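/- **Setting.** Let $F_0\subset\mathbb{R}^3$ be a smooth embedded orientable surface (without boundary, not necessarily compact or connected) with continuous unit normal field $\nu$, and let $\gamma\subset F_0$ be a smooth embedded closed curve, regularly parametrized with period $1$, whose tangent vector $\dot\gamma=(\dot x,\dot y,\dot z)$ is never vertical (never parallel to the $z$-axis). Two framings of $\gamma$ are considered: the surface normal framing $\nu\circ\gamma$, and the blackboard framing $\beta=(-\dot y,\dot x,0)/\sqrt{\dot x^2+\dot y^2}$, the unit horizontal normal field along $\gamma$. For disjoint closed curves $a,b$ of period $1$ let $$\operatorname{lk}(a,b)=\frac1{4\pi}\int_0^1\!\!\int_0^1\frac{\det\big(\dot a(s),\dot b(t),a(s)-b(t)\big)}{\|a(s)-b(t)\|^3}\,dt\,ds$$ be their linking number. The writhe is $w(\gamma)=\lim_{\epsilon\to0^+}\operatorname{lk}(\gamma,\gamma+\epsilon\beta)$ and the surface linking number is $\lambda(\gamma,F_0)=\lim_{\epsilon\to0^+}\operatorname{lk}(\gamma,\gamma+\epsilon\,\nu\circ\gamma)$. The closed curve $\gamma$ is a *profile curve* of a smooth surface $F$ if it is a connected component of the set of points of $F$ at which the tangent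 plane of $F$ is vertical (contains the vertical direction). An isotopy of $F_0$ fixing $\gamma$ is a smooth family $\Phi_t$, $0\le t\le1$, of smooth embeddings $F_0\to\mathbb{R}^3$, with $\Phi_0$ the inclusion and every $\Phi_t$ fixing every point of $\gamma$; it ends at the surface $F_1=\Phi_1(F_0)$. **Theorem 3.1.** For all sufficiently small $\epsilon>0$ the push-offs $\gamma+\epsilon\beta$ and $\gamma+\epsilon\,\nu\circ\gamma$ are disjoint from $\gamma$ and their linking numbers with $\gamma$ are equal to $w(\gamma)$ and $\lambda(\gamma,F_0)$ respectively (so these are well defined). There is an isotopy of $F_0$ fixing $\gamma$ that ends at a surface $F_1$ having $\gamma$ as a profile curve if and only if $$w(\gamma)=\lambda(\gamma,F_0).$$ Moreover: * if there is an isotopy of $F_0$ fixing $\gamma$ that ends at a surface $F_1$ whose tangent plane is vertical at every point of $\gamma$, then already $w(\gamma)=\lambda(\gamma,F_0)$; * if $w(\gamma)=\lambda(\gamma,F_0)$, then there is a smooth ambient isotopy of $\mathbb{R}^3$ (through diffeomorphisms, starting at the identity) fixing every point of $\gamma$ that carries $F_0$ to a surface $F_1$ having $\gamma$ as a profile curve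 and whose projection to the $xy$-plane has a fold at each point of $\gamma$: the tangent plane of $F_1$ there is vertical, and the normal curvature of $F_1$ in the vertical direction is non-zero. -/

import Mathlib

open Set Filter Topology
open scoped ContDiff

noncomputable section

/-- Euclidean three-space; the vertical direction is the third coordinate direction. -/
abbrev Space : Type := EuclideanSpace ℝ (Fin 3)

/-- The vertical unit vector. -/
def vert : Space := !₂[0, 0, 1]

/-! ### Surfaces -/

/-- `F` is a smooth embedded surface (without boundary) in three-space: it is locally a regular
level set of a smooth function. It need be neither compact, nor connected, nor a closed subset. -/
def IsSmoothSurface (F : Set Space) : Prop :=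
  ∀ p ∈ F, ∃ (U : Set Space) (f : Space → ℝ), IsOpen U ∧ p ∈ U ∧ ContDiffOn ℝ ∞ f U ∧
    (∀ q ∈ U, fderiv ℝ f q ≠ 0) ∧ F ∩ U = {q ∈ U | f q = 0}

/-- The tangent plane of `F` at `p`, as a set of vectors. At a point of a smooth surface this
tangent cone is the usual tangent plane (the kernel of the differential of a local defining
function). -/
def tangentPlane (F : Set Space) (p : Space) : Set Space := tangentConeAt ℝ F p

/-- `ν` is a continuous (hence smooth) unit normal vector field on `F`; for a smooth surface `F`,
such a field exists if and only if `F` is orientable, and it amounts to an orientation. -/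
structure IsUnitNormalField (F : Set Space) (ν : Space → Space) : Prop where
  continuousOn : ContinuousOn ν F
  norm_eq_one : ∀ p ∈ F, ‖ν p‖ = 1
  normal : ∀ p ∈ F, ∀ v ∈ tangentPlane F p, inner ℝ v (ν p) = 0

/-! ### Curves -/

/-- `γ` is (a parametrization, with period `1`, of) a smooth embedded closed curve. -/
structure IsEmbeddedClosedCurve (γ : ℝ → Space) : Prop where
  contDiff : ContDiff ℝ ∞ γ
  periodic : Function.Periodic γ 1
  injOn : InjOn γ (Ico 0 1)
  deriv_ne_zero : ∀ t, deriv γ t ≠ 0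

/-- The tangent vector of `γ` is never vertical. -/
def NowhereVertical (γ : ℝ → Space) : Prop :=
  ∀ t, deriv γ t ∉ Submodule.span ℝ {vert}

/-- The linking number of two disjoint closed curves of period `1`, as the Gauss linking
integral `(4π)⁻¹ ∬ det (a'(s), b'(t), a(s) - b(t)) / ‖a(s) - b(t)‖³ ds dt`. -/
def linkingNumber (a b : ℝ → Space) : ℝ :=
  (4 * Real.pi)⁻¹ * ∫ s in (0 : ℝ)..1, ∫ t in (0 : ℝ)..1,
    (Matrix.of ![(deriv a s).ofLp, (deriv b t).ofLp, (a s - b t).ofLp]).det / ‖a s - b t‖ ^ 3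

/-- The push-off of `γ` by `ε` along the vector field `n` along `γ`. -/
def pushOff (γ n : ℝ → Space) (ε : ℝ) : ℝ → Space := fun t => γ t + ε • n t

/-- The blackboard framing of a curve with no vertical tangents: the unit horizontal vector
field along the curve normal to its velocity `(x', y', z')`, obtained by lifting the unit normal
`(-y', x') / ‖(x', y')‖` of the projection to the `xy`-plane. -/
def blackboardFraming (γ : ℝ → Space) : ℝ → Space := fun t =>
  (Real.sqrt (deriv γ t 0 ^ 2 + deriv γ t 1 ^ 2))⁻¹ • !₂[-(deriv γ t 1), deriv γ t 0, 0]

/-- The surface normal framing: the restriction to `γ` of the unit normal field of a surface. -/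
def surfaceFraming (γ : ℝ → Space) (ν : Space → Space) : ℝ → Space := fun t => ν (γ t)

/-- The linking number of `γ` with its push-off along `n` by a small `ε > 0`: the limit as
`ε → 0⁺`. -/
def framingNumber (γ n : ℝ → Space) : ℝ :=
  limUnder (𝓝[>] (0 : ℝ)) fun ε => linkingNumber γ (pushOff γ n ε)

/-- The writhe `w(γ)`. -/
def writhe (γ : ℝ → Space) : ℝ := framingNumber γ (blackboardFraming γ)

/-- The surface linking number `λ(γ, F)` of a curve on a surface `F` with unit normal `ν`. -/
def surfaceLinkingNumber (γ : ℝ → Space) (ν : Space → Space) : ℝ :=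
  framingNumber γ (surfaceFraming γ ν)

/-! ### Profile curves -/

/-- The set of points of `F` at which the tangent plane is vertical. -/
def verticalLocus (F : Set Space) : Set Space := {p ∈ F | vert ∈ tangentPlane F p}

/-- `γ` is a profile curve of `F`: it is one of the curves that form the set of points of `F`
with vertical tangent plane, that is, a connected component of this set. -/
def IsProfileCurve (γ : ℝ → Space) (F : Set Space) : Prop :=
  range γ = connectedComponentIn (verticalLocus F) (γ 0)

/-- The projection of the surface `F` to the `xy`-plane has a fold at `p`: the tangent plane at `p`
is vertical, and the normal curvature of `F` at `p` in the vertical direction is non-zero, that is,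
a curve in `F` with vertical velocity at `p` has an acceleration at `p` not tangent to `F`.
(The normal component of this acceleration is the same for all such curves.) -/
def IsFoldPoint (F : Set Space) (p : Space) : Prop :=
  p ∈ verticalLocus F ∧ ∃ c : ℝ → Space, ContDiff ℝ ∞ c ∧ (∀ᶠ t in 𝓝 0, c t ∈ F) ∧
    c 0 = p ∧ deriv c 0 = vert ∧ deriv (deriv c) 0 ∉ tangentPlane F p

/-! ### Isotopies -/

/-- `f` restricts to a smooth embedding of the surface `F`: a topological embedding that is
smooth and has injective differential on each tangent plane. -/
structure IsSmoothEmbeddingOn (F : Set Space) (f : Space → Space) : Prop where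
  contDiffOn : ContDiffOn ℝ ∞ f F
  isEmbedding : IsEmbedding (F.domRestrict f)
  immersion : ∀ p ∈ F, ∀ v ∈ tangentPlane F p, fderivWithin ℝ f F p v = 0 → v = 0

/-- `Φ t`, `0 ≤ t ≤ 1`, is a smooth isotopy of the surface `F` (through embeddings, starting at
the inclusion) that fixes every point of `γ`. It ends at the surface `Φ 1 '' F`. -/
structure IsIsotopyFixing (F : Set Space) (γ : ℝ → Space) (Φ : ℝ → Space → Space) : Prop where
  contDiffOn : ContDiffOn ℝ ∞ (fun x : ℝ × Space => Φ x.1 x.2) (Icc 0 1 ×ˢ F)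
  embedding : ∀ t ∈ Icc (0 : ℝ) 1, IsSmoothEmbeddingOn F (Φ t)
  start : ∀ p ∈ F, Φ 0 p = p
  fixes : ∀ t ∈ Icc (0 : ℝ) 1, ∀ s, Φ t (γ s) = γ s

/-- `Φ t`, `0 ≤ t ≤ 1`, is a smooth ambient isotopy of three-space (through diffeomorphisms,
starting at the identity) that fixes every point of `γ`. -/
structure IsAmbientIsotopyFixing (γ : ℝ → Space) (Φ : ℝ → Space → Space) : Prop where
  contDiffOn : ContDiffOn ℝ ∞ (fun x : ℝ × Space => Φ x.1 x.2) (Icc 0 1 ×ˢ univ)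
  diffeo : ∀ t ∈ Icc (0 : ℝ) 1, ContDiff ℝ ∞ (Φ t) ∧ ∃ g : Space → Space, ContDiff ℝ ∞ g ∧
    Function.LeftInverse g (Φ t) ∧ Function.RightInverse g (Φ t)
  start : ∀ p, Φ 0 p = p
  fixes : ∀ t ∈ Icc (0 : ℝ) 1, ∀ s, Φ t (γ s) = γ s

end

/-! Along `γ` the horizontal field β (`blackboardFraming`) and the field b (`binormal`) form an
orthonormal frame of the normal planes. Hence ν ∘ γ = cos θ β + sin θ b for a smooth angle θ with
θ(t + 1) = θ(t) + 2πk (`exists_normal_angle`), and every condition in the theorem amounts to k = 0.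

Linking numbers: by Fubini the Gauss integral of `γ` and a push-off is a circulation of the
Biot–Savart field of `γ`, which is curl free off `γ` because `γ` is closed. The parameters (radius,
position, angle) of a punctured tube range over a convex set, so the pulled-back field has a
potential there; it changes by constants a and m when the position or the angle goes through a
period. A push-off of winding number k at any small radius thus has linking number (a + km)/4π
(`linkingNumber_tube`). Here m is the circulation around a meridian of any small radius. As the
radius shrinks, the rescaled integrand tends to the positive integrand of a straight line, so m ≠ 0
(`potential_meridian_ne_zero`). Therefore w = λ exactly when k = 0, and the value of m is never
needed.

Necessity of k = 0: let μ be the unit tangent field of the surface along `γ` orthogonal to the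
velocity. Since `Φ r` is an immersion fixing `γ`, the image of μ under its differential is never
parallel to the velocity, and its normal part is a homotopy of nonvanishing plane fields. If the
last surface is vertical along `γ`, this part ends in the directions ±b. Squaring removes the sign,
so the square of the initial field, whose angle is 2θ up to a constant, has winding number 0
(`IsIsotopyFixing.winding_eq_zero`).

Sufficiency: if k = 0, then θ is periodic and can be scaled down to 0 in small steps. Each step is
realized by a map p + g(p) with g = 0 on `γ` and ‖Dg‖ ≤ 1/2, which is a diffeomorphism
(`exists_rotation`). Now b is tangent to the surface, so its tangent planes along `γ` are vertical.
A perturbation of second order adds normal curvature until it cannot vanish (`exists_fold`). At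
folds the two equations of the vertical locus are independent, so the locus coincides with `γ` near
`γ`; being closed and relatively open in it, `γ` is a component (`isProfileCurve_of_isFoldPoint`).
-/

/-! ### Local inverses and local retractions -/

/-- The inverse function theorem for maps that are smooth on an open set. -/
theorem exists_openPartialHomeomorph_of_injective_fderiv {E : Type*} [NormedAddCommGroup E]
    [NormedSpace ℝ E] [FiniteDimensional ℝ E] {G : E → E} {U : Set E} {p : E} (hU : IsOpen U)
    (hp : p ∈ U) (hG : ContDiffOn ℝ ∞ G U) (hinj : Function.Injective (fderiv ℝ G p)) :
    ∃ Φ : OpenPartialHomeomorph E E, (Φ : E → E) = G ∧ p ∈ Φ.source ∧ Φ.source ⊆ U ∧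
      ContDiffOn ℝ ∞ Φ.symm Φ.target := by
  have : CompleteSpace E := FiniteDimensional.complete ℝ E
  have hGat : ∀ x ∈ U, ContDiffAt ℝ ∞ G x := fun x hx => hG.contDiffAt (hU.mem_nhds hx)
  have hder : ∀ x ∈ U, HasFDerivAt G (fderiv ℝ G x) x := fun x hx =>
    ((hGat x hx).differentiableAt (by simp)).hasFDerivAt
  let e : E ≃L[ℝ] E :=
    (LinearEquiv.ofInjectiveEndo (fderiv ℝ G p : E →ₗ[ℝ] E) hinj).toContinuousLinearEquiv
  have he : (e : E →L[ℝ] E) = fderiv ℝ G p := by ext x; rfl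
  have hep : HasFDerivAt G (e : E →L[ℝ] E) p := he ▸ hder p hp
  let Ψ := (hGat p hp).toOpenPartialHomeomorph G hep (by simp)
  have hΨ : (Ψ : E → E) = G := rfl
  have hcont : ContinuousOn (fderiv ℝ G) U := hG.continuousOn_fderiv_of_isOpen hU (by simp)
  -- Shrinking the source to the points with invertible derivative, an open condition, makes the
  -- inverse smooth on its whole target and not only near the image of `p`.
  have hN : IsOpen (U ∩ fderiv ℝ G ⁻¹' (range ((↑) : (E ≃L[ℝ] E) → E →L[ℝ] E))) :=
    hcont.isOpen_inter_preimage hU ContinuousLinearEquiv.isOpen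
  refine ⟨Ψ.restrOpen _ hN, by simpa using hΨ, ?_, ?_, ?_⟩
  · rw [OpenPartialHomeomorph.restrOpen_source]
    exact ⟨(hGat p hp).mem_toOpenPartialHomeomorph_source hep (by simp), hp, ⟨e, he⟩⟩
  · rw [OpenPartialHomeomorph.restrOpen_source]
    exact fun x hx => hx.2.1
  · intro y hy
    have hx := (Ψ.restrOpen _ hN).map_target hy
    rw [OpenPartialHomeomorph.restrOpen_source] at hx
    obtain ⟨-, hxU, e', he'⟩ := hx
    refine ((Ψ.restrOpen _ hN).contDiffAt_symm (f₀' := e') hy ?_ ?_).contDiffWithinAt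
    · rw [he']; exact hder _ hxU
    · exact hGat _ hxU

/-- Near each of its points a smooth surface is a retract of space. The derivative of the
retraction at the point is a projection to the kernel of the differential of a defining function. -/
theorem IsSmoothSurface.exists_retraction {U : Set Space} {f : Space → ℝ} {p : Space}
    (hU : IsOpen U) (hpU : p ∈ U) (hf : ContDiffOn ℝ ∞ f U) (hf' : fderiv ℝ f p ≠ 0)
    (hfp : f p = 0) :
    ∃ (W : Set Space) (R : Space → Space) (n : Space), IsOpen W ∧ p ∈ W ∧ W ⊆ U ∧
      ContDiffOn ℝ ∞ R W ∧
      (∀ x ∈ W, R x ∈ U ∧ f (R x) = 0) ∧ (∀ x ∈ W, f x = 0 → R x = x) ∧ fderiv ℝ f p n = 1 ∧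
      ∀ v, fderiv ℝ R p v = v - fderiv ℝ f p v • n := by
  set L := fderiv ℝ f p with hL
  obtain ⟨n, hn⟩ : ∃ n, L n = 1 := by
    obtain ⟨v, hv⟩ : ∃ v, L v ≠ 0 := by
      by_contra! h; exact hf' (by ext v; simpa using h v)
    exact ⟨(L v)⁻¹ • v, by simp [hv]⟩
  have hfat : HasFDerivAt f L p :=
    ((hf.contDiffAt (hU.mem_nhds hpU)).differentiableAt (by simp)).hasFDerivAt
  -- `H` is tangent to the identity at `p` and satisfies `L (H x - p) = f x`, so it flattens the
  -- level sets of `f` to parallel planes. The retraction is the projection along `n` to the plane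
  -- of level 0, conjugated by `H`.
  set H : Space → Space := fun x => x + (f x - L (x - p)) • n with hH
  have hHc : ContDiffOn ℝ ∞ H U :=
    contDiffOn_id.add ((hf.sub (L.contDiff.comp (contDiff_id.sub contDiff_const)).contDiffOn).smul
      contDiffOn_const)
  have hHder : HasFDerivAt H (ContinuousLinearMap.id ℝ Space) p := by
    have h1 : HasFDerivAt (fun x => L (x - p)) L p :=
      L.hasFDerivAt.comp p ((hasFDerivAt_id p).sub_const p)
    have := (hasFDerivAt_id p).add ((hfat.sub h1).smul_const n)
    refine this.congr_fderiv ?_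
    ext v; simp
  have hHp : H p = p := by simp [hH, hfp]
  obtain ⟨Φ, hΦ, hpΦ, hΦU, hΦs⟩ := exists_openPartialHomeomorph_of_injective_fderiv hU hpU hHc
    (by rw [hHder.fderiv]; exact Function.injective_id)
  have hLH : ∀ x, L (H x - p) = f x := by
    intro x
    simp only [hH, map_sub, map_add, map_smul, hn, smul_eq_mul]; ring
  have hqc : ContDiffOn ℝ ∞ (fun x => H x - f x • n) U := hHc.sub (hf.smul contDiffOn_const)
  set W := U ∩ (fun x => H x - f x • n) ⁻¹' Φ.target ∩ Φ.source with hW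
  have hWo : IsOpen W :=
    (hqc.continuousOn.isOpen_inter_preimage hU Φ.open_target).inter Φ.open_source
  have hΦp : Φ p = p := by rw [hΦ]; exact hHp
  have hpt : p ∈ Φ.target := by have := Φ.map_source hpΦ; rwa [hΦp] at this
  have hpW : p ∈ W := by
    refine ⟨⟨hpU, ?_⟩, hpΦ⟩
    simpa [hHp, hfp] using hpt
  refine ⟨W, fun x => Φ.symm (H x - f x • n), n, hWo, hpW, fun x hx => hx.1.1, ?_, ?_, ?_, hn, ?_⟩
  · exact hΦs.comp (hqc.mono fun x hx => hx.1.1) fun x hx => hx.1.2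
  · intro x hx
    refine ⟨hΦU (Φ.map_target hx.1.2), ?_⟩
    have h1 : H (Φ.symm (H x - f x • n)) = H x - f x • n := by
      have := Φ.right_inv hx.1.2
      rwa [hΦ] at this
    rw [← hLH, h1]
    have : H x - f x • n - p = (H x - p) - f x • n := by abel
    rw [this, map_sub, hLH, map_smul, hn]; simp
  · intro x hx hfx
    have := Φ.left_inv hx.2
    simp only [hfx, zero_smul, sub_zero]
    rwa [hΦ] at this
  · intro v
    have hs : HasFDerivAt Φ.symm (ContinuousLinearMap.id ℝ Space) p := by
      have := Φ.hasFDerivAt_symm (f' := ContinuousLinearEquiv.refl ℝ Space) hpt (by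
        have h2 : Φ.symm p = p := by
          have := Φ.left_inv hpΦ; rwa [hΦp] at this
        rw [h2, hΦ]; exact hHder)
      exact this
    have hq : HasFDerivAt (fun x => H x - f x • n)
        (ContinuousLinearMap.id ℝ Space - L.smulRight n) p := hHder.sub (hfat.smul_const n)
    have h3 : HasFDerivAt Φ.symm (ContinuousLinearMap.id ℝ Space) (H p - f p • n) := by
      simpa [hHp, hfp] using hs
    have := (h3.comp p hq).fderiv
    simp only [Function.comp_def] at this
    rw [this]; simp

/-! ### Tangent planes, local retractions and curves of a smooth surface. -/

namespace IsSmoothSurface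

variable {F : Set Space} {p : Space}

/-- The tangent plane of a regular level set is the kernel of the differential. -/
theorem tangentPlane_eq {U : Set Space} {f : Space → ℝ} (hU : IsOpen U) (hpU : p ∈ U)
    (hf : ContDiffOn ℝ ∞ f U) (hf' : fderiv ℝ f p ≠ 0) (hFU : F ∩ U = {q ∈ U | f q = 0})
    (hp : p ∈ F) : tangentPlane F p = {v | fderiv ℝ f p v = 0} := by
  have hfp : f p = 0 := (hFU.subset ⟨hp, hpU⟩).2
  have hfat : HasFDerivAt f (fderiv ℝ f p) p :=
    ((hf.contDiffAt (hU.mem_nhds hpU)).differentiableAt (by simp)).hasFDerivAt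
  rw [tangentPlane, ← tangentConeAt_inter_nhds (hU.mem_nhds hpU), hFU]
  apply Subset.antisymm
  · intro v hv
    have h1 : HasFDerivWithinAt f (0 : Space →L[ℝ] ℝ) {q ∈ U | f q = 0} p :=
      (hasFDerivWithinAt_const (0 : ℝ) p _).congr (fun x hx => hx.2) hfp
    have := hfat.hasFDerivWithinAt.unique_on h1 hv
    simpa using this
  -- Every vector is tangent to the open set `W`, and `R` maps `W` into the surface; its
  -- differential at `p` fixes the kernel of `fderiv ℝ f p`.
  · obtain ⟨W, R, n, hW, hpW, hWU, hR, hRF, hRid, hn, hRd⟩ :=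
      exists_retraction hU hpU hf hf' hfp
    intro v hv
    have hRat : HasFDerivAt R (fderiv ℝ R p) p :=
      ((hR.contDiffAt (hW.mem_nhds hpW)).differentiableAt (by simp)).hasFDerivAt
    have h2 := (hRat.hasFDerivWithinAt (s := W)).mapsTo_tangent_cone
      (show v ∈ tangentConeAt ℝ W p by
        rw [tangentConeAt_of_mem_nhds (hW.mem_nhds hpW)]; trivial)
    rw [hRd v, show fderiv ℝ f p v = 0 from hv, zero_smul, sub_zero, hRid p hpW hfp] at h2
    refine tangentConeAt_mono ?_ h2
    rintro _ ⟨x, hx, rfl⟩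
    exact hRF x hx

/-- A smooth surface is the zero set of a smooth function near each of its points, and its tangent
planes are the kernels of the differential. -/
theorem exists_equation (hF : IsSmoothSurface F) (hp : p ∈ F) :
    ∃ (U : Set Space) (f : Space → ℝ), IsOpen U ∧ p ∈ U ∧ ContDiffOn ℝ ∞ f U ∧
      (∀ q ∈ U, fderiv ℝ f q ≠ 0) ∧ (F ∩ U = {q ∈ U | f q = 0}) ∧
      ∀ q ∈ U, f q = 0 → q ∈ F ∧ tangentPlane F q = {v | fderiv ℝ f q v = 0} := by
  obtain ⟨U, f, hU, hpU, hf, hf', hFU⟩ := hF p hp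
  refine ⟨U, f, hU, hpU, hf, hf', hFU, fun q hq hfq => ?_⟩
  have hqF : q ∈ F := (hFU.symm.subset ⟨hq, hfq⟩).1
  exact ⟨hqF, tangentPlane_eq hU hq hf (hf' q hq) hFU hqF⟩

/-- The tangent plane is the kernel of a nonzero functional. -/
theorem exists_functional (hF : IsSmoothSurface F) (hp : p ∈ F) :
    ∃ L : Space →L[ℝ] ℝ, L ≠ 0 ∧ tangentPlane F p = {v | L v = 0} := by
  obtain ⟨U, f, hU, hpU, hf, hf', hFU, hq⟩ := hF.exists_equation hp
  exact ⟨_, hf' p hpU, (hq p hpU (hFU.subset ⟨hp, hpU⟩).2).2⟩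

/-- Local retractions onto a smooth surface; their derivatives fix tangent vectors. -/
theorem exists_local_retraction (hF : IsSmoothSurface F) (hp : p ∈ F) :
    ∃ (W : Set Space) (R : Space → Space), IsOpen W ∧ p ∈ W ∧ ContDiffOn ℝ ∞ R W ∧
      MapsTo R W F ∧ (∀ x ∈ W, x ∈ F → R x = x) ∧
      ∀ x ∈ W, x ∈ F → ∀ v ∈ tangentPlane F x, fderiv ℝ R x v = v := by
  obtain ⟨U, f, hU, hpU, hf, hf', hFU, hq⟩ := hF.exists_equation hp
  obtain ⟨W, R, n, hW, hpW, hWU, hR, hRF, hRid, hn, hRd⟩ :=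
    exists_retraction hU hpU hf (hf' p hpU) (hFU.subset ⟨hp, hpU⟩).2
  have hid : ∀ x ∈ W, x ∈ F → R x = x := fun x hx hxF =>
    hRid x hx (hFU.subset ⟨hxF, hWU hx⟩).2
  refine ⟨W, R, hW, hpW, hR, fun x hx => (hq _ (hRF x hx).1 (hRF x hx).2).1, hid, ?_⟩
  intro x hx hxF v hv
  have hRat : HasFDerivAt R (fderiv ℝ R x) x :=
    ((hR.contDiffAt (hW.mem_nhds hx)).differentiableAt (by simp)).hasFDerivAt
  have h1 : HasFDerivWithinAt R (ContinuousLinearMap.id ℝ Space) (F ∩ W) x :=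
    (hasFDerivWithinAt_id x _).congr (fun y hy => hid y hy.2 hy.1) (hid x hx hxF)
  have hv' : v ∈ tangentConeAt ℝ (F ∩ W) x := by
    rwa [tangentConeAt_inter_nhds (hW.mem_nhds hx)]
  exact hRat.hasFDerivWithinAt.unique_on h1 hv'

/-- A smooth curve in space, with prescribed position and velocity at `0`, contained in a given
open set. -/
theorem _root_.exists_curve_mem_open {W : Set Space} (hW : IsOpen W) (hp : p ∈ W) (v : Space) :
    ∃ c : ℝ → Space, ContDiff ℝ ∞ c ∧ (∀ t, c t ∈ W) ∧ c 0 = p ∧ HasDerivAt c v 0 := by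
  obtain ⟨r, hr, hrW⟩ := Metric.isOpen_iff.1 hW p hp
  -- The curve has to stay in `W` for all times, so the line `p + t • v` is replaced by `p + k sin(t
  -- / k) • v`, which has the same velocity at 0 and moves by at most `k * ‖v‖ < r`.
  set k : ℝ := r / (2 * (‖v‖ + 1)) with hk
  have hv : 0 < ‖v‖ + 1 := by positivity
  have hk0 : 0 < k := by positivity
  refine ⟨fun t => p + (k * Real.sin (t / k)) • v, by fun_prop, fun t => hrW ?_, by simp, ?_⟩
  · rw [mem_ball_iff_norm, add_sub_cancel_left, norm_smul, Real.norm_eq_abs, abs_mul,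
      abs_of_pos hk0]
    calc k * |Real.sin (t / k)| * ‖v‖ ≤ k * 1 * ‖v‖ := by
          gcongr; exact Real.abs_sin_le_one _
      _ < k * (2 * (‖v‖ + 1)) := by nlinarith [norm_nonneg v]
      _ = r := by rw [hk]; field_simp
  · have h1 : HasDerivAt (fun t : ℝ => k * Real.sin (t / k)) 1 0 := by
      have := ((Real.hasDerivAt_sin ((0:ℝ) / k)).comp (0:ℝ)
        ((hasDerivAt_id (0:ℝ)).div_const k)).const_mul k
      refine this.congr_deriv ?_
      simp [hk0.ne']
    simpa using (h1.smul_const v).const_add p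

/-- Every tangent vector is the velocity of a smooth curve in the surface. -/
theorem exists_curve (hF : IsSmoothSurface F) (hp : p ∈ F) {v : Space}
    (hv : v ∈ tangentPlane F p) :
    ∃ c : ℝ → Space, ContDiff ℝ ∞ c ∧ (∀ t, c t ∈ F) ∧ c 0 = p ∧ HasDerivAt c v 0 := by
  obtain ⟨W, R, hW, hpW, hR, hRF, hRid, hRd⟩ := hF.exists_local_retraction hp
  obtain ⟨c, hc, hcW, hc0, hcd⟩ := exists_curve_mem_open hW hpW v
  refine ⟨R ∘ c, ?_, fun t => hRF (hcW t), by simp [hc0, hRid p hpW hp], ?_⟩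
  · exact contDiffOn_univ.1 (hR.comp hc.contDiffOn fun t _ => hcW t)
  · have hRat : HasFDerivAt R (fderiv ℝ R p) (c 0) := by
      rw [hc0]
      exact ((hR.contDiffAt (hW.mem_nhds hpW)).differentiableAt (by simp)).hasFDerivAt
    have := hRat.comp_hasDerivAt 0 hcd
    rwa [hRd p hpW hp v hv] at this

/-- The velocity of a curve in a surface is tangent to the surface. -/
theorem _root_.mem_tangentPlane_of_hasDerivAt {c : ℝ → Space} {v : Space} {t₀ : ℝ}
    (hcF : ∀ᶠ t in 𝓝 t₀, c t ∈ F) (hc : HasDerivAt c v t₀) : v ∈ tangentPlane F (c t₀) := by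
  obtain ⟨S, hS, hSo, htS⟩ := eventually_nhds_iff.1 hcF
  have h2 := (hc.hasFDerivAt.hasFDerivWithinAt (s := S)).mapsTo_tangent_cone
    (show (1 : ℝ) ∈ tangentConeAt ℝ S t₀ by
      rw [tangentConeAt_of_mem_nhds (hSo.mem_nhds htS)]; trivial)
  rw [ContinuousLinearMap.toSpanSingleton_apply, one_smul] at h2
  refine tangentConeAt_mono ?_ h2
  rintro _ ⟨x, hx, rfl⟩
  exact hS x hx

/-- Differentiating the equation of the surface along a curve in it twice. -/
theorem _root_.fderiv_fderiv_add_eq_zero {U : Set Space} {f : Space → ℝ} (hU : IsOpen U)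
    (hpU : p ∈ U) (hf : ContDiffOn ℝ ∞ f U) {c : ℝ → Space} (hc : ContDiff ℝ ∞ c) (hc0 : c 0 = p)
    (hcf : ∀ᶠ t in 𝓝 0, f (c t) = 0) :
    fderiv ℝ (fderiv ℝ f) p (deriv c 0) (deriv c 0) + fderiv ℝ f p (deriv (deriv c) 0) = 0 := by
  have hcd : ∀ t, HasDerivAt c (deriv c t) t := fun t =>
    (hc.differentiable (by simp) t).hasDerivAt
  have hcU : ∀ᶠ t in 𝓝 0, c t ∈ U :=
    hc.continuous.continuousAt.eventually_mem (by rw [hc0]; exact hU.mem_nhds hpU)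
  have hfd : ∀ x ∈ U, HasFDerivAt f (fderiv ℝ f x) x := fun x hx =>
    ((hf.contDiffAt (hU.mem_nhds hx)).differentiableAt (by simp)).hasFDerivAt
  have h1 : ∀ᶠ t in 𝓝 (0:ℝ), fderiv ℝ f (c t) (deriv c t) = 0 := by
    filter_upwards [hcU, hcf.eventually_nhds] with t ht hft
    have h2 := (hfd _ ht).comp_hasDerivAt t (hcd t)
    have h3 : HasDerivAt (f ∘ c) 0 t := (hasDerivAt_const t (0:ℝ)).congr_of_eventuallyEq hft
    exact h2.unique h3
  have hf2 : HasFDerivAt (fderiv ℝ f) (fderiv ℝ (fderiv ℝ f) p) (c 0) := by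
    rw [hc0]
    have : ContDiffOn ℝ ∞ (fderiv ℝ f) U := hf.fderiv_of_isOpen hU (by simp)
    exact ((this.contDiffAt (hU.mem_nhds hpU)).differentiableAt (by simp)).hasFDerivAt
  have hc2 : HasDerivAt (deriv c) (deriv (deriv c) 0) 0 := by
    have : ContDiff ℝ ∞ (deriv c) := by
      have := (contDiff_infty_iff_deriv.1 hc).2; exact this
    exact (this.differentiable (by simp) 0).hasDerivAt
  have h4 := (hf2.comp_hasDerivAt 0 (hcd 0)).clm_apply hc2
  have h5 : HasDerivAt (fun t => fderiv ℝ f (c t) (deriv c t)) 0 0 :=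
    (hasDerivAt_const (0:ℝ) (0:ℝ)).congr_of_eventuallyEq h1
  have := h4.unique h5
  rwa [Function.comp_apply, hc0] at this

end IsSmoothSurface

/-! ### The cross product -/

/-- The cross product of two vectors in space. -/
def cross (a b : Space) : Space :=
  !₂[a 1 * b 2 - a 2 * b 1, a 2 * b 0 - a 0 * b 2, a 0 * b 1 - a 1 * b 0]

theorem inner_eq_coords (a b : Space) : inner ℝ a b = a 0 * b 0 + a 1 * b 1 + a 2 * b 2 := by
  simp [PiLp.inner_apply, Fin.sum_univ_three]; ring

theorem norm_sq_eq_coords (a : Space) : ‖a‖ ^ 2 = a 0 ^ 2 + a 1 ^ 2 + a 2 ^ 2 := by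
  rw [← real_inner_self_eq_norm_sq, inner_eq_coords]; ring

theorem inner_cross_left (a b : Space) : inner ℝ a (cross a b) = 0 := by
  simp [inner_eq_coords, cross]; ring

theorem inner_cross_right (a b : Space) : inner ℝ b (cross a b) = 0 := by
  simp [inner_eq_coords, cross]; ring

theorem norm_cross_sq (a b : Space) :
    ‖cross a b‖ ^ 2 = ‖a‖ ^ 2 * ‖b‖ ^ 2 - inner ℝ a b ^ 2 := by
  simp [inner_eq_coords, norm_sq_eq_coords, cross]; ring

theorem cross_smul_left (r : ℝ) (a b : Space) : cross (r • a) b = r • cross a b := by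
  ext i; fin_cases i <;> simp [cross] <;> ring

theorem ContDiff.cross {E : Type*} [NormedAddCommGroup E] [NormedSpace ℝ E] {f g : E → Space}
    {n : ℕ∞ω} (hf : ContDiff ℝ n f) (hg : ContDiff ℝ n g) :
    ContDiff ℝ n fun x => cross (f x) (g x) := by
  rw [contDiff_euclidean] at hf hg ⊢
  intro i
  have h0 := hf 0; have h1 := hf 1; have h2 := hf 2
  have k0 := hg 0; have k1 := hg 1; have k2 := hg 2
  fin_cases i <;> simp [_root_.cross] <;> fun_prop

/-- Expansion of a vector in an orthonormal frame completed by the cross product. -/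
theorem eq_add_of_orthonormal {u w : Space} (hu : ‖u‖ = 1) (hw : ‖w‖ = 1) (huw : inner ℝ u w = 0)
    (v : Space) :
    v = inner ℝ u v • u + inner ℝ w v • w + inner ℝ (cross u w) v • cross u w := by
  have hn : ‖cross u w‖ = 1 := by
    have := norm_cross_sq u w
    rw [hu, hw, huw] at this
    nlinarith [norm_nonneg (cross u w)]
  have ho : Orthonormal ℝ ![u, w, cross u w] := by
    have e1 := inner_cross_left u w
    have e2 := inner_cross_right u w
    have e3 : inner ℝ w u = 0 := by rw [real_inner_comm]; exact huw
    have e4 : inner ℝ (cross u w) u = 0 := by rw [real_inner_comm]; exact e1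
    have e5 : inner ℝ (cross u w) w = 0 := by rw [real_inner_comm]; exact e2
    constructor
    · intro i; fin_cases i <;> simp [hu, hw, hn]
    · intro i j hij
      fin_cases i <;> fin_cases j <;> first | exact absurd rfl hij | simp [*]
  let B := (basisOfOrthonormalOfCardEqFinrank ho (by simp)).toOrthonormalBasis (by simpa using ho)
  have := (B.sum_repr' v).symm
  simpa [B, Fin.sum_univ_three] using this

/-! ### The frame of a curve -/

theorem IsEmbeddedClosedCurve.contDiff_deriv {γ : ℝ → Space} (hγ : IsEmbeddedClosedCurve γ) :
    ContDiff ℝ ∞ (deriv γ) := (contDiff_infty_iff_deriv.1 hγ.contDiff).2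

theorem IsEmbeddedClosedCurve.hasDerivAt {γ : ℝ → Space} (hγ : IsEmbeddedClosedCurve γ) (t : ℝ) :
    HasDerivAt γ (deriv γ t) t := (hγ.contDiff.differentiable (by simp) t).hasDerivAt

theorem Function.Periodic.deriv {E : Type*} [NormedAddCommGroup E] [NormedSpace ℝ E] {f : ℝ → E}
    {c : ℝ} (hf : Function.Periodic f c) : Function.Periodic (deriv f) c := by
  intro x
  rw [← deriv_comp_add_const]
  congr 1
  exact funext hf

/-- The unit normal vector field along `γ` orthogonal to the blackboard framing. -/
noncomputable def binormal (γ : ℝ → Space) (t : ℝ) : Space :=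
  ‖deriv γ t‖⁻¹ • cross (deriv γ t) (blackboardFraming γ t)

/-- The unit normal vector at angle `φ` to the blackboard framing. -/
noncomputable def frameVec (γ : ℝ → Space) (t φ : ℝ) : Space :=
  Real.cos φ • blackboardFraming γ t + Real.sin φ • binormal γ t

section Frame

variable {γ : ℝ → Space}

theorem NowhereVertical.pos (h : NowhereVertical γ) (t : ℝ) :
    0 < deriv γ t 0 ^ 2 + deriv γ t 1 ^ 2 := by
  by_contra! hle
  have h0 : deriv γ t 0 = 0 := by nlinarith [sq_nonneg (deriv γ t 0), sq_nonneg (deriv γ t 1)]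
  have h1 : deriv γ t 1 = 0 := by nlinarith [sq_nonneg (deriv γ t 0), sq_nonneg (deriv γ t 1)]
  apply h t
  rw [Submodule.mem_span_singleton]
  refine ⟨deriv γ t 2, ?_⟩
  ext i; fin_cases i <;> simp [vert, h0, h1]

theorem norm_blackboardFraming (h : NowhereVertical γ) (t : ℝ) : ‖blackboardFraming γ t‖ = 1 := by
  have hp := h.pos t
  have : ‖blackboardFraming γ t‖ ^ 2 = 1 := by
    rw [norm_sq_eq_coords]
    simp only [blackboardFraming, PiLp.smul_apply, smul_eq_mul, mul_pow, inv_pow,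
      Real.sq_sqrt hp.le]
    simp
    field_simp
    ring
  nlinarith [norm_nonneg (blackboardFraming γ t)]

theorem inner_deriv_blackboardFraming (γ : ℝ → Space) (t : ℝ) :
    inner ℝ (deriv γ t) (blackboardFraming γ t) = 0 := by
  simp [inner_eq_coords, blackboardFraming]; ring

theorem contDiff_blackboardFraming (hγ : IsEmbeddedClosedCurve γ) (h : NowhereVertical γ) :
    ContDiff ℝ ∞ (blackboardFraming γ) := by
  have hd := contDiff_euclidean.1 hγ.contDiff_deriv
  have h0 := hd 0; have h1 := hd 1
  have hs : ContDiff ℝ ∞ fun t => (Real.sqrt (deriv γ t 0 ^ 2 + deriv γ t 1 ^ 2))⁻¹ :=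
    (((h0.pow 2).add (h1.pow 2)).sqrt fun t => (h.pos t).ne').inv
      fun t => (Real.sqrt_pos.2 (h.pos t)).ne'
  refine hs.smul ?_
  rw [contDiff_euclidean]
  intro i
  fin_cases i
  · simpa using h1.neg
  · simpa using h0
  · simpa using contDiff_const

theorem periodic_blackboardFraming (hγ : IsEmbeddedClosedCurve γ) :
    Function.Periodic (blackboardFraming γ) 1 := by
  intro t
  simp only [blackboardFraming, hγ.periodic.deriv t]

theorem norm_deriv_pos (hγ : IsEmbeddedClosedCurve γ) (t : ℝ) : 0 < ‖deriv γ t‖ :=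
  norm_pos_iff.2 (hγ.deriv_ne_zero t)

theorem binormal_eq_cross (γ : ℝ → Space) (t : ℝ) :
    binormal γ t = cross (‖deriv γ t‖⁻¹ • deriv γ t) (blackboardFraming γ t) := by
  rw [binormal, cross_smul_left]

theorem norm_binormal (hγ : IsEmbeddedClosedCurve γ) (h : NowhereVertical γ) (t : ℝ) :
    ‖binormal γ t‖ = 1 := by
  have hp := norm_deriv_pos hγ t
  have h1 := norm_cross_sq (deriv γ t) (blackboardFraming γ t)
  rw [inner_deriv_blackboardFraming, norm_blackboardFraming h] at h1
  have h2 : ‖cross (deriv γ t) (blackboardFraming γ t)‖ = ‖deriv γ t‖ := by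
    rw [← sq_eq_sq₀ (norm_nonneg _) (norm_nonneg _), h1]; ring
  rw [binormal, norm_smul, h2, norm_inv, norm_norm, inv_mul_cancel₀ hp.ne']

theorem inner_deriv_binormal (γ : ℝ → Space) (t : ℝ) :
    inner ℝ (deriv γ t) (binormal γ t) = 0 := by
  rw [binormal, inner_smul_right, inner_cross_left, mul_zero]

theorem inner_blackboardFraming_binormal (γ : ℝ → Space) (t : ℝ) :
    inner ℝ (blackboardFraming γ t) (binormal γ t) = 0 := by
  rw [binormal, inner_smul_right, inner_cross_right, mul_zero]

theorem contDiff_binormal (hγ : IsEmbeddedClosedCurve γ) (h : NowhereVertical γ) :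
    ContDiff ℝ ∞ (binormal γ) :=
  ((hγ.contDiff_deriv.norm ℝ hγ.deriv_ne_zero).inv fun t => (norm_deriv_pos hγ t).ne').smul
    (hγ.contDiff_deriv.cross (contDiff_blackboardFraming hγ h))

theorem periodic_binormal (hγ : IsEmbeddedClosedCurve γ) : Function.Periodic (binormal γ) 1 := by
  intro t
  simp only [binormal, hγ.periodic.deriv t, periodic_blackboardFraming hγ t]

/-- Expansion of a vector in the frame of the curve. -/
theorem frame_expansion (hγ : IsEmbeddedClosedCurve γ) (h : NowhereVertical γ) (t : ℝ) (v : Space) :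
    v = (inner ℝ (deriv γ t) v / ‖deriv γ t‖ ^ 2) • deriv γ t +
      inner ℝ (blackboardFraming γ t) v • blackboardFraming γ t +
      inner ℝ (binormal γ t) v • binormal γ t := by
  have hp := norm_deriv_pos hγ t
  have hu : ‖(‖deriv γ t‖⁻¹ • deriv γ t)‖ = 1 := by
    rw [norm_smul, norm_inv, norm_norm, inv_mul_cancel₀ hp.ne']
  have := eq_add_of_orthonormal hu (norm_blackboardFraming h t)
    (by rw [inner_smul_left, inner_deriv_blackboardFraming, mul_zero]) v
  rw [← binormal_eq_cross] at this
  conv_lhs => rw [this]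
  congr 2
  rw [inner_smul_left, smul_smul]
  congr 1
  simp
  field_simp

theorem inner_blackboardFraming_vert (γ : ℝ → Space) (t : ℝ) :
    inner ℝ (blackboardFraming γ t) vert = 0 := by
  simp [inner_eq_coords, blackboardFraming, vert]

theorem inner_binormal_vert_pos (hγ : IsEmbeddedClosedCurve γ) (h : NowhereVertical γ) (t : ℝ) :
    0 < inner ℝ (binormal γ t) vert := by
  have hp := norm_deriv_pos hγ t
  have h1 := h.pos t
  have h2 := Real.sqrt_pos.2 h1
  have : inner ℝ (binormal γ t) vert =
      ‖deriv γ t‖⁻¹ * ((Real.sqrt (deriv γ t 0 ^ 2 + deriv γ t 1 ^ 2))⁻¹ *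
        (deriv γ t 0 ^ 2 + deriv γ t 1 ^ 2)) := by
    simp [inner_eq_coords, vert, binormal, cross, blackboardFraming]; ring_nf; tauto
  rw [this]; positivity

theorem norm_frameVec (hγ : IsEmbeddedClosedCurve γ) (h : NowhereVertical γ) (t φ : ℝ) :
    ‖frameVec γ t φ‖ = 1 := by
  have : ‖frameVec γ t φ‖ ^ 2 = 1 := by
    rw [frameVec, norm_add_sq_real, norm_smul, norm_smul, norm_blackboardFraming h,
      norm_binormal hγ h, inner_smul_left, inner_smul_right, inner_blackboardFraming_binormal]
    simp
  nlinarith [norm_nonneg (frameVec γ t φ)]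

theorem inner_deriv_frameVec (γ : ℝ → Space) (t φ : ℝ) :
    inner ℝ (deriv γ t) (frameVec γ t φ) = 0 := by
  rw [frameVec, inner_add_right, inner_smul_right, inner_smul_right,
    inner_deriv_blackboardFraming, inner_deriv_binormal]; simp

theorem inner_blackboardFraming_frameVec (h : NowhereVertical γ) (t φ : ℝ) :
    inner ℝ (blackboardFraming γ t) (frameVec γ t φ) = Real.cos φ := by
  rw [frameVec, inner_add_right, inner_smul_right, inner_smul_right,
    real_inner_self_eq_norm_sq, norm_blackboardFraming h, inner_blackboardFraming_binormal]; simp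

theorem inner_binormal_frameVec (hγ : IsEmbeddedClosedCurve γ) (h : NowhereVertical γ) (t φ : ℝ) :
    inner ℝ (binormal γ t) (frameVec γ t φ) = Real.sin φ := by
  rw [frameVec, inner_add_right, inner_smul_right, inner_smul_right,
    real_inner_self_eq_norm_sq, norm_binormal hγ h, real_inner_comm,
    inner_blackboardFraming_binormal]; simp

theorem inner_frameVec_frameVec (hγ : IsEmbeddedClosedCurve γ) (h : NowhereVertical γ)
    (t φ ψ : ℝ) : inner ℝ (frameVec γ t φ) (frameVec γ t ψ) = Real.cos (φ - ψ) := by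
  rw [frameVec, inner_add_left, inner_smul_left, inner_smul_left,
    inner_blackboardFraming_frameVec h, inner_binormal_frameVec hγ h, Real.cos_sub]; simp

theorem contDiff_frameVec (hγ : IsEmbeddedClosedCurve γ) (h : NowhereVertical γ)
    {E : Type*} [NormedAddCommGroup E] [NormedSpace ℝ E] {t φ : E → ℝ} (ht : ContDiff ℝ ∞ t)
    (hφ : ContDiff ℝ ∞ φ) : ContDiff ℝ ∞ fun x => frameVec γ (t x) (φ x) :=
  ((Real.contDiff_cos.comp hφ).smul ((contDiff_blackboardFraming hγ h).comp ht)).add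
    ((Real.contDiff_sin.comp hφ).smul ((contDiff_binormal hγ h).comp ht))

theorem frameVec_add_one (hγ : IsEmbeddedClosedCurve γ) (t φ : ℝ) :
    frameVec γ (t + 1) φ = frameVec γ t φ := by
  rw [frameVec, periodic_blackboardFraming hγ t, periodic_binormal hγ t, frameVec]

theorem frameVec_add_int_mul_two_pi (γ : ℝ → Space) (t φ : ℝ) (k : ℤ) :
    frameVec γ t (φ + k * (2 * Real.pi)) = frameVec γ t φ := by
  rw [frameVec, Real.cos_add_int_mul_two_pi, Real.sin_add_int_mul_two_pi, frameVec]

theorem blackboardFraming_eq_frameVec (γ : ℝ → Space) (t : ℝ) :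
    blackboardFraming γ t = frameVec γ t 0 := by simp [frameVec]

theorem binormal_eq_frameVec (γ : ℝ → Space) (t : ℝ) :
    binormal γ t = frameVec γ t (Real.pi / 2) := by simp [frameVec]

end Frame

/-! ### Angles -/

/-- A smooth unit vector field in the plane has a smooth angle function. -/
theorem exists_contDiff_angle {x y : ℝ → ℝ} (hx : ContDiff ℝ ∞ x) (hy : ContDiff ℝ ∞ y)
    (hxy : ∀ s, x s ^ 2 + y s ^ 2 = 1) :
    ∃ θ : ℝ → ℝ, ContDiff ℝ ∞ θ ∧ ∀ s, x s = Real.cos (θ s) ∧ y s = Real.sin (θ s) := by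
  have hx' : ContDiff ℝ ∞ (deriv x) := (contDiff_infty_iff_deriv.1 hx).2
  have hy' : ContDiff ℝ ∞ (deriv y) := (contDiff_infty_iff_deriv.1 hy).2
  have hxd : ∀ s, HasDerivAt x (deriv x s) s := fun s => (hx.differentiable (by simp) s).hasDerivAt
  have hyd : ∀ s, HasDerivAt y (deriv y s) s := fun s => (hy.differentiable (by simp) s).hasDerivAt
  -- The angular velocity of (x, y). Its primitive θ is the angle: rotating (x, y) back by θ gives a
  -- constant vector, equal to (1, 0) by the choice of the initial value.
  set w : ℝ → ℝ := fun s => x s * deriv y s - y s * deriv x s with hw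
  have hwc : ContDiff ℝ ∞ w := (hx.mul hy').sub (hy.mul hx')
  obtain ⟨a, ha1, ha2⟩ : ∃ a, x 0 = Real.cos a ∧ y 0 = Real.sin a := by
    refine ⟨Complex.arg ⟨x 0, y 0⟩, ?_, ?_⟩
    · have hn : ‖(⟨x 0, y 0⟩ : ℂ)‖ = 1 := by
        rw [Complex.norm_def, Complex.normSq_mk, ← sq, ← sq, hxy, Real.sqrt_one]
      rw [Complex.cos_arg (by rw [← norm_pos_iff, hn]; exact one_pos), hn]; simp
    · have hn : ‖(⟨x 0, y 0⟩ : ℂ)‖ = 1 := by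
        rw [Complex.norm_def, Complex.normSq_mk, ← sq, ← sq, hxy, Real.sqrt_one]
      rw [Complex.sin_arg, hn]; simp
  set θ : ℝ → ℝ := fun s => a + ∫ u in (0:ℝ)..s, w u with hθ
  have hθd : ∀ s, HasDerivAt θ (w s) s := fun s =>
    (intervalIntegral.integral_hasDerivAt_right (hwc.continuous.intervalIntegrable _ _)
      (hwc.continuous.stronglyMeasurableAtFilter _ _) hwc.continuous.continuousAt).const_add a
  have hθc : ContDiff ℝ ∞ θ := by
    rw [contDiff_infty_iff_deriv]
    refine ⟨fun s => (hθd s).differentiableAt, ?_⟩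
    rw [show deriv θ = w from funext fun s => (hθd s).deriv]
    exact hwc
  have hrel : ∀ s, x s * deriv x s + y s * deriv y s = 0 := by
    intro s
    have h1 := ((hxd s).pow 2).add ((hyd s).pow 2)
    have h2 : HasDerivAt (x ^ 2 + y ^ 2) 0 s := by
      have : x ^ 2 + y ^ 2 = fun _ => (1 : ℝ) := funext hxy
      rw [this]; exact hasDerivAt_const s 1
    have := h1.unique h2
    norm_num at this
    linarith
  have hxw : ∀ s, deriv x s = -(y s * w s) := fun s => by
    simp only [hw]; linear_combination (x s) * hrel s - deriv x s * hxy s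
  have hyw : ∀ s, deriv y s = x s * w s := fun s => by
    simp only [hw]; linear_combination (y s) * hrel s - deriv y s * hxy s
  have hconst : ∀ f : ℝ → ℝ, (∀ s, HasDerivAt f 0 s) → ∀ s, f s = f 0 := fun f hf s =>
    is_const_of_deriv_eq_zero (fun s => (hf s).differentiableAt) (fun s => (hf s).deriv) s 0
  have hc := hconst (fun s => x s * Real.cos (θ s) + y s * Real.sin (θ s)) fun s => by
    refine (((hxd s).mul (hθd s).cos).add ((hyd s).mul (hθd s).sin)).congr_deriv ?_
    rw [hxw, hyw]; ring
  have hs := hconst (fun s => y s * Real.cos (θ s) - x s * Real.sin (θ s)) fun s => by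
    refine (((hyd s).mul (hθd s).cos).sub ((hxd s).mul (hθd s).sin)).congr_deriv ?_
    rw [hxw, hyw]; ring
  have hθ0 : θ 0 = a := by simp [hθ]
  refine ⟨θ, hθc, fun s => ?_⟩
  have h1 := hc s
  have h2 := hs s
  simp only [hθ0, ← ha1, ← ha2] at h1 h2
  have h0 := hxy 0
  have h3 := Real.sin_sq_add_cos_sq (θ s)
  constructor
  · linear_combination Real.cos (θ s) * h1 - Real.sin (θ s) * h2 + Real.cos (θ s) * h0 - x s * h3
  · linear_combination Real.sin (θ s) * h1 + Real.cos (θ s) * h2 + Real.sin (θ s) * h0 - y s * h3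

/-- A continuous angle that is always trivial modulo `2π` is a constant multiple of `2π`. -/
theorem exists_int_of_forall_cos_eq_one {f : ℝ → ℝ} (hf : Continuous f)
    (h : ∀ s, Real.cos (f s) = 1) : ∃ k : ℤ, ∀ s, f s = k * (2 * Real.pi) := by
  choose g hg using fun s => (Real.cos_eq_one_iff (f s)).1 (h s)
  have hgc : Continuous g := by
    rw [Int.isClosedEmbedding_coe_real.isInducing.continuous_iff]
    have : (Int.cast ∘ g : ℝ → ℝ) = fun s => f s / (2 * Real.pi) := by
      ext s; rw [← hg s]; simp
    rw [this]; exact hf.div_const _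
  refine ⟨g 0, fun s => ?_⟩
  rw [← hg s, PreconnectedSpace.constant inferInstance hgc (x := s) (y := 0)]

/-! ### Estimates for an embedded closed curve -/

section Estimates

variable {γ : ℝ → Space}

theorem Function.Periodic.exists_norm_le {E : Type*} [NormedAddCommGroup E] {f : ℝ → E}
    (hf : Function.Periodic f 1) (hc : Continuous f) : ∃ C, 0 ≤ C ∧ ∀ s, ‖f s‖ ≤ C := by
  obtain ⟨C, hC⟩ := isCompact_Icc.exists_bound_of_continuousOn (s := Icc (0:ℝ) 1) hc.continuousOn
  refine ⟨C, (norm_nonneg _).trans (hC 0 (by simp)), fun s => ?_⟩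
  obtain ⟨y, hy, hfy⟩ := hf.exists_mem_Ico₀ one_pos s
  rw [hfy]
  exact hC y ⟨hy.1, hy.2.le⟩

theorem IsEmbeddedClosedCurve.apply_add_int (hγ : IsEmbeddedClosedCurve γ) (t : ℝ) (n : ℤ) :
    γ (t + n) = γ t := by
  have := hγ.periodic.int_mul n t
  rwa [mul_one] at this

theorem IsEmbeddedClosedCurve.exists_eq_add_int (hγ : IsEmbeddedClosedCurve γ) {s t : ℝ}
    (h : γ s = γ t) : ∃ n : ℤ, s = t + n := by
  have hf : ∀ s, γ (Int.fract s) = γ s := fun s => by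
    have := hγ.apply_add_int s (-⌊s⌋)
    rw [← this]; congr 1; simp [Int.fract, sub_eq_add_neg]
  have := hγ.injOn (x₁ := Int.fract s) ⟨Int.fract_nonneg s, Int.fract_lt_one s⟩
    (x₂ := Int.fract t) ⟨Int.fract_nonneg t, Int.fract_lt_one t⟩ (by rw [hf, hf, h])
  obtain ⟨n, hn⟩ := Int.fract_eq_fract.1 this
  exact ⟨n, by linarith⟩

/-- The mean velocity `Q (s, h)` extends the difference quotient of `γ` continuously to h = 0. For
|h| ≤ 1/2 it has no zeros: at h = 0 because `γ` is regular, elsewhere because `γ` is injective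
modulo the period. Its minimal norm over a compact set of pairs is the constant. -/
theorem IsEmbeddedClosedCurve.exists_chord_arc (hγ : IsEmbeddedClosedCurve γ) :
    ∃ c, 0 < c ∧ ∀ s t, |s - t| ≤ 1 / 2 → c * |s - t| ≤ ‖γ s - γ t‖ := by
  set Q : ℝ × ℝ → Space := fun x => ∫ u in (0:ℝ)..1, deriv γ (x.1 + x.2 * u) with hQ
  have hdc : Continuous (deriv γ) := hγ.contDiff_deriv.continuous
  have hQc : Continuous Q :=
    intervalIntegral.continuous_parametric_intervalIntegral_of_continuous'
      (f := fun (x : ℝ × ℝ) u => deriv γ (x.1 + x.2 * u)) (by fun_prop) 0 1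
  have hQe : ∀ s h, h • Q (s, h) = γ (s + h) - γ s := by
    intro s h
    have h1 : ∀ u ∈ uIcc (0:ℝ) 1, HasDerivAt (fun u => γ (s + h * u)) (h • deriv γ (s + h * u)) u := by
      intro u _
      have h2 : HasDerivAt (fun u : ℝ => s + h * u) h u := by
        simpa using ((hasDerivAt_id u).const_mul h).const_add s
      exact (hγ.hasDerivAt (s + h * u)).scomp u h2
    have := intervalIntegral.integral_eq_sub_of_hasDerivAt h1
      (Continuous.intervalIntegrable (by fun_prop) _ _)
    rw [intervalIntegral.integral_smul] at this
    simpa [hQ] using this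
  have hQ0 : ∀ x ∈ Icc (0:ℝ) 1 ×ˢ Icc (-(1/2):ℝ) (1/2), Q x ≠ 0 := by
    rintro ⟨s, h⟩ ⟨-, hh⟩ h0
    simp only at hh
    by_cases hz : h = 0
    · apply hγ.deriv_ne_zero s
      simpa [hQ, hz] using h0
    · have := hQe s h
      rw [h0, smul_zero] at this
      obtain ⟨n, hn⟩ := hγ.exists_eq_add_int (sub_eq_zero.1 this.symm)
      have hn' : h = n := by linarith
      have h1 : (n:ℝ) < 1 := by rw [← hn']; linarith [hh.2]
      have h2 : (-1:ℝ) < n := by rw [← hn']; linarith [hh.1]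
      have h3 : n < 1 := by exact_mod_cast h1
      have h4 : -1 < n := by exact_mod_cast h2
      apply hz
      rw [hn', show n = 0 by omega]; simp
  obtain ⟨x, hx, hmin⟩ := (isCompact_Icc.prod isCompact_Icc).exists_isMinOn
    (s := Icc (0:ℝ) 1 ×ˢ Icc (-(1/2):ℝ) (1/2)) ⟨(0, 0), by norm_num⟩ hQc.norm.continuousOn
  refine ⟨‖Q x‖, norm_pos_iff.2 (hQ0 x hx), fun s t hst => ?_⟩
  set n := ⌊t⌋ with hn
  have h1 : ‖Q x‖ ≤ ‖Q (Int.fract t, s - t)‖ :=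
    hmin ⟨⟨Int.fract_nonneg t, (Int.fract_lt_one t).le⟩, abs_le.1 hst⟩
  have h2 := hQe (Int.fract t) (s - t)
  have h3 : γ (Int.fract t) = γ t := by
    rw [← hγ.apply_add_int _ n, hn, Int.fract_add_floor]
  have h4 : γ (Int.fract t + (s - t)) = γ s := by
    rw [← hγ.apply_add_int _ n]; congr 1; rw [hn]; linarith [Int.fract_add_floor t]
  rw [h3, h4] at h2
  rw [← h2, norm_smul, Real.norm_eq_abs, mul_comm]
  gcongr

theorem IsEmbeddedClosedCurve.exists_taylor_bound (hγ : IsEmbeddedClosedCurve γ) :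
    ∃ C, 0 < C ∧ ∀ s t, ‖γ s - γ t - (s - t) • deriv γ t‖ ≤ C * (s - t) ^ 2 := by
  have hd2 : ContDiff ℝ ∞ (deriv (deriv γ)) := (contDiff_infty_iff_deriv.1 hγ.contDiff_deriv).2
  obtain ⟨C, hC0, hC⟩ := hγ.periodic.deriv.deriv.exists_norm_le hd2.continuous
  -- `C` may be 0; the larger constant is positive, so that it can serve as a divisor.
  refine ⟨C + 1, by linarith, fun s t => ?_⟩
  have h1 : ∀ x, ‖deriv γ x - deriv γ t‖ ≤ C * ‖x - t‖ := fun x =>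
    convex_univ.norm_image_sub_le_of_norm_deriv_le
      (fun y _ => (hγ.contDiff_deriv.differentiable (by simp)).differentiableAt)
      (fun y _ => hC y) (mem_univ t) (mem_univ x)
  have h2 := (convex_uIcc t s).norm_image_sub_le_of_norm_hasDerivWithin_le
    (f := fun x => γ x - γ t - (x - t) • deriv γ t) (f' := fun x => deriv γ x - deriv γ t)
    (C := C * |s - t|)
    (fun x _ => by
      have := ((hγ.hasDerivAt x).sub_const (γ t)).sub
        (((hasDerivAt_id x).sub_const t).smul_const (deriv γ t))
      exact (this.congr_deriv (by simp)).hasDerivWithinAt)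
    (fun x hx => (h1 x).trans (by
      gcongr
      rw [Real.norm_eq_abs]
      exact abs_sub_left_of_mem_uIcc hx)) left_mem_uIcc right_mem_uIcc
  simp only [sub_self, zero_smul, sub_zero] at h2
  refine h2.trans ?_
  rw [Real.norm_eq_abs, mul_assoc, abs_mul_abs_self]
  nlinarith [mul_self_nonneg (s - t)]

/-- Points at a small distance from `γ` in normal directions are not too close to `γ`. -/
theorem exists_tube_bound (hγ : IsEmbeddedClosedCurve γ) (h : NowhereVertical γ) :
    ∃ ε₀ c, 0 < ε₀ ∧ 0 < c ∧ ∀ ε, 0 < ε → ε < ε₀ → ∀ s t φ, |s - t| ≤ 1 / 2 →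
      c * (s - t) ^ 2 + ε ^ 2 ≤ ‖γ s - (γ t + ε • frameVec γ t φ)‖ ^ 2 := by
  obtain ⟨c, hc, hc'⟩ := hγ.exists_chord_arc
  obtain ⟨C, hC, hC'⟩ := hγ.exists_taylor_bound
  -- In the expanded square the chord contributes at least c²(s - t)² and the cross term at most
  -- 2εC(s - t)² in absolute value when it is negative. For ε < c²/(4C) the latter uses up at most
  -- half of the former.
  refine ⟨c ^ 2 / (4 * C), c ^ 2 / 2, by positivity, by positivity, fun ε hε hε' s t φ hst => ?_⟩
  have h1 := hc' s t hst
  have h2 : (c * |s - t|) ^ 2 ≤ ‖γ s - γ t‖ ^ 2 := by gcongr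
  rw [mul_pow, sq_abs] at h2
  -- The normal vector is orthogonal to the velocity, so only the second order Taylor remainder
  -- contributes.
  have h3 : inner ℝ (γ s - γ t) (frameVec γ t φ) ≤ C * (s - t) ^ 2 := by
    have : inner ℝ (γ s - γ t) (frameVec γ t φ) =
        inner ℝ (γ s - γ t - (s - t) • deriv γ t) (frameVec γ t φ) := by
      rw [inner_sub_left (γ s - γ t), inner_smul_left, inner_deriv_frameVec]; simp
    rw [this]
    refine (real_inner_le_norm _ _).trans ?_
    rw [norm_frameVec hγ h, mul_one]
    exact hC' s t
  rw [← sub_sub, norm_sub_sq_real, norm_smul, inner_smul_right, norm_frameVec hγ h, mul_one,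
    Real.norm_eq_abs, sq_abs]
  have h4 : ε * (4 * C) ≤ c ^ 2 := by
    rw [lt_div_iff₀ (by positivity)] at hε'; exact hε'.le
  have h5 : ε * inner ℝ (γ s - γ t) (frameVec γ t φ) ≤ ε * (C * (s - t) ^ 2) := by gcongr
  nlinarith [mul_le_mul_of_nonneg_right h4 (sq_nonneg (s - t))]

end Estimates

/-! ### The unit normal field along a curve -/

/-- Near a point of the surface, a unit normal field is the normalized gradient of a defining
function, up to sign. -/
theorem IsUnitNormalField.contDiff_comp {F : Set Space} {ν : Space → Space}
    (hν : IsUnitNormalField F ν) (hF : IsSmoothSurface F) {γ : ℝ → Space} (hγ : ContDiff ℝ ∞ γ)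
    (hγF : ∀ t, γ t ∈ F) : ContDiff ℝ ∞ fun t => ν (γ t) := by
  rw [contDiff_iff_contDiffAt]
  intro t₀
  obtain ⟨U, f, hU, hpU, hf, hf', hFU, hq⟩ := hF.exists_equation (hγF t₀)
  have hUt : ∀ᶠ t in 𝓝 t₀, γ t ∈ U :=
    hγ.continuous.continuousAt.eventually_mem (hU.mem_nhds hpU)
  -- The inverse Riesz map as a real linear map: it turns differentials into gradients.
  set J : (Space →L[ℝ] ℝ) →L[ℝ] Space :=
    LinearMap.toContinuousLinearMap
      { toFun := (InnerProductSpace.toDual ℝ Space).symm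
        map_add' := fun x y => by simp
        map_smul' := fun r x => by simp } with hJ
  have hJ' : ∀ L v, inner ℝ (J L) v = L v := fun L v => by
    simp [hJ, InnerProductSpace.toDual_symm_apply]
  have hJ0 : ∀ q ∈ U, J (fderiv ℝ f q) ≠ 0 := fun q hqU h0 => hf' q hqU (by
    ext v; rw [← hJ', h0]; simp)
  set n : Space → Space := fun q => ‖J (fderiv ℝ f q)‖⁻¹ • J (fderiv ℝ f q) with hn
  have hJc : ContDiffOn ℝ ∞ (fun q => J (fderiv ℝ f q)) U :=
    J.contDiff.comp_contDiffOn (hf.fderiv_of_isOpen hU (by simp))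
  have hnc : ContDiffOn ℝ ∞ n U :=
    ((hJc.norm ℝ hJ0).inv fun q hqU => norm_ne_zero_iff.2 (hJ0 q hqU)).smul hJc
  have hn1 : ∀ q ∈ U, ‖n q‖ = 1 := fun q hqU => by
    rw [hn]
    simp only [norm_smul, norm_inv, norm_norm]
    exact inv_mul_cancel₀ (norm_ne_zero_iff.2 (hJ0 q hqU))
  have hpm : ∀ q ∈ U, f q = 0 → ν q = inner ℝ (n q) (ν q) • n q := by
    intro q hqU hfq
    obtain ⟨hqF, htan⟩ := hq q hqU hfq
    set w := ν q - inner ℝ (n q) (ν q) • n q with hw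
    have hnw : inner ℝ (n q) w = 0 := by
      rw [hw, inner_sub_right, inner_smul_right, real_inner_self_eq_norm_sq, hn1 q hqU]; ring
    have hwt : w ∈ tangentPlane F q := by
      rw [htan, mem_ofPred_eq, ← hJ']
      have h0 : ‖J (fderiv ℝ f q)‖ ≠ 0 := norm_ne_zero_iff.2 (hJ0 q hqU)
      have : inner ℝ (n q) w = ‖J (fderiv ℝ f q)‖⁻¹ * inner ℝ (J (fderiv ℝ f q)) w := by
        rw [hn, real_inner_smul_left]
      rw [this] at hnw
      exact (mul_eq_zero.1 hnw).resolve_left (inv_ne_zero h0)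
    have h1 := hν.normal q hqF w hwt
    have h2 : inner ℝ w w = 0 := by
      have : inner ℝ w w = inner ℝ w (ν q) - inner ℝ (n q) (ν q) * inner ℝ w (n q) := by
        rw [← real_inner_smul_right, ← inner_sub_right]
      rw [this, h1, real_inner_comm (n q) w, hnw]; ring
    rw [inner_self_eq_zero] at h2
    exact sub_eq_zero.1 h2
  set p := γ t₀ with hp
  have hfp : f p = 0 := (hFU.subset ⟨hγF t₀, hpU⟩).2
  have hsgn : ∀ q ∈ U, f q = 0 → inner ℝ (n q) (ν q) ^ 2 = 1 := by
    intro q hqU hfq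
    have h1 := congrArg (fun v => ‖v‖ ^ 2) (hpm q hqU hfq)
    simp only [norm_smul, mul_pow, hn1 q hqU, hν.norm_eq_one q (hq q hqU hfq).1, Real.norm_eq_abs,
      sq_abs] at h1
    linarith
  have hcont : ContinuousAt (fun t => inner ℝ (n (γ t)) (ν (γ t))) t₀ := by
    refine ContinuousAt.inner ?_ ?_
    · exact ((hnc.continuousOn.continuousAt (hU.mem_nhds hpU))).comp hγ.continuous.continuousAt
    · exact (continuousOn_univ.1 (hν.continuousOn.comp hγ.continuous.continuousOn
        fun t _ => hγF t)).continuousAt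
  -- The coefficient of `ν` with respect to the normalized gradient is ±1 and continuous along `γ`.
  -- Two such values at distance less than 1 are equal, so it is locally constant.
  have hev : ∀ᶠ t in 𝓝 t₀, ν (γ t) = inner ℝ (n p) (ν p) • n (γ t) := by
    have h1 : ∀ᶠ t in 𝓝 t₀, dist (inner ℝ (n (γ t)) (ν (γ t))) (inner ℝ (n p) (ν p)) < 1 :=
      hcont.eventually_mem (Metric.ball_mem_nhds _ one_pos)
    filter_upwards [h1, hUt] with t ht htU
    have hft : f (γ t) = 0 := (hFU.subset ⟨hγF t, htU⟩).2
    have e1 := hsgn _ htU hft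
    have e2 := hsgn p hpU hfp
    rw [hpm _ htU hft]
    congr 1
    rw [Real.dist_eq] at ht
    rcases (mul_self_eq_one_iff.1 ((sq _).symm.trans e1)) with a | a <;>
      rcases (mul_self_eq_one_iff.1 ((sq _).symm.trans e2)) with b | b <;>
      rw [a, b] at ht ⊢ <;> norm_num at ht
  refine ContDiffAt.congr_of_eventuallyEq ?_ hev
  exact ContDiffAt.const_smul _ ((hnc.contDiffAt (hU.mem_nhds hpU)).comp t₀ hγ.contDiffAt)

/-- The angle of the surface normal framing to the blackboard framing. -/
theorem exists_normal_angle {F : Set Space} {ν : Space → Space} {γ : ℝ → Space}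
    (hF : IsSmoothSurface F) (hν : IsUnitNormalField F ν) (hγ : IsEmbeddedClosedCurve γ)
    (hγF : ∀ t, γ t ∈ F) (h : NowhereVertical γ) :
    ∃ (θ : ℝ → ℝ) (k : ℤ), ContDiff ℝ ∞ θ ∧ (∀ t, ν (γ t) = frameVec γ t (θ t)) ∧
      ∀ t, θ (t + 1) = θ t + k * (2 * Real.pi) := by
  have hνc := hν.contDiff_comp hF hγ.contDiff hγF
  have hT : ∀ t, inner ℝ (deriv γ t) (ν (γ t)) = 0 := fun t =>
    hν.normal _ (hγF t) _ (mem_tangentPlane_of_hasDerivAt (Eventually.of_forall hγF)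
      (hγ.hasDerivAt t))
  have hexp : ∀ t, ν (γ t) = inner ℝ (blackboardFraming γ t) (ν (γ t)) • blackboardFraming γ t +
      inner ℝ (binormal γ t) (ν (γ t)) • binormal γ t := fun t => by
    conv_lhs => rw [frame_expansion hγ h t (ν (γ t)), hT t]
    simp
  obtain ⟨θ, hθ, hθe⟩ := exists_contDiff_angle
    ((contDiff_blackboardFraming hγ h).inner ℝ hνc) ((contDiff_binormal hγ h).inner ℝ hνc) (by
      intro t
      have h1 := congrArg (fun v => inner ℝ (ν (γ t)) v) (hexp t)
      simp only [inner_add_right, inner_smul_right, real_inner_self_eq_norm_sq,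
        hν.norm_eq_one _ (hγF t)] at h1
      rw [real_inner_comm, real_inner_comm (ν (γ t)) (binormal γ t)] at h1 ⊢
      nlinarith)
  have hνθ : ∀ t, ν (γ t) = frameVec γ t (θ t) := fun t => by
    rw [frameVec, ← (hθe t).1, ← (hθe t).2]; exact hexp t
  obtain ⟨k, hk⟩ := exists_int_of_forall_cos_eq_one (f := fun t => θ (t + 1) - θ t)
    (by have := hθ.continuous; fun_prop) (fun t => by
      have h1 := hθe (t + 1)
      rw [periodic_blackboardFraming hγ t, periodic_binormal hγ t, hγ.periodic t] at h1
      rw [Real.cos_sub, ← h1.1, ← h1.2, (hθe t).1, (hθe t).2, ← sq, ← sq, Real.cos_sq_add_sin_sq])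
  exact ⟨θ, k, hθ, hνθ, fun t => by linarith [hk t]⟩

/-! ### The Biot–Savart field of a closed curve -/

/-- Differentiation under an integral over a compact interval. -/
theorem hasFDerivAt_intervalIntegral_of_continuousOn {H E : Type*} [NormedAddCommGroup H]
    [NormedSpace ℝ H] [ProperSpace H] [NormedAddCommGroup E] [NormedSpace ℝ E]
    {G : H → ℝ → E} {G' : H → ℝ → H →L[ℝ] E} {Ω : Set H} (hΩ : IsOpen Ω)
    (hG : ∀ x ∈ Ω, Continuous (G x)) (hG' : ContinuousOn (Function.uncurry G') (Ω ×ˢ univ))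
    (hd : ∀ x ∈ Ω, ∀ s, HasFDerivAt (fun x => G x s) (G' x s) x) (a b : ℝ) {x₀ : H}
    (hx₀ : x₀ ∈ Ω) :
    HasFDerivAt (fun x => ∫ s in a..b, G x s) (∫ s in a..b, G' x₀ s) x₀ := by
  obtain ⟨r, hr, hrΩ⟩ := Metric.nhds_basis_closedBall.mem_iff.1 (hΩ.mem_nhds hx₀)
  obtain ⟨C, hC⟩ := ((isCompact_closedBall x₀ r).prod
    (isCompact_uIcc (a := a) (b := b))).exists_bound_of_continuousOn
    (hG'.mono (prod_mono hrΩ (subset_univ _)))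
  have hG'x : Continuous (G' x₀) := by
    rw [← continuousOn_univ]
    exact hG'.comp (f := fun s => (x₀, s)) (by fun_prop) fun s _ => ⟨hx₀, mem_univ _⟩
  refine intervalIntegral.hasFDerivAt_integral_of_dominated_of_fderiv_le (bound := fun _ => C)
    (Metric.ball_mem_nhds x₀ hr) ?_ ((hG x₀ hx₀).intervalIntegrable _ _)
    hG'x.aestronglyMeasurable ?_ intervalIntegrable_const ?_
  · filter_upwards [hΩ.mem_nhds hx₀] with x hx using (hG x hx).aestronglyMeasurable
  · refine Eventually.of_forall fun s hs x hx => ?_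
    exact hC (x, s) ⟨Metric.ball_subset_closedBall hx, uIoc_subset_uIcc hs⟩
  · exact Eventually.of_forall fun s hs x hx => hd x (hrΩ (Metric.ball_subset_closedBall hx)) s

/-- The cross product as a continuous bilinear map. -/
noncomputable def crossL : Space →L[ℝ] Space →L[ℝ] Space :=
  LinearMap.toContinuousLinearMap
    (LinearMap.toContinuousLinearMap.toLinearMap ∘ₗ
      LinearMap.mk₂ ℝ cross
        (fun a b c => by ext i; fin_cases i <;> simp [cross] <;> ring)
        (fun r a b => by ext i; fin_cases i <;> simp [cross] <;> ring)
        (fun a b c => by ext i; fin_cases i <;> simp [cross] <;> ring)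
        (fun r a b => by ext i; fin_cases i <;> simp [cross] <;> ring))

@[simp] theorem crossL_apply (a b : Space) : crossL a b = cross a b := rfl

/-- The field `r / ‖r‖³` of a point charge. -/
noncomputable def coulomb (r : Space) : Space := (‖r‖ ^ 2) ^ (-3 / 2 : ℝ) • r

theorem coulomb_eq (r : Space) : coulomb r = (‖r‖ ^ 3)⁻¹ • r := by
  rw [coulomb, ← Real.rpow_natCast, ← Real.rpow_mul (norm_nonneg r), ← Real.rpow_natCast ‖r‖ 3,
    ← Real.rpow_neg (norm_nonneg r)]
  norm_num

/-- The derivative of the field of a point charge. -/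
noncomputable def coulombDeriv (r : Space) : Space →L[ℝ] Space :=
  (‖r‖ ^ 2) ^ (-3 / 2 : ℝ) • ContinuousLinearMap.id ℝ Space -
    (3 * (‖r‖ ^ 2) ^ (-5 / 2 : ℝ)) • (innerSL ℝ r).smulRight r

theorem coulombDeriv_apply {r : Space} (hr : r ≠ 0) (w : Space) :
    coulombDeriv r w = (‖r‖ ^ 2) ^ (-5 / 2 : ℝ) • (‖r‖ ^ 2 • w - (3 * inner ℝ r w) • r) := by
  have h : (‖r‖ ^ 2) ^ (-3 / 2 : ℝ) = (‖r‖ ^ 2) ^ (-5 / 2 : ℝ) * ‖r‖ ^ 2 := by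
    have := Real.rpow_add_one (x := ‖r‖ ^ 2) (by positivity) (-5 / 2)
    rw [← this]; norm_num
  simp only [coulombDeriv, h, _root_.sub_apply, _root_.smul_apply,
    ContinuousLinearMap.id_apply, ContinuousLinearMap.smulRight_apply, innerSL_apply_apply]
  module

theorem hasFDerivAt_coulomb {r : Space} (hr : r ≠ 0) :
    HasFDerivAt coulomb (coulombDeriv r) r := by
  have h1 : HasFDerivAt (fun r : Space => ‖r‖ ^ 2) (2 • innerSL ℝ r) r :=
    (hasStrictFDerivAt_norm_sq r).hasFDerivAt
  have h2 := (h1.rpow_const (p := (-3 / 2 : ℝ)) (Or.inl (by positivity))).smul (hasFDerivAt_id r)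
  refine h2.congr_fderiv ?_
  ext1 w
  simp only [coulombDeriv]
  norm_num
  module

theorem continuousOn_coulombDeriv : ContinuousOn coulombDeriv {0}ᶜ := by
  have h : ∀ p : ℝ, ContinuousOn (fun r : Space => (‖r‖ ^ 2) ^ p) {0}ᶜ := fun p =>
    ContinuousOn.rpow_const (by fun_prop) fun r hr => Or.inl (by
      have : r ≠ 0 := hr
      positivity)
  refine ((h _).smul continuousOn_const).sub ((continuousOn_const.mul (h _)).smul ?_)
  have : Continuous fun r : Space => ContinuousLinearMap.smulRightL ℝ Space Space (innerSL ℝ r) r := by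
    fun_prop
  exact this.continuousOn

/-- The field of a point charge is divergence free. -/
theorem inner_cross_coulombDeriv {r : Space} (hr : r ≠ 0) (a v w : Space) :
    inner ℝ v (cross (coulombDeriv r w) a) - inner ℝ w (cross (coulombDeriv r v) a) =
      -inner ℝ (coulombDeriv r a) (cross v w) := by
  -- For a linear map A, det(Av, w, a) + det(v, Aw, a) + det(v, w, Aa) = tr A · det(v, w, a). The
  -- derivative of the field has trace proportional to 3‖r‖² - 3‖r‖² = 0; the identity is checked in
  -- coordinates.
  rw [coulombDeriv_apply hr, coulombDeriv_apply hr, coulombDeriv_apply hr]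
  generalize (‖r‖ ^ 2) ^ (-5 / 2 : ℝ) = p
  simp only [inner_eq_coords, cross, norm_sq_eq_coords, PiLp.smul_apply, PiLp.sub_apply,
    smul_eq_mul]
  simp
  ring

/-- The Biot–Savart integral of a closed curve of period `1`. -/
noncomputable def biotSavart (γ : ℝ → Space) (x : Space) : Space :=
  ∫ s in (0:ℝ)..1, cross (coulomb (γ s - x)) (deriv γ s)

/-- The derivative of the Biot–Savart integral. -/
noncomputable def biotSavartDeriv (γ : ℝ → Space) (x : Space) : Space →L[ℝ] Space :=
  ∫ s in (0:ℝ)..1, -(crossL.flip (deriv γ s)).comp (coulombDeriv (γ s - x))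

section BiotSavart

variable {γ : ℝ → Space}

theorem IsEmbeddedClosedCurve.isCompact_range (hγ : IsEmbeddedClosedCurve γ) :
    IsCompact (range γ) := by
  have : range γ = γ '' Icc 0 1 := by
    apply Subset.antisymm
    · rintro _ ⟨s, rfl⟩
      obtain ⟨y, hy, hfy⟩ := hγ.periodic.exists_mem_Ico₀ one_pos s
      exact ⟨y, ⟨hy.1, hy.2.le⟩, hfy.symm⟩
    · exact image_subset_range _ _
  rw [this]
  exact isCompact_Icc.image hγ.contDiff.continuous

theorem isOpen_compl_range (hγ : IsEmbeddedClosedCurve γ) : IsOpen (range γ)ᶜ :=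
  hγ.isCompact_range.isClosed.isOpen_compl

theorem sub_ne_zero_of_notMem_range {x : Space} (hx : x ∈ (range γ)ᶜ) (s : ℝ) : γ s - x ≠ 0 :=
  fun h => hx ⟨s, sub_eq_zero.1 h⟩

theorem continuous_biotSavart_integrand (hγ : IsEmbeddedClosedCurve γ) {x : Space}
    (hx : x ∈ (range γ)ᶜ) : Continuous fun s => cross (coulomb (γ s - x)) (deriv γ s) := by
  have h1 : Continuous fun s => coulomb (γ s - x) := continuous_iff_continuousAt.2 fun s =>
    (hasFDerivAt_coulomb (sub_ne_zero_of_notMem_range hx s)).continuousAt.comp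
      (f := fun s => γ s - x) (hγ.contDiff.continuous.sub continuous_const).continuousAt
  exact (crossL.continuous.comp h1).clm_apply hγ.contDiff_deriv.continuous

theorem continuousOn_biotSavartDeriv_integrand (hγ : IsEmbeddedClosedCurve γ) :
    ContinuousOn (fun z : Space × ℝ =>
      -(crossL.flip (deriv γ z.2)).comp (coulombDeriv (γ z.2 - z.1))) ((range γ)ᶜ ×ˢ univ) := by
  have h1 := hγ.contDiff.continuous
  have h2 := hγ.contDiff_deriv.continuous
  refine (ContinuousOn.clm_comp (by fun_prop) ?_).neg
  exact continuousOn_coulombDeriv.comp (by fun_prop) fun z hz =>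
    sub_ne_zero_of_notMem_range hz.1 z.2

theorem hasFDerivAt_biotSavart (hγ : IsEmbeddedClosedCurve γ) {x : Space}
    (hx : x ∈ (range γ)ᶜ) : HasFDerivAt (biotSavart γ) (biotSavartDeriv γ x) x := by
  refine hasFDerivAt_intervalIntegral_of_continuousOn (isOpen_compl_range hγ)
    (G := fun x s => cross (coulomb (γ s - x)) (deriv γ s))
    (G' := fun x s => -(crossL.flip (deriv γ s)).comp (coulombDeriv (γ s - x)))
    (fun x hx => continuous_biotSavart_integrand hγ hx)
    (continuousOn_biotSavartDeriv_integrand hγ) ?_ 0 1 hx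
  intro x hx s
  have h1 := (hasFDerivAt_coulomb (sub_ne_zero_of_notMem_range hx s)).comp x
    ((hasFDerivAt_id x).const_sub (γ s))
  have h2 := (crossL.flip (deriv γ s)).hasFDerivAt.comp x h1
  refine h2.congr_fderiv ?_
  ext1 w; simp

/-- The Biot–Savart field is curl free off the curve. -/
theorem biotSavartDeriv_symm (hγ : IsEmbeddedClosedCurve γ) {x : Space} (hx : x ∈ (range γ)ᶜ)
    (v w : Space) :
    inner ℝ v (biotSavartDeriv γ x w) = inner ℝ w (biotSavartDeriv γ x v) := by
  have hc : Continuous fun s => -(crossL.flip (deriv γ s)).comp (coulombDeriv (γ s - x)) := by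
    rw [← continuousOn_univ]
    exact (continuousOn_biotSavartDeriv_integrand hγ).comp (f := fun s => (x, s)) (by fun_prop)
      fun s _ => ⟨hx, mem_univ _⟩
  have happ : ∀ v w, inner ℝ v (biotSavartDeriv γ x w) =
      ∫ s in (0:ℝ)..1, -inner ℝ v (cross (coulombDeriv (γ s - x) w) (deriv γ s)) := by
    intro v w
    rw [biotSavartDeriv, ContinuousLinearMap.intervalIntegral_apply (hc.intervalIntegrable _ _),
      ← innerSL_apply_apply ℝ, ← ContinuousLinearMap.intervalIntegral_comp_comm _
        ((hc.clm_apply continuous_const).intervalIntegrable _ _)]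
    simp
  have hci : ∀ v w, Continuous fun s =>
      -inner ℝ v (cross (coulombDeriv (γ s - x) w) (deriv γ s)) := fun v w => by
    have := (continuous_const (y := v)).inner (hc.clm_apply (continuous_const (y := w))) (𝕜 := ℝ)
    simpa using this
  rw [← sub_eq_zero, happ, happ, ← intervalIntegral.integral_sub
    ((hci v w).intervalIntegrable _ _) ((hci w v).intervalIntegrable _ _)]
  -- The antisymmetric part of the derivative is the integral over one period of the derivative of
  -- this periodic function, hence 0.
  have hder : ∀ s, HasDerivAt (fun s => inner ℝ (coulomb (γ s - x)) (cross v w))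
      (inner ℝ (coulombDeriv (γ s - x) (deriv γ s)) (cross v w)) s := by
    intro s
    have h1 := (hasFDerivAt_coulomb (sub_ne_zero_of_notMem_range hx s)).comp_hasDerivAt s
      ((hγ.hasDerivAt s).sub_const x)
    simpa using h1.inner ℝ (hasDerivAt_const s (cross v w))
  have heq : ∀ s, -inner ℝ v (cross (coulombDeriv (γ s - x) w) (deriv γ s)) -
      -inner ℝ w (cross (coulombDeriv (γ s - x) v) (deriv γ s)) =
      inner ℝ (coulombDeriv (γ s - x) (deriv γ s)) (cross v w) := fun s => by
    have := inner_cross_coulombDeriv (sub_ne_zero_of_notMem_range hx s) (deriv γ s) v w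
    linarith
  rw [intervalIntegral.integral_congr fun s _ => heq s,
    intervalIntegral.integral_eq_sub_of_hasDerivAt (fun s _ => hder s)]
  · have : γ 1 = γ 0 := by simpa using hγ.periodic 0
    rw [this, sub_self]
  · apply Continuous.intervalIntegrable
    simp_rw [← heq]
    exact (hci v w).sub (hci w v)

end BiotSavart

/-! ### The potential on a tube around the curve -/

/-- The parametrization of a punctured tube around `γ`: distance to `γ`, parameter on `γ`, angle
to the blackboard framing. -/
noncomputable def tube (γ : ℝ → Space) (y : ℝ × ℝ × ℝ) : Space :=
  γ y.2.1 + y.1 • frameVec γ y.2.1 y.2.2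

/-- The parameters of a punctured tube of radius `ε`. -/
def tubeDomain (ε : ℝ) : Set (ℝ × ℝ × ℝ) := Ioo 0 ε ×ˢ univ

theorem isOpen_tubeDomain (ε : ℝ) : IsOpen (tubeDomain ε) := isOpen_Ioo.prod isOpen_univ

theorem convex_tubeDomain (ε : ℝ) : Convex ℝ (tubeDomain ε) := (convex_Ioo 0 ε).prod convex_univ

/-- The inner product as a real bilinear map. -/
noncomputable def innerL : Space →L[ℝ] Space →L[ℝ] ℝ :=
  LinearMap.toContinuousLinearMap
    (LinearMap.toContinuousLinearMap.toLinearMap ∘ₗ innerₗ Space)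

@[simp] theorem innerL_apply (a b : Space) : innerL a b = inner ℝ a b := rfl

/-- The pull-back to the tube parameters of the `1`-form dual to the Biot–Savart field. -/
noncomputable def tubeForm (γ : ℝ → Space) (y : ℝ × ℝ × ℝ) : ℝ × ℝ × ℝ →L[ℝ] ℝ :=
  (innerL (biotSavart γ (tube γ y))).comp (fderiv ℝ (tube γ) y)

section Potential

variable {γ : ℝ → Space}

theorem contDiff_tube (hγ : IsEmbeddedClosedCurve γ) (h : NowhereVertical γ) :
    ContDiff ℝ ∞ (tube γ) :=
  (hγ.contDiff.comp (by fun_prop)).add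
    (contDiff_fst.smul (contDiff_frameVec hγ h (by fun_prop) (by fun_prop)))

/-- The Poincaré lemma. Positions and angles are taken in the whole line and not modulo periods, so
the domain is convex. The derivative of the form is symmetric: one term is a second derivative of
`tube γ`, the other is symmetric by `biotSavartDeriv_symm`. -/
theorem exists_potential (hγ : IsEmbeddedClosedCurve γ) (h : NowhereVertical γ) {ε₀ : ℝ}
    (hε : ∀ y ∈ tubeDomain ε₀, tube γ y ∈ (range γ)ᶜ) :
    ∃ Q : ℝ × ℝ × ℝ → ℝ, ∀ y ∈ tubeDomain ε₀, HasFDerivAt Q (tubeForm γ y) y := by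
  have hW := contDiff_tube hγ h
  have hder : ∀ y ∈ tubeDomain ε₀, HasFDerivAt (tubeForm γ)
      (((ContinuousLinearMap.compL ℝ (ℝ × ℝ × ℝ) Space ℝ).flip (fderiv ℝ (tube γ) y)).comp
        (innerL.comp ((biotSavartDeriv γ (tube γ y)).comp (fderiv ℝ (tube γ) y))) +
      (ContinuousLinearMap.compL ℝ (ℝ × ℝ × ℝ) Space ℝ (innerL (biotSavart γ (tube γ y)))).comp
        (fderiv ℝ (fderiv ℝ (tube γ)) y)) y := by
    intro y hy
    have h1 := (hasFDerivAt_biotSavart hγ (hε y hy)).comp y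
      (hW.differentiable (by simp) y).hasFDerivAt
    have h2 : HasFDerivAt (fun y => innerL (biotSavart γ (tube γ y))) _ y :=
      innerL.hasFDerivAt.comp y h1
    have h3 : HasFDerivAt (fderiv ℝ (tube γ)) (fderiv ℝ (fderiv ℝ (tube γ)) y) y :=
      ((hW.fderiv_right (m := ∞) (by simp)).differentiable (by simp) y).hasFDerivAt
    refine (h2.clm_comp h3).congr_fderiv ?_
    rw [add_comm]
  refine (convex_tubeDomain ε₀).exists_forall_hasFDerivAt_of_fderiv_symmetric
    (isOpen_tubeDomain ε₀) (fun y hy => (hder y hy).differentiableAt.differentiableWithinAt) ?_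
  intro y hy u v
  rw [(hder y hy).fderiv]
  have hsymm : fderiv ℝ (fderiv ℝ (tube γ)) y u v = fderiv ℝ (fderiv ℝ (tube γ)) y v u :=
    (hW.contDiffAt.isSymmSndFDerivAt (by simp only [minSmoothness_of_isRCLikeNormedField]; exact WithTop.coe_le_coe.2 (le_top : (2 : ℕ∞) ≤ ⊤))) u v
  have hB := biotSavartDeriv_symm hγ (hε y hy) (fderiv ℝ (tube γ) y v) (fderiv ℝ (tube γ) y u)
  simp only [_root_.add_apply, ContinuousLinearMap.comp_apply, ContinuousLinearMap.flip_apply,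
    ContinuousLinearMap.compL_apply, innerL_apply, hsymm]
  rw [real_inner_comm, hB, real_inner_comm]

theorem tubeForm_add_of_periodic {e : ℝ × ℝ × ℝ} (he : ∀ y, tube γ (y + e) = tube γ y)
    (y : ℝ × ℝ × ℝ) : tubeForm γ (y + e) = tubeForm γ y := by
  have : fderiv ℝ (tube γ) (y + e) = fderiv ℝ (tube γ) y := by
    rw [← fderiv_comp_add_right]
    congr 1
    exact funext he
  rw [tubeForm, this, he, tubeForm]

/-- The potential changes by a constant under a period of the tube. -/
theorem potential_add_period {ε₀ : ℝ} {Q : ℝ × ℝ × ℝ → ℝ}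
    (hQ : ∀ y ∈ tubeDomain ε₀, HasFDerivAt Q (tubeForm γ y) y) {e : ℝ × ℝ}
    (he : ∀ y, tube γ (y + (0, e)) = tube γ y) :
    ∃ a, ∀ y ∈ tubeDomain ε₀, Q (y + (0, e)) = Q y + a := by
  have hmem : ∀ y ∈ tubeDomain ε₀, y + (0, e) ∈ tubeDomain ε₀ := fun y hy => by
    refine ⟨?_, mem_univ _⟩
    simpa using hy.1
  have hd : ∀ y ∈ tubeDomain ε₀, HasFDerivAt (fun y => Q (y + (0, e)) - Q y) 0 y := fun y hy => by
    have h1 := (hQ _ (hmem y hy)).comp y ((hasFDerivAt_id y).add_const (0, e))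
    refine (h1.sub (hQ y hy)).congr_fderiv ?_
    rw [tubeForm_add_of_periodic he]; simp
  rcases (tubeDomain ε₀).eq_empty_or_nonempty with h0 | ⟨y₀, hy₀⟩
  · exact ⟨0, by simp [h0]⟩
  refine ⟨Q (y₀ + (0, e)) - Q y₀, fun y hy => ?_⟩
  have := (convex_tubeDomain ε₀).is_const_of_fderivWithin_eq_zero (𝕜 := ℝ)
    (fun z hz => (hd z hz).differentiableAt.differentiableWithinAt)
    (fun z hz => by
      rw [fderivWithin_of_isOpen (isOpen_tubeDomain ε₀) hz]; exact (hd z hz).fderiv) hy hy₀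
  linarith

theorem potential_add_int_period {ε₀ a : ℝ} {Q : ℝ × ℝ × ℝ → ℝ} {e : ℝ × ℝ}
    (h : ∀ y ∈ tubeDomain ε₀, Q (y + (0, e)) = Q y + a) (k : ℤ) :
    ∀ y ∈ tubeDomain ε₀, Q (y + (0, (k : ℝ) • e)) = Q y + k * a := by
  have hmem : ∀ (r : ℝ), ∀ y ∈ tubeDomain ε₀, y + (0, r • e) ∈ tubeDomain ε₀ := fun r y hy => by
    refine ⟨?_, mem_univ _⟩
    simpa using hy.1
  induction k with
  | zero =>
    intro y _
    have : y + ((0 : ℝ), ((0 : ℤ) : ℝ) • e) = y := by ext <;> simp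
    rw [this]; simp
  | succ i ih =>
    intro y hy
    have h1 := h _ (hmem i y hy)
    have h2 : y + (0, ((i : ℤ) + 1 : ℤ) • e) = y + (0, (i : ℝ) • e) + (0, e) := by
      ext <;> simp <;> ring
    have h3 : (((i : ℤ) + 1 : ℤ) : ℝ) • e = ((i : ℤ) + 1 : ℤ) • e := by
      rw [Int.cast_smul_eq_zsmul]
    have h4 := ih y hy
    simp only [Int.cast_natCast] at h4
    rw [h3, h2, h1, h4]; push_cast; ring
  | pred i ih =>
    intro y hy
    have h1 := h _ (hmem (-(i : ℝ) - 1) y hy)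
    have h2 : y + (0, (-(i : ℝ) - 1) • e) + (0, e) = y + (0, (-(i : ℝ)) • e) := by
      ext <;> simp <;> ring
    have h4 := ih y hy
    push_cast at h4 ⊢
    rw [h2, h4] at h1
    linarith

/-- The derivative of the potential along a curve in the tube. -/
theorem hasDerivAt_potential_comp (hγ : IsEmbeddedClosedCurve γ) (h : NowhereVertical γ) {ε₀ : ℝ}
    {Q : ℝ × ℝ × ℝ → ℝ} (hQ : ∀ y ∈ tubeDomain ε₀, HasFDerivAt Q (tubeForm γ y) y)
    {c : ℝ → ℝ × ℝ × ℝ} (hc : ContDiff ℝ ∞ c) (hcD : ∀ t, c t ∈ tubeDomain ε₀) (t : ℝ) :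
    HasDerivAt (fun t => Q (c t))
      (inner ℝ (biotSavart γ (tube γ (c t))) (deriv (fun t => tube γ (c t)) t)) t := by
  have hct := (hc.differentiable (by simp) t).hasDerivAt
  have h1 := (hQ _ (hcD t)).comp_hasDerivAt t hct
  have h2 := (((contDiff_tube hγ h).differentiable (by simp) (c t)).hasFDerivAt).comp_hasDerivAt t
    hct
  refine h1.congr_deriv ?_
  have h3 : deriv (fun t => tube γ (c t)) t = fderiv ℝ (tube γ) (c t) (deriv c t) := h2.deriv
  rw [h3]
  rfl

/-- The Gauss integral as the circulation of the Biot–Savart field. -/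
theorem linkingNumber_eq_integral (hγ : IsEmbeddedClosedCurve γ) {b : ℝ → Space}
    (hb : ContDiff ℝ ∞ b) (hdis : ∀ t, b t ∈ (range γ)ᶜ) :
    linkingNumber γ b =
      (4 * Real.pi)⁻¹ * ∫ t in (0:ℝ)..1, inner ℝ (biotSavart γ (b t)) (deriv b t) := by
  have hbd : Continuous (deriv b) := hb.continuous_deriv (by simp)
  set f : ℝ → ℝ → ℝ := fun s t =>
    inner ℝ (cross (coulomb (γ s - b t)) (deriv γ s)) (deriv b t) with hf
  have hdet : ∀ s t, (Matrix.of ![(deriv γ s).ofLp, (deriv b t).ofLp, (γ s - b t).ofLp]).det /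
      ‖γ s - b t‖ ^ 3 = f s t := by
    intro s t
    simp only [hf, coulomb_eq, cross_smul_left, inner_smul_left, inner_eq_coords,
      Matrix.det_fin_three]
    simp [cross]
    ring
  have hfc : Continuous (Function.uncurry f) := by
    have h1 : Continuous fun z : ℝ × ℝ => coulomb (γ z.1 - b z.2) :=
      continuous_iff_continuousAt.2 fun z =>
        (hasFDerivAt_coulomb (sub_ne_zero_of_notMem_range (hdis z.2) z.1)).continuousAt.comp
          (f := fun z : ℝ × ℝ => γ z.1 - b z.2)
          ((hγ.contDiff.continuous.comp continuous_fst).sub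
            (hb.continuous.comp continuous_snd)).continuousAt
    have h2 : Continuous fun z : ℝ × ℝ => cross (coulomb (γ z.1 - b z.2)) (deriv γ z.1) :=
      (crossL.continuous.comp h1).clm_apply (hγ.contDiff_deriv.continuous.comp continuous_fst)
    exact h2.inner (hbd.comp continuous_snd)
  rw [linkingNumber]
  congr 1
  simp only [hdet]
  simp only [intervalIntegral.integral_of_le zero_le_one]
  -- The two curves are disjoint, so the integrand is continuous on the compact square and Fubini
  -- applies.
  rw [MeasureTheory.integral_integral_swap]
  · congr 1
    ext t
    rw [biotSavart, ← intervalIntegral.integral_of_le zero_le_one, real_inner_comm,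
      ← innerSL_apply_apply ℝ, ← ContinuousLinearMap.intervalIntegral_comp_comm _
        ((continuous_biotSavart_integrand hγ (hdis t)).intervalIntegrable _ _)]
    simp only [innerSL_apply_apply, hf]
    simp_rw [real_inner_comm]
  · rw [MeasureTheory.Measure.prod_restrict]
    exact (hfc.continuousOn.integrableOn_compact (isCompact_Icc.prod isCompact_Icc)).mono_set
      (prod_mono Ioc_subset_Icc_self Ioc_subset_Icc_self)

theorem continuous_biotSavart_inner (hγ : IsEmbeddedClosedCurve γ) {b : ℝ → Space}
    (hb : ContDiff ℝ ∞ b) (hdis : ∀ t, b t ∈ (range γ)ᶜ) :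
    Continuous fun t => inner ℝ (biotSavart γ (b t)) (deriv b t) := by
  have h1 : Continuous fun t => biotSavart γ (b t) := continuous_iff_continuousAt.2 fun t =>
    (hasFDerivAt_biotSavart hγ (hdis t)).continuousAt.comp hb.continuous.continuousAt
  exact h1.inner (hb.continuous_deriv (by simp))

/-- The linking number of `γ` with a push-off of winding number `k` around the blackboard
framing depends affinely on `k`; it does not depend on the distance. -/
theorem linkingNumber_tube (hγ : IsEmbeddedClosedCurve γ) (h : NowhereVertical γ) {ε₀ : ℝ}
    (hε : ∀ y ∈ tubeDomain ε₀, tube γ y ∈ (range γ)ᶜ) {Q : ℝ × ℝ × ℝ → ℝ}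
    (hQ : ∀ y ∈ tubeDomain ε₀, HasFDerivAt Q (tubeForm γ y) y) {a m : ℝ}
    (ha : ∀ y ∈ tubeDomain ε₀, Q (y + (0, (1, 0))) = Q y + a)
    (hm : ∀ y ∈ tubeDomain ε₀, Q (y + (0, (0, 2 * Real.pi))) = Q y + m)
    {θ : ℝ → ℝ} {k : ℤ} (hθ : ContDiff ℝ ∞ θ) (hk : ∀ t, θ (t + 1) = θ t + k * (2 * Real.pi))
    {ε : ℝ} (h0 : 0 < ε) (h1 : ε < ε₀) :
    linkingNumber γ (pushOff γ (fun t => frameVec γ t (θ t)) ε) =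
      (4 * Real.pi)⁻¹ * (a + k * m) := by
  have hc : ContDiff ℝ ∞ fun t => (ε, t, θ t) := by fun_prop
  have hcD : ∀ t, (ε, t, θ t) ∈ tubeDomain ε₀ := fun t => ⟨⟨h0, h1⟩, mem_univ _⟩
  have hpush : pushOff γ (fun t => frameVec γ t (θ t)) ε = fun t => tube γ (ε, t, θ t) := rfl
  have hb : ContDiff ℝ ∞ fun t => tube γ (ε, t, θ t) := (contDiff_tube hγ h).comp hc
  rw [hpush, linkingNumber_eq_integral hγ hb fun t => hε _ (hcD t),
    intervalIntegral.integral_eq_sub_of_hasDerivAt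
      (fun t _ => hasDerivAt_potential_comp hγ h hQ hc hcD t)
      ((continuous_biotSavart_inner hγ hb fun t => hε _ (hcD t)).intervalIntegrable _ _)]
  congr 1
  -- The lifted push-off runs from (ε, 0, θ 0) to (ε, 1, θ 0 + 2πk): one period in the position
  -- contributes `a`, and `k` periods in the angle contribute `k * m`.
  have e1 := ha _ (hcD 0)
  have e2 := potential_add_int_period hm k (ε, 1, θ 0) ⟨⟨h0, h1⟩, mem_univ _⟩
  have e3 : ((ε, 1, θ 0) : ℝ × ℝ × ℝ) + (0, (k : ℝ) • (0, 2 * Real.pi)) = (ε, 1, θ 1) := by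
    have := hk 0
    rw [zero_add] at this
    ext <;> simp [this]
  have e4 : ((ε, 0, θ 0) : ℝ × ℝ × ℝ) + (0, (1, 0)) = (ε, 1, θ 0) := by ext <;> simp
  rw [e4] at e1
  rw [e3, e1] at e2
  rw [e2]; ring

end Potential

/-! ### The linking number with a meridian -/

theorem norm_cross_le (a b : Space) : ‖cross a b‖ ≤ ‖a‖ * ‖b‖ := by
  refine (sq_le_sq₀ (norm_nonneg _) (by positivity)).1 ?_
  rw [norm_cross_sq, mul_pow]
  nlinarith [sq_nonneg (inner ℝ a b)]

theorem Filter.Tendsto.cross {α : Type*} {l : Filter α} {f g : α → Space} {a b : Space}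
    (hf : Tendsto f l (𝓝 a)) (hg : Tendsto g l (𝓝 b)) :
    Tendsto (fun x => cross (f x) (g x)) l (𝓝 (cross a b)) := by
  have h : Continuous fun p : Space × Space => _root_.cross p.1 p.2 :=
    (contDiff_fst.cross contDiff_snd (n := 0)).continuous
  exact (h.tendsto (a, b)).comp (hf.prodMk_nhds hg)

theorem norm_coulomb {r : Space} (hr : r ≠ 0) : ‖coulomb r‖ = (‖r‖ ^ 2)⁻¹ := by
  have : ‖r‖ ≠ 0 := norm_ne_zero_iff.2 hr
  rw [coulomb_eq, norm_smul, norm_inv, norm_pow, norm_norm]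
  field_simp

theorem coulomb_smul {ε : ℝ} (hε : 0 < ε) (r : Space) :
    coulomb (ε • r) = (ε ^ 2)⁻¹ • coulomb r := by
  rw [coulomb_eq, coulomb_eq, norm_smul, Real.norm_of_nonneg hε.le, smul_smul, smul_smul]
  congr 1
  by_cases h : ‖r‖ = 0
  · simp [h]
  · field_simp

section Meridian

variable {γ : ℝ → Space}

/-- The frame (velocity, β, b) is orthogonal and oriented, so the product with the velocity is a
quarter turn of the normal plane, scaled by the speed. This makes the integrand of the straight line
explicit. -/
theorem cross_frameVec_deriv (hγ : IsEmbeddedClosedCurve γ) (t φ : ℝ) :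
    cross (frameVec γ t φ) (deriv γ t) = -‖deriv γ t‖ • frameVec γ t (φ + Real.pi / 2) := by
  have hp := norm_deriv_pos hγ t
  have h1 : cross (blackboardFraming γ t) (deriv γ t) = -‖deriv γ t‖ • binormal γ t := by
    rw [binormal, smul_smul, neg_mul, mul_inv_cancel₀ hp.ne', neg_one_smul]
    ext i; fin_cases i <;> simp [cross] <;> ring
  have h2 : cross (binormal γ t) (deriv γ t) = ‖deriv γ t‖ • blackboardFraming γ t := by
    have h3 : cross (cross (deriv γ t) (blackboardFraming γ t)) (deriv γ t) =
        ‖deriv γ t‖ ^ 2 • blackboardFraming γ t -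
          inner ℝ (deriv γ t) (blackboardFraming γ t) • deriv γ t := by
      rw [inner_eq_coords, norm_sq_eq_coords]
      ext i; fin_cases i <;> simp [cross] <;> ring
    rw [binormal, cross_smul_left, h3, inner_deriv_blackboardFraming, zero_smul, sub_zero,
      smul_smul]
    congr 1
    field_simp
  have h4 : cross (frameVec γ t φ) (deriv γ t) = Real.cos φ • cross (blackboardFraming γ t)
      (deriv γ t) + Real.sin φ • cross (binormal γ t) (deriv γ t) := by
    simp only [frameVec, ← crossL_apply, map_add, map_smul, _root_.add_apply, _root_.smul_apply]
  rw [h4, h1, h2, frameVec, Real.cos_add_pi_div_two, Real.sin_add_pi_div_two]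
  module

theorem hasDerivAt_frameVec (γ : ℝ → Space) (t φ : ℝ) :
    HasDerivAt (fun φ => frameVec γ t φ) (frameVec γ t (φ + Real.pi / 2)) φ := by
  have := ((Real.hasDerivAt_cos φ).smul_const (blackboardFraming γ t)).add
    ((Real.hasDerivAt_sin φ).smul_const (binormal γ t))
  refine this.congr_deriv ?_
  rw [frameVec, Real.cos_add_pi_div_two, Real.sin_add_pi_div_two]

/-- The Gauss integrand for `γ` and the meridian of radius `ε`, rescaled by `ε`. -/
noncomputable def meridianIntegrand (γ : ℝ → Space) (ε φ u : ℝ) : ℝ :=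
  ε ^ 2 * inner ℝ (frameVec γ 0 (φ + Real.pi / 2))
    (cross (coulomb (γ (ε * u) - (γ 0 + ε • frameVec γ 0 φ))) (deriv γ (ε * u)))

/-- The period is moved to [-1/2, 1/2], which puts the nearby point `γ 0` in the middle, and then s
= εu is substituted. One factor ε is the speed of the meridian, the other comes from the
substitution. The indicator function makes the domain independent of ε, as dominated convergence
requires. -/
theorem circulation_meridian (hγ : IsEmbeddedClosedCurve γ) {ε φ : ℝ} (hε : 0 < ε)
    (hdis : tube γ (ε, 0, φ) ∈ (range γ)ᶜ) :
    inner ℝ (biotSavart γ (tube γ (ε, 0, φ))) (deriv (fun φ => tube γ (ε, 0, φ)) φ) =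
      ∫ u, (Ioc (-(1 / (2 * ε))) (1 / (2 * ε))).indicator (meridianIntegrand γ ε φ) u := by
  have hd : deriv (fun φ => tube γ (ε, 0, φ)) φ = ε • frameVec γ 0 (φ + Real.pi / 2) :=
    (((hasDerivAt_frameVec γ 0 φ).const_smul ε).const_add (γ 0)).deriv
  have hle : -(1 / (2 * ε)) ≤ 1 / (2 * ε) := by
    have : 0 < 1 / (2 * ε) := by positivity
    linarith
  set x := tube γ (ε, 0, φ) with hx
  have hxe : x = γ 0 + ε • frameVec γ 0 φ := rfl
  set f : ℝ → ℝ := fun s => ε * inner ℝ (frameVec γ 0 (φ + Real.pi / 2))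
    (cross (coulomb (γ s - x)) (deriv γ s)) with hf
  have hper : Function.Periodic f 1 := fun s => by
    simp only [hf, hγ.periodic s, hγ.periodic.deriv s]
  rw [hd, real_inner_comm, biotSavart, ← innerSL_apply_apply ℝ,
    ← ContinuousLinearMap.intervalIntegral_comp_comm _
        ((continuous_biotSavart_integrand hγ hdis).intervalIntegrable _ _)]
  have h1 : (∫ s in (0:ℝ)..1, (innerSL ℝ (ε • frameVec γ 0 (φ + Real.pi / 2)))
      (cross (coulomb (γ s - x)) (deriv γ s))) = ∫ s in (0:ℝ)..1, f s := by
    congr 1; ext s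
    simp [hf]
  have h2 := hper.intervalIntegral_add_eq 0 (-1 / 2)
  rw [zero_add] at h2
  rw [h1, h2, MeasureTheory.integral_indicator measurableSet_Ioc,
    ← intervalIntegral.integral_of_le hle]
  have h3 := intervalIntegral.mul_integral_comp_mul_left (f := f) (a := -(1 / (2 * ε)))
    (b := 1 / (2 * ε)) ε
  have e1 : ε * -(1 / (2 * ε)) = -1 / 2 := by field_simp
  have e2 : ε * (1 / (2 * ε)) = -1 / 2 + 1 := by field_simp; norm_num
  rw [e1, e2] at h3
  rw [← h3, ← intervalIntegral.integral_const_mul]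
  congr 1; ext u
  simp only [hf, meridianIntegrand, hxe]
  ring

/-- The field of a charge has norm 1/‖r‖², and the tube estimate bounds ‖r‖² below by ε²(1 + cu²).
The factor ε² cancels, which leaves an integrable bound independent of ε and φ. -/
theorem abs_meridianIntegrand_le (hγ : IsEmbeddedClosedCurve γ) (h : NowhereVertical γ) {c C : ℝ}
    (hc : 0 < c) (hC : ∀ s, ‖deriv γ s‖ ≤ C) {ε φ u : ℝ} (hε : 0 < ε)
    (hb : c * (ε * u) ^ 2 + ε ^ 2 ≤ ‖γ (ε * u) - (γ 0 + ε • frameVec γ 0 φ)‖ ^ 2) :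
    |meridianIntegrand γ ε φ u| ≤ C * (1 + (Real.sqrt c * u) ^ 2)⁻¹ := by
  set r := γ (ε * u) - (γ 0 + ε • frameVec γ 0 φ) with hr
  have hε2 : 0 < ε ^ 2 := by positivity
  have hX : 0 < c * (ε * u) ^ 2 + ε ^ 2 := by positivity
  have hr0 : r ≠ 0 := by
    rintro h0
    rw [h0, norm_zero] at hb
    linarith
  have h1 : |inner ℝ (frameVec γ 0 (φ + Real.pi / 2)) (cross (coulomb r) (deriv γ (ε * u)))| ≤
      (c * (ε * u) ^ 2 + ε ^ 2)⁻¹ * C := by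
    refine (abs_real_inner_le_norm _ _).trans ?_
    rw [norm_frameVec hγ h, one_mul]
    refine (norm_cross_le _ _).trans ?_
    rw [norm_coulomb hr0]
    gcongr
    exact hC _
  rw [meridianIntegrand, abs_mul, abs_of_pos hε2]
  refine (mul_le_mul_of_nonneg_left h1 hε2.le).trans (le_of_eq ?_)
  rw [mul_pow, mul_pow (Real.sqrt c), Real.sq_sqrt hc.le]
  have : 0 < 1 + c * u ^ 2 := by positivity
  field_simp
  ring

theorem norm_smul_deriv_sub_frameVec_sq (hγ : IsEmbeddedClosedCurve γ) (h : NowhereVertical γ)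
    (t φ u : ℝ) : ‖u • deriv γ t - frameVec γ t φ‖ ^ 2 = u ^ 2 * ‖deriv γ t‖ ^ 2 + 1 := by
  rw [norm_sub_sq_real, inner_smul_left, inner_deriv_frameVec, norm_frameVec hγ h, norm_smul,
    mul_pow, Real.norm_eq_abs, sq_abs]
  simp

/-- The Gauss integrand for a line and a circle around it. -/
theorem inner_frameVec_cross_coulomb (hγ : IsEmbeddedClosedCurve γ) (h : NowhereVertical γ)
    (φ u : ℝ) : inner ℝ (frameVec γ 0 (φ + Real.pi / 2))
        (cross (coulomb (u • deriv γ 0 - frameVec γ 0 φ)) (deriv γ 0)) =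
      ‖deriv γ 0‖ * (Real.sqrt (u ^ 2 * ‖deriv γ 0‖ ^ 2 + 1) ^ 3)⁻¹ := by
  have h1 : cross (u • deriv γ 0 - frameVec γ 0 φ) (deriv γ 0) =
      ‖deriv γ 0‖ • frameVec γ 0 (φ + Real.pi / 2) := by
    have h2 : cross (deriv γ 0) (deriv γ 0) = 0 := by
      ext i; fin_cases i <;> simp [cross] <;> ring
    rw [← crossL_apply, map_sub, map_smul, _root_.sub_apply, _root_.smul_apply, crossL_apply,
      crossL_apply, h2, cross_frameVec_deriv hγ]
    module
  rw [coulomb_eq, cross_smul_left, h1, inner_smul_right, inner_smul_right,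
    real_inner_self_eq_norm_sq, norm_frameVec hγ h, ← norm_smul_deriv_sub_frameVec_sq hγ h 0 φ u,
    Real.sqrt_sq (norm_nonneg _)]
  ring

theorem tendsto_inv_smul_sub (hγ : IsEmbeddedClosedCurve γ) (u : ℝ) :
    Tendsto (fun ε : ℝ => ε⁻¹ • (γ (ε * u) - γ 0)) (𝓝[>] 0) (𝓝 (u • deriv γ 0)) := by
  have h2 : HasDerivAt (fun ε : ℝ => ε * u) u 0 := by
    simpa using (hasDerivAt_id (0:ℝ)).mul_const u
  have h3 : HasDerivAt γ (deriv γ 0) ((0:ℝ) * u) := by rw [zero_mul]; exact hγ.hasDerivAt 0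
  have h4 := (h3.scomp 0 h2).tendsto_slope_zero_right
  simpa only [Function.comp_apply, zero_add, zero_mul] using h4

/-- The field is homogeneous of degree -2, so the factor ε² rescales its argument by 1/ε; the
rescaled curve converges to its tangent line at `γ 0`. -/
theorem tendsto_meridianIntegrand (hγ : IsEmbeddedClosedCurve γ) (h : NowhereVertical γ)
    (φ u : ℝ) : Tendsto (fun ε => meridianIntegrand γ ε φ u) (𝓝[>] 0)
      (𝓝 (‖deriv γ 0‖ * (Real.sqrt (u ^ 2 * ‖deriv γ 0‖ ^ 2 + 1) ^ 3)⁻¹)) := by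
  have hne : u • deriv γ 0 - frameVec γ 0 φ ≠ 0 := by
    intro h0
    have hnorm := norm_smul_deriv_sub_frameVec_sq hγ h 0 φ u
    rw [h0, norm_zero] at hnorm
    nlinarith [mul_nonneg (sq_nonneg u) (sq_nonneg ‖deriv γ 0‖)]
  have hγ' : Tendsto (fun ε : ℝ => deriv γ (ε * u)) (𝓝[>] 0) (𝓝 (deriv γ 0)) := by
    have : Continuous fun ε : ℝ => deriv γ (ε * u) :=
      hγ.contDiff_deriv.continuous.comp (by fun_prop)
    have := this.tendsto 0
    rw [zero_mul] at this
    exact this.mono_left nhdsWithin_le_nhds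
  have hK : Tendsto (fun ε : ℝ => coulomb (ε⁻¹ • (γ (ε * u) - γ 0) - frameVec γ 0 φ)) (𝓝[>] 0)
      (𝓝 (coulomb (u • deriv γ 0 - frameVec γ 0 φ))) :=
    (hasFDerivAt_coulomb hne).continuousAt.tendsto.comp
      ((tendsto_inv_smul_sub hγ u).sub_const (frameVec γ 0 φ))
  have hcr : Tendsto (fun ε : ℝ => cross (coulomb (ε⁻¹ • (γ (ε * u) - γ 0) - frameVec γ 0 φ))
      (deriv γ (ε * u))) (𝓝[>] 0)
      (𝓝 (cross (coulomb (u • deriv γ 0 - frameVec γ 0 φ)) (deriv γ 0))) :=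
    hK.cross hγ'
  have hlim := Tendsto.inner (𝕜 := ℝ) (tendsto_const_nhds (x := frameVec γ 0 (φ + Real.pi / 2))) hcr
  rw [inner_frameVec_cross_coulomb hγ h] at hlim
  refine hlim.congr' ?_
  filter_upwards [self_mem_nhdsWithin] with ε hε
  have hε : 0 < ε := hε
  have h1 : γ (ε * u) - (γ 0 + ε • frameVec γ 0 φ) =
      ε • (ε⁻¹ • (γ (ε * u) - γ 0) - frameVec γ 0 φ) := by
    rw [smul_sub, smul_smul, mul_inv_cancel₀ hε.ne', one_smul]; abel
  rw [meridianIntegrand, h1, coulomb_smul hε, cross_smul_left, inner_smul_right]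
  field_simp

/-- `m` is the circulation along the meridian of every radius ε < `ε₀`. Letting ε tend to 0 under
both integrals identifies it with 2π times the integral of the positive function `g` that belongs to
a straight line. -/
theorem potential_meridian_ne_zero (hγ : IsEmbeddedClosedCurve γ) (h : NowhereVertical γ) {ε₀ c : ℝ}
    (hε₀ : 0 < ε₀) (hc : 0 < c)
    (htube : ∀ ε, 0 < ε → ε < ε₀ → ∀ s t φ, |s - t| ≤ 1 / 2 →
      c * (s - t) ^ 2 + ε ^ 2 ≤ ‖γ s - (γ t + ε • frameVec γ t φ)‖ ^ 2)
    (hε : ∀ y ∈ tubeDomain ε₀, tube γ y ∈ (range γ)ᶜ) {Q : ℝ × ℝ × ℝ → ℝ}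
    (hQ : ∀ y ∈ tubeDomain ε₀, HasFDerivAt Q (tubeForm γ y) y) {m : ℝ}
    (hm : ∀ y ∈ tubeDomain ε₀, Q (y + (0, (0, 2 * Real.pi))) = Q y + m) : m ≠ 0 := by
  obtain ⟨C, hC0, hC⟩ := hγ.periodic.deriv.exists_norm_le hγ.contDiff_deriv.continuous
  set L := ‖deriv γ 0‖ with hL
  have hLpos : 0 < L := norm_deriv_pos hγ 0
  set B : ℝ → ℝ := fun u => C * (1 + (Real.sqrt c * u) ^ 2)⁻¹ with hB
  have hB0 : ∀ u, 0 ≤ B u := fun u => by positivity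
  have hBi : MeasureTheory.Integrable B :=
    (integrable_inv_one_add_sq.comp_mul_left' (Real.sqrt_pos.2 hc).ne').const_mul C
  set g : ℝ → ℝ := fun u => L * (Real.sqrt (u ^ 2 * L ^ 2 + 1) ^ 3)⁻¹ with hg
  have hgpos : ∀ u, 0 < g u := fun u => by
    have : 0 < Real.sqrt (u ^ 2 * L ^ 2 + 1) := Real.sqrt_pos.2 (by positivity)
    positivity
  have hIoo : ∀ᶠ ε in 𝓝[>] (0:ℝ), 0 < ε ∧ ε < ε₀ := Ioo_mem_nhdsGT hε₀
  set G : ℝ → ℝ → ℝ → ℝ := fun ε φ =>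
    (Ioc (-(1 / (2 * ε))) (1 / (2 * ε))).indicator (meridianIntegrand γ ε φ) with hG
  have hGle : ∀ ε, 0 < ε → ε < ε₀ → ∀ φ u, ‖G ε φ u‖ ≤ B u := by
    intro ε h0 h1 φ u
    simp only [hG, indicator]
    split_ifs with hu
    · refine abs_meridianIntegrand_le hγ h hc hC h0 ?_
      have := htube ε h0 h1 (ε * u) 0 φ (by
        rw [sub_zero, abs_mul, abs_of_pos h0]
        have : |u| ≤ 1 / (2 * ε) := abs_le.2 ⟨hu.1.le, hu.2⟩
        calc ε * |u| ≤ ε * (1 / (2 * ε)) := by gcongr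
          _ = 1 / 2 := by field_simp)
      rwa [sub_zero] at this
    · simpa using hB0 u
  have hGm : ∀ ε, 0 < ε → ε < ε₀ → ∀ φ,
      MeasureTheory.AEStronglyMeasurable (G ε φ) MeasureTheory.volume := by
    intro ε h0 h1 φ
    refine MeasureTheory.AEStronglyMeasurable.indicator ?_ measurableSet_Ioc
    apply Continuous.aestronglyMeasurable
    have h2 := (continuous_biotSavart_integrand hγ
      (hε (ε, 0, φ) ⟨⟨h0, h1⟩, mem_univ _⟩)).comp (continuous_const_mul ε)
    exact continuous_const.mul (continuous_const.inner h2)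
  have hGt : ∀ φ u, Tendsto (fun ε => G ε φ u) (𝓝[>] 0) (𝓝 (g u)) := by
    intro φ u
    refine (tendsto_meridianIntegrand hγ h φ u).congr' ?_
    -- For such ε the fixed point `u` lies in the window of the indicator.
    have h1 : ∀ᶠ ε in 𝓝[>] (0:ℝ), ε < 1 / (2 * (|u| + 1)) :=
      
      nhdsWithin_le_nhds (Iio_mem_nhds (by positivity))
    filter_upwards [h1, self_mem_nhdsWithin] with ε h1 h2
    have h2 : 0 < ε := h2
    simp only [hG]
    rw [indicator_of_mem]
    have h3 : |u| < 1 / (2 * ε) := by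
      rw [lt_div_iff₀ (by positivity)] at h1 ⊢
      nlinarith
    exact ⟨(abs_lt.1 h3).1, (abs_lt.1 h3).2.le⟩
  have hJt : ∀ φ, Tendsto (fun ε => ∫ u, G ε φ u) (𝓝[>] 0) (𝓝 (∫ u, g u)) := fun φ =>
    MeasureTheory.tendsto_integral_filter_of_dominated_convergence B
      (hIoo.mono fun ε hε' => hGm ε hε'.1 hε'.2 φ)
      (hIoo.mono fun ε hε' => Eventually.of_forall fun u => hGle ε hε'.1 hε'.2 φ u) hBi
      (Eventually.of_forall fun u => hGt φ u)
  have hgi : MeasureTheory.Integrable g := by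
    refine hBi.mono' ?_ (Eventually.of_forall fun u => ?_)
    · apply Continuous.aestronglyMeasurable
      refine continuous_const.mul (Continuous.inv₀ (by fun_prop) fun u => ?_)
      have : 0 < Real.sqrt (u ^ 2 * L ^ 2 + 1) := Real.sqrt_pos.2 (by positivity)
      positivity
    · exact le_of_tendsto (hGt 0 u).norm (hIoo.mono fun ε hε' => hGle ε hε'.1 hε'.2 0 u)
  have hgI : 0 < ∫ u, g u := by
    rw [MeasureTheory.integral_pos_iff_support_of_nonneg (fun u => (hgpos u).le) hgi]
    have : Function.support g = univ := eq_univ_of_forall fun u => (hgpos u).ne'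
    rw [this]; simp
  have hdis : ∀ ε, 0 < ε → ε < ε₀ → ∀ φ, tube γ (ε, 0, φ) ∈ (range γ)ᶜ := fun ε h0 h1 φ =>
    hε _ ⟨⟨h0, h1⟩, mem_univ _⟩
  have hmer : ∀ ε, ContDiff ℝ ∞ fun φ => tube γ (ε, 0, φ) := fun ε =>
    (contDiff_tube hγ h).comp (by fun_prop)
  have hJ : ∀ ε, 0 < ε → ε < ε₀ → (Continuous fun φ => ∫ u, G ε φ u) ∧
      ∫ φ in (0:ℝ)..(2 * Real.pi), ∫ u, G ε φ u = m := by
    intro ε h0 h1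
    have he : ∀ φ, ∫ u, G ε φ u =
        inner ℝ (biotSavart γ (tube γ (ε, 0, φ))) (deriv (fun φ => tube γ (ε, 0, φ)) φ) :=
      fun φ => (circulation_meridian hγ h0 (hdis ε h0 h1 φ)).symm
    have hcont := continuous_biotSavart_inner hγ (hmer ε) (hdis ε h0 h1)
    simp only [he]
    refine ⟨hcont, ?_⟩
    rw [intervalIntegral.integral_eq_sub_of_hasDerivAt
      (fun φ _ => hasDerivAt_potential_comp hγ h hQ (c := fun φ => (ε, 0, φ)) (by fun_prop)
        (fun φ => ⟨⟨h0, h1⟩, mem_univ _⟩) φ) (hcont.intervalIntegrable _ _)]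
    have := hm (ε, 0, 0) ⟨⟨h0, h1⟩, mem_univ _⟩
    have e : ((ε, 0, 0) : ℝ × ℝ × ℝ) + (0, (0, 2 * Real.pi)) = (ε, 0, 2 * Real.pi) := by
      ext <;> simp
    rw [e] at this
    linarith
  have hlim : Tendsto (fun ε => ∫ φ in (0:ℝ)..(2 * Real.pi), ∫ u, G ε φ u) (𝓝[>] 0)
      (𝓝 (∫ φ in (0:ℝ)..(2 * Real.pi), ∫ u, g u)) := by
    refine intervalIntegral.tendsto_integral_filter_of_dominated_convergence (fun _ => ∫ u, B u)
      (hIoo.mono fun ε hε' => (hJ ε hε'.1 hε'.2).1.aestronglyMeasurable)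
      (hIoo.mono fun ε hε' => Eventually.of_forall fun φ _ => ?_) intervalIntegrable_const
      (Eventually.of_forall fun φ _ => hJt φ)
    exact MeasureTheory.norm_integral_le_of_norm_le hBi
      (Eventually.of_forall fun u => hGle ε hε'.1 hε'.2 φ u)
  have hmeq := tendsto_nhds_unique (tendsto_const_nhds.congr'
    (hIoo.mono fun ε hε' => (hJ ε hε'.1 hε'.2).2.symm)) hlim
  rw [hmeq, intervalIntegral.integral_const, sub_zero, smul_eq_mul]
  have := Real.pi_pos
  positivity

/-- The linking number of `γ` with its push-off along a framing is, for small distances, an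
affine function of the winding number of the framing. -/
theorem exists_linkingNumber_formula (hγ : IsEmbeddedClosedCurve γ) (h : NowhereVertical γ) :
    ∃ ε₀ A M : ℝ, 0 < ε₀ ∧ M ≠ 0 ∧ ∀ (θ : ℝ → ℝ) (k : ℤ), ContDiff ℝ ∞ θ →
      (∀ t, θ (t + 1) = θ t + k * (2 * Real.pi)) → ∀ ε, 0 < ε → ε < ε₀ →
      (∀ s t, γ s ≠ pushOff γ (fun t => frameVec γ t (θ t)) ε t) ∧
        linkingNumber γ (pushOff γ (fun t => frameVec γ t (θ t)) ε) = A + k * M := by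
  obtain ⟨ε₀, c, hε₀, hc, htube⟩ := exists_tube_bound hγ h
  have hne : ∀ ε, 0 < ε → ε < ε₀ → ∀ s t φ, γ s ≠ γ t + ε • frameVec γ t φ := by
    intro ε h0 h1 s t φ heq
    -- The tube estimate needs parameters at distance at most 1/2; subtracting the integer nearest
    -- to `s - t` from `s` achieves this without moving `γ s`.
    have h2 := htube ε h0 h1 (s + (-round (s - t) : ℤ)) t φ (by
      have := abs_sub_round (s - t)
      rwa [show s + ((-round (s - t) : ℤ) : ℝ) - t = s - t - round (s - t) by push_cast; ring])
    rw [hγ.apply_add_int, heq, sub_self, norm_zero] at h2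
    have : 0 < ε ^ 2 := by positivity
    nlinarith [mul_nonneg hc.le (sq_nonneg (s + ((-round (s - t) : ℤ) : ℝ) - t))]
  have hε : ∀ y ∈ tubeDomain ε₀, tube γ y ∈ (range γ)ᶜ := by
    rintro ⟨ε, t, φ⟩ hy ⟨s, hs⟩
    exact hne ε hy.1.1 hy.1.2 s t φ hs
  obtain ⟨Q, hQ⟩ := exists_potential hγ h hε
  obtain ⟨a, ha⟩ := potential_add_period hQ (e := (1, 0)) fun y => by
    simp [tube, hγ.periodic y.2.1, frameVec_add_one hγ]
  obtain ⟨m, hm⟩ := potential_add_period hQ (e := (0, 2 * Real.pi)) fun y => by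
    have := frameVec_add_int_mul_two_pi γ y.2.1 y.2.2 1
    rw [Int.cast_one, one_mul] at this
    simp [tube, this]
  have hm0 := potential_meridian_ne_zero hγ h hε₀ hc htube hε hQ hm
  refine ⟨ε₀, (4 * Real.pi)⁻¹ * a, (4 * Real.pi)⁻¹ * m, hε₀,
    mul_ne_zero (inv_ne_zero (by positivity)) hm0, fun θ k hθ hk ε h0 h1 => ?_⟩
  refine ⟨fun s t => hne ε h0 h1 s t (θ t), ?_⟩
  rw [linkingNumber_tube hγ h hε hQ ha hm hθ hk h0 h1]
  ring

end Meridian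

/-! ### Isotopies of a surface -/

section TangentMap

variable {F : Set Space} {f : Space → Space} {p : Space}

theorem IsSmoothEmbeddingOn.hasFDerivWithinAt (hf : IsSmoothEmbeddingOn F f) (hp : p ∈ F) :
    HasFDerivWithinAt f (fderivWithin ℝ f F p) F p :=
  ((hf.contDiffOn.differentiableOn (by simp)) p hp).hasFDerivWithinAt

/-- A vector tangent to the image of a surface under an embedding is the image of a vector
tangent to the surface. -/
theorem IsSmoothEmbeddingOn.exists_of_mem_tangentPlane_image (hf : IsSmoothEmbeddingOn F f)
    (hF : IsSmoothSurface F) (hp : p ∈ F) {u : Space} (hu : u ∈ tangentPlane (f '' F) (f p)) :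
    ∃ w ∈ tangentPlane F p, fderivWithin ℝ f F p w = u := by
  obtain ⟨U, g, hU, hpU, hg, hg', hFU, hq⟩ := hF.exists_equation hp
  have hgp : g p = 0 := (hFU.subset ⟨hp, hpU⟩).2
  have htan : tangentPlane F p = {v | fderiv ℝ g p v = 0} := (hq p hpU hgp).2
  set L := fderiv ℝ g p with hL
  set D := fderivWithin ℝ f F p with hD
  have hinj : ∀ v, L v = 0 → D v = 0 → v = 0 := fun v hv => hf.immersion p hp v (by rw [htan]; exact hv)
  obtain ⟨W, R, hW, hpW, hR, hRF, hRid, hRd⟩ := hF.exists_local_retraction hp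
  have hRat : HasFDerivAt R (fderiv ℝ R p) p :=
    ((hR.contDiffAt (hW.mem_nhds hpW)).differentiableAt (by simp)).hasFDerivAt
  have hRker : ∀ v, L v = 0 → fderiv ℝ R p v = v := fun v hv =>
    hRd p hpW hp v (by rw [htan]; exact hv)
  have hLR : ∀ v, L (fderiv ℝ R p v) = 0 := by
    intro v
    have h1 : HasFDerivAt (fun x => g (R x)) (L.comp (fderiv ℝ R p)) p := by
      have : HasFDerivAt g L (R p) := by
        rw [hRid p hpW hp]
        exact ((hg.contDiffAt (hU.mem_nhds hpU)).differentiableAt (by simp)).hasFDerivAt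
      exact this.comp p hRat
    have h2 : (fun x => g (R x)) =ᶠ[𝓝 p] fun _ => 0 := by
      have h3 : ∀ᶠ x in 𝓝 p, R x ∈ U :=
        hRat.continuousAt.eventually_mem (by rw [hRid p hpW hp]; exact hU.mem_nhds hpU)
      filter_upwards [h3, hW.mem_nhds hpW] with x hx hxW
      exact (hFU.subset ⟨hRF hxW, hx⟩).2
    have := h1.unique ((hasFDerivAt_const (0:ℝ) p).congr_of_eventuallyEq h2)
    exact DFunLike.congr_fun this v
  -- A direction transverse to the image of the tangent plane. If there were none, `D` composed with
  -- the differential of `R` would be onto, hence injective, although the differential of `R` kills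
  -- `n` minus its projection, a nonzero vector.
  obtain ⟨N, hN⟩ : ∃ N, ∀ v, L v = 0 → D v ≠ N := by
    obtain ⟨n, hn⟩ : ∃ n, L n ≠ 0 := by
      by_contra! h; exact hg' p hpU (by ext v; simpa using h v)
    by_contra! h
    have hsurj : Function.Surjective (D.comp (fderiv ℝ R p)) := fun N => by
      obtain ⟨v, hv, hvN⟩ := h N
      exact ⟨v, by simp [hRker v hv, hvN]⟩
    have hinj' : Function.Injective (D.comp (fderiv ℝ R p)) :=
      (LinearMap.injective_iff_surjective
        (f := (D.comp (fderiv ℝ R p) : Space →ₗ[ℝ] Space))).2 hsurj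
    have h0 : fderiv ℝ R p (n - fderiv ℝ R p n) = 0 := by
      rw [map_sub, hRker (fderiv ℝ R p n) (hLR n), sub_self]
    have h1 : n - fderiv ℝ R p n = 0 := hinj' (by simp [h0])
    apply hn
    rw [sub_eq_zero.1 h1, hLR]
  -- The embedding is thickened in the direction `N` to a local diffeomorphism of space that agrees
  -- with `f` on `F`; its inverse then pulls tangent vectors back.
  set G : Space → Space := fun x => f (R x) + g x • N with hG
  have hGc : ContDiffOn ℝ ∞ G (W ∩ U) :=
    (hf.contDiffOn.comp (hR.mono inter_subset_left) fun x hx => hRF hx.1).add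
      ((hg.mono inter_subset_right).smul contDiffOn_const)
  have hGd : HasFDerivAt G (D.comp (fderiv ℝ R p) + L.smulRight N) p := by
    have h1 : HasFDerivWithinAt f D F (R p) := by
      rw [hRid p hpW hp]; exact hf.hasFDerivWithinAt hp
    have h2 : HasFDerivAt (fun x => f (R x)) (D.comp (fderiv ℝ R p)) p :=
      (h1.comp p (hRat.hasFDerivWithinAt (s := W)) hRF).hasFDerivAt (hW.mem_nhds hpW)
    exact h2.add (((hg.contDiffAt (hU.mem_nhds hpU)).differentiableAt
      (by simp)).hasFDerivAt.smul_const N)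
  have hGinj : Function.Injective (fderiv ℝ G p) := by
    rw [hGd.fderiv, injective_iff_map_eq_zero]
    intro v hv
    simp only [_root_.add_apply, ContinuousLinearMap.comp_apply,
      ContinuousLinearMap.smulRight_apply] at hv
    by_cases hLv : L v = 0
    · rw [hLv, zero_smul, add_zero, hRker v hLv] at hv
      exact hinj v hLv hv
    · exfalso
      refine hN (-((L v)⁻¹ • fderiv ℝ R p v)) (by simp [hLR]) ?_
      rw [map_neg, map_smul, eq_neg_of_add_eq_zero_left hv, smul_neg, neg_neg, smul_smul,
        inv_mul_cancel₀ hLv, one_smul]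
  obtain ⟨Ψ, hΨ, hpΨ, hΨU, hΨs⟩ := exists_openPartialHomeomorph_of_injective_fderiv
    (hW.inter hU) ⟨hpW, hpU⟩ hGc hGinj
  have hGF : ∀ x ∈ F ∩ (W ∩ U), G x = f x := fun x hx => by
    simp only [hG]
    rw [hRid x hx.2.1 hx.1, (hFU.subset ⟨hx.1, hx.2.2⟩).2, zero_smul, add_zero]
  have hGp : G p = f p := hGF p ⟨hp, hpW, hpU⟩
  have hqt : f p ∈ Ψ.target := by
    have := Ψ.map_source hpΨ
    rwa [hΨ, hGp] at this
  have hsymmp : Ψ.symm (f p) = p := by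
    have := Ψ.left_inv hpΨ
    rwa [hΨ, hGp] at this
  have hsd : HasFDerivAt Ψ.symm (fderiv ℝ Ψ.symm (f p)) (f p) :=
    ((hΨs.contDiffAt (Ψ.open_target.mem_nhds hqt)).differentiableAt (by simp)).hasFDerivAt
  have hDD : (D.comp (fderiv ℝ R p) + L.smulRight N).comp (fderiv ℝ Ψ.symm (f p)) =
      ContinuousLinearMap.id ℝ Space := by
    have h1 : HasFDerivAt G (D.comp (fderiv ℝ R p) + L.smulRight N) (Ψ.symm (f p)) := by
      rw [hsymmp]; exact hGd
    have h2 := h1.comp (f p) hsd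
    refine h2.unique ((hasFDerivAt_id (f p)).congr_of_eventuallyEq ?_)
    filter_upwards [Ψ.open_target.mem_nhds hqt] with y hy
    have := Ψ.right_inv hy
    rwa [hΨ] at this
  -- This uses that `f` is a topological embedding: points of the image close to `f p` come from
  -- points of `F` close to `p`, so no other sheet of the image contributes tangent vectors.
  obtain ⟨S, hS, hSF⟩ : ∃ S ∈ 𝓝 (f p), ∀ y ∈ f '' F ∩ S, ∃ x ∈ F ∩ Ψ.source, f x = y := by
    have h2 := hf.isEmbedding.isInducing.nhds_eq_comap ⟨p, hp⟩
    have h3 : ((↑) : F → Space) ⁻¹' Ψ.source ∈ 𝓝 (⟨p, hp⟩ : F) :=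
      continuous_subtype_val.continuousAt.preimage_mem_nhds (Ψ.open_source.mem_nhds hpΨ)
    rw [h2, mem_comap] at h3
    obtain ⟨S, hS, hSs⟩ := h3
    refine ⟨S, hS, ?_⟩
    rintro _ ⟨⟨x, hx, rfl⟩, hxS⟩
    exact ⟨x, ⟨hx, hSs (show (⟨x, hx⟩ : F) ∈ F.domRestrict f ⁻¹' S from hxS)⟩, rfl⟩
  have hmaps : Ψ.symm '' (f '' F ∩ S) ⊆ F := by
    rintro _ ⟨y, hy, rfl⟩
    obtain ⟨x, hx, rfl⟩ := hSF y hy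
    have := Ψ.left_inv hx.2
    rw [hΨ, hGF x ⟨hx.1, hΨU hx.2⟩] at this
    rw [this]; exact hx.1
  have hu' : u ∈ tangentConeAt ℝ (f '' F ∩ S) (f p) := by
    rwa [tangentConeAt_inter_nhds hS]
  have hw := hsd.hasFDerivWithinAt.mapsTo_tangent_cone hu'
  rw [hsymmp] at hw
  have hw' := tangentConeAt_mono hmaps hw
  refine ⟨_, hw', ?_⟩
  have hLw : L (fderiv ℝ Ψ.symm (f p) u) = 0 := by
    have : fderiv ℝ Ψ.symm (f p) u ∈ tangentPlane F p := hw'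
    rwa [htan] at this
  have := DFunLike.congr_fun hDD u
  simpa [hLw, hRker _ hLw] using this

end TangentMap

section Isotopy

variable {F : Set Space} {γ : ℝ → Space} {Φ : ℝ → Space → Space}

/-- The differential of an isotopy along a curve in the surface depends continuously on time and
the parameter of the curve. -/
theorem IsIsotopyFixing.continuousOn_fderivWithin (hΦ : IsIsotopyFixing F γ Φ)
    (hF : IsSmoothSurface F) (hγ : Continuous γ) (hγF : ∀ t, γ t ∈ F) {μ : ℝ → Space}
    (hμ : Continuous μ) (hμT : ∀ s, μ s ∈ tangentPlane F (γ s)) :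
    ContinuousOn (fun z : ℝ × ℝ => fderivWithin ℝ (Φ z.1) F (γ z.2) (μ z.2))
      (Icc 0 1 ×ˢ univ) := by
  rintro ⟨r₀, s₀⟩ ⟨hr₀, -⟩
  obtain ⟨W, R, hW, hpW, hR, hRF, hRid, hRd⟩ := hF.exists_local_retraction (hγF s₀)
  -- A derivative within `F` is determined only on tangent vectors. Composition with the retraction
  -- replaces `F` by the open set `W`, where the derivative is unique and continuous, and changes
  -- nothing on tangent vectors because the differential of `R` fixes them.
  set Ψ : ℝ × Space → Space := fun x => Φ x.1 (R x.2) with hΨ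
  have hΨc : ContDiffOn ℝ ∞ Ψ (Icc 0 1 ×ˢ W) := by
    refine hΦ.contDiffOn.comp (f := fun x : ℝ × Space => (x.1, R x.2)) ?_ fun x hx =>
      ⟨hx.1, hRF hx.2⟩
    exact contDiffOn_fst.prodMk (hR.comp contDiffOn_snd fun x hx => hx.2)
  have hud : UniqueDiffOn ℝ (Icc (0:ℝ) 1 ×ˢ W) :=
    (uniqueDiffOn_Icc_zero_one).prod hW.uniqueDiffOn
  have hdc := hΨc.continuousOn_fderivWithin hud (by simp)
  have heq : ∀ r ∈ Icc (0:ℝ) 1, ∀ s, γ s ∈ W → fderivWithin ℝ (Φ r) F (γ s) (μ s) =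
      fderivWithin ℝ Ψ (Icc 0 1 ×ˢ W) (r, γ s) (0, μ s) := by
    intro r hr s hs
    have hRat : HasFDerivAt R (fderiv ℝ R (γ s)) (γ s) :=
      ((hR.contDiffAt (hW.mem_nhds hs)).differentiableAt (by simp)).hasFDerivAt
    have h1 : HasFDerivWithinAt (Φ r) (fderivWithin ℝ (Φ r) F (γ s)) F (R (γ s)) := by
      rw [hRid _ hs (hγF s)]; exact (hΦ.embedding r hr).hasFDerivWithinAt (hγF s)
    have h2 := h1.comp (γ s) (hRat.hasFDerivWithinAt (s := W)) hRF
    have h3 : HasFDerivWithinAt Ψ (fderivWithin ℝ Ψ (Icc 0 1 ×ˢ W) (r, γ s)) (Icc 0 1 ×ˢ W)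
        (r, γ s) := (hΨc.differentiableOn (by simp) _ ⟨hr, hs⟩).hasFDerivWithinAt
    have h4 : HasFDerivWithinAt (fun x : Space => (r, x))
        (ContinuousLinearMap.inr ℝ ℝ Space) W (γ s) :=
      (hasFDerivAt_prodMk_right r (γ s)).hasFDerivWithinAt
    have h5 := h3.comp (γ s) h4 fun x hx => ⟨hr, hx⟩
    have h6 := (hW.uniqueDiffWithinAt hs).eq h2 h5
    have h7 := DFunLike.congr_fun h6 (μ s)
    simpa [hRd _ hs (hγF s) _ (hμT s)] using h7
  have hN : Icc (0:ℝ) 1 ×ˢ (γ ⁻¹' W) ∈ 𝓝[Icc (0:ℝ) 1 ×ˢ univ] (r₀, s₀) := by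
    rw [nhdsWithin_prod_eq, nhdsWithin_univ]
    exact prod_mem_prod self_mem_nhdsWithin ((hW.preimage hγ).mem_nhds hpW)
  have hc : ContinuousOn (fun z : ℝ × ℝ => fderivWithin ℝ Ψ (Icc 0 1 ×ˢ W) (z.1, γ z.2)
      (0, μ z.2)) (Icc (0:ℝ) 1 ×ˢ (γ ⁻¹' W)) := by
    refine ContinuousOn.clm_apply (hdc.comp (by fun_prop) fun z hz => ⟨hz.1, hz.2⟩) (by fun_prop)
  have h1 : ContinuousWithinAt (fun z : ℝ × ℝ => fderivWithin ℝ (Φ z.1) F (γ z.2) (μ z.2))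
      (Icc (0:ℝ) 1 ×ˢ (γ ⁻¹' W)) (r₀, s₀) :=
    (hc.congr fun z hz => heq z.1 hz.1 z.2 hz.2) (r₀, s₀) ⟨hr₀, hpW⟩
  exact h1.mono_of_mem_nhdsWithin hN

theorem IsIsotopyFixing.fderivWithin_deriv (hΦ : IsIsotopyFixing F γ Φ)
    (hγ : IsEmbeddedClosedCurve γ) (hγF : ∀ t, γ t ∈ F) {r : ℝ} (hr : r ∈ Icc (0:ℝ) 1) (s : ℝ) :
    fderivWithin ℝ (Φ r) F (γ s) (deriv γ s) = deriv γ s := by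
  have h1 := ((hΦ.embedding r hr).hasFDerivWithinAt (hγF s)).comp_hasDerivAt s
    (hγ.hasDerivAt s) (Eventually.of_forall hγF)
  have h2 : Φ r ∘ γ = γ := funext fun s => hΦ.fixes r hr s
  rw [h2] at h1
  exact h1.unique (hγ.hasDerivAt s)

/-- The tangent plane is the orthogonal complement of the unit normal. -/
theorem IsUnitNormalField.mem_tangentPlane_iff {ν : Space → Space} (hν : IsUnitNormalField F ν)
    (hF : IsSmoothSurface F) {p : Space} (hp : p ∈ F) (w : Space) :
    w ∈ tangentPlane F p ↔ inner ℝ w (ν p) = 0 := by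
  refine ⟨hν.normal p hp w, fun hw => ?_⟩
  obtain ⟨L, -, hL⟩ := hF.exists_functional hp
  rw [hL]
  by_contra hLw
  have hLw : L w ≠ 0 := hLw
  -- If `w` were orthogonal to `ν p` but not tangent, this correction of `ν p` would be tangent, and
  -- its inner product with `ν p` would be 1 instead of 0.
  have h1 := hν.normal p hp (ν p - (L (ν p) / L w) • w) (by
    rw [hL, mem_ofPred_eq, map_sub, map_smul, smul_eq_mul]
    field_simp; ring)
  rw [inner_sub_left, inner_smul_left, hw, real_inner_self_eq_norm_sq, hν.norm_eq_one p hp] at h1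
  simp at h1

/-- Expansion of a vector orthogonal to a normal vector of the curve. -/
theorem eq_add_smul_frameVec (hγ : IsEmbeddedClosedCurve γ) (h : NowhereVertical γ) {t φ : ℝ}
    {w : Space} (hw : inner ℝ w (frameVec γ t φ) = 0) :
    ∃ x y : ℝ, w = x • deriv γ t + y • frameVec γ t (φ + Real.pi / 2) := by
  set a := inner ℝ (blackboardFraming γ t) w with ha
  set b := inner ℝ (binormal γ t) w with hb
  have h1 : a * Real.cos φ + b * Real.sin φ = 0 := by
    rw [frameVec, inner_add_right, inner_smul_right, inner_smul_right, real_inner_comm,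
      real_inner_comm (binormal γ t)] at hw
    linarith
  refine ⟨inner ℝ (deriv γ t) w / ‖deriv γ t‖ ^ 2, b * Real.cos φ - a * Real.sin φ, ?_⟩
  conv_lhs => rw [frame_expansion hγ h t w]
  rw [← ha, ← hb, add_assoc, frameVec, Real.cos_add_pi_div_two, Real.sin_add_pi_div_two]
  have e1 : a = (b * Real.cos φ - a * Real.sin φ) * -Real.sin φ := by
    linear_combination Real.cos φ * h1 - a * Real.sin_sq_add_cos_sq φ
  have e2 : b = (b * Real.cos φ - a * Real.sin φ) * Real.cos φ := by
    linear_combination Real.sin φ * h1 - b * Real.sin_sq_add_cos_sq φ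
  rw [smul_add, smul_smul, smul_smul, ← e1, ← e2]

end Isotopy

/-! ### Homotopy invariance of the winding number -/

/-- A homotopy of closed curves in the unit circle carries a continuous periodic angle of one end
to a continuous periodic angle of the other end. -/
theorem exists_periodic_angle_of_homotopy {w : ℝ × ℝ → ℂ}
    (hw : ContinuousOn w (Icc 0 1 ×ˢ univ)) (hn : ∀ z ∈ Icc (0:ℝ) 1 ×ˢ univ, ‖w z‖ = 1)
    (hper : ∀ r ∈ Icc (0:ℝ) 1, ∀ s, w (r, s + 1) = w (r, s)) (h1 : ∀ s, w (1, s) = 1) :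
    ∃ α : ℝ → ℝ, Continuous α ∧ Function.Periodic α 1 ∧
      ∀ s, w (0, s) = Complex.exp (α s * Complex.I) := by
  obtain ⟨δ, hδ, hδ'⟩ := Metric.uniformContinuousOn_iff.1
    ((isCompact_Icc.prod isCompact_Icc).uniformContinuousOn_of_continuous
      (hw.mono (prod_mono subset_rfl (subset_univ (Icc (0:ℝ) 1))))) 1 one_pos
  have hclose : ∀ r ∈ Icc (0:ℝ) 1, ∀ r' ∈ Icc (0:ℝ) 1, |r - r'| < δ → ∀ s,
      dist (w (r, s)) (w (r', s)) < 1 := by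
    intro r hr r' hr' hrr s
    have hp : ∀ r ∈ Icc (0:ℝ) 1, w (r, s) = w (r, Int.fract s) := fun r hr => by
      have : Function.Periodic (fun s => w (r, s)) 1 := hper r hr
      have := this.int_mul (-⌊s⌋) s
      simp only [mul_one] at this
      rw [← this]; congr 2; simp [Int.fract, sub_eq_add_neg]
    rw [hp r hr, hp r' hr']
    have hs : Int.fract s ∈ Icc (0:ℝ) 1 := ⟨Int.fract_nonneg s, (Int.fract_lt_one s).le⟩
    exact hδ' _ ⟨hr, hs⟩ _ ⟨hr', hs⟩ (by simpa [Prod.dist_eq, Real.dist_eq] using hrr)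
  set P : ℝ → Prop := fun r => ∃ α : ℝ → ℝ, Continuous α ∧ Function.Periodic α 1 ∧
      ∀ s, w (r, s) = Complex.exp (α s * Complex.I) with hP
  have hstep : ∀ r ∈ Icc (0:ℝ) 1, ∀ r' ∈ Icc (0:ℝ) 1, |r' - r| < δ → P r → P r' := by
    rintro r hr r' hr' hrr ⟨α, hα, hαp, hαe⟩
    have hne : ∀ r ∈ Icc (0:ℝ) 1, ∀ s, w (r, s) ≠ 0 := fun r hr s => by
      rw [← norm_pos_iff, hn _ ⟨hr, mem_univ _⟩]; exact one_pos
    have hcr : ∀ r ∈ Icc (0:ℝ) 1, Continuous fun s => w (r, s) := fun r hr => by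
      rw [← continuousOn_univ]
      exact hw.comp (f := fun s => (r, s)) (by fun_prop) fun s _ => ⟨hr, mem_univ _⟩
    -- At nearby times the quotient is at distance less than 1 from 1, so its principal argument is
    -- continuous in `s`. Being periodic, it corrects the old angle to a new periodic one.
    have hslit : ∀ s, w (r', s) / w (r, s) ∈ Complex.slitPlane := by
      intro s
      rw [← add_sub_cancel 1 (w (r', s) / w (r, s))]
      apply Complex.mem_slitPlane_of_norm_lt_one
      rw [div_sub_one (hne r hr s), norm_div, hn (r, s) ⟨hr, mem_univ _⟩, div_one, ← dist_eq_norm]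
      exact hclose r' hr' r hr hrr s
    refine ⟨fun s => α s + Complex.arg (w (r', s) / w (r, s)), ?_, ?_, ?_⟩
    · refine hα.add (continuous_iff_continuousAt.2 fun s => ?_)
      exact (Complex.continuousAt_arg (hslit s)).comp
        (f := fun s => w (r', s) / w (r, s))
        (((hcr r' hr').div (hcr r hr) (hne r hr)).continuousAt)
    · intro s
      simp only [hαp s, hper r hr s, hper r' hr' s]
    · intro s
      have h2 := Complex.norm_mul_exp_arg_mul_I (w (r', s) / w (r, s))
      rw [norm_div, hn (r, s) ⟨hr, mem_univ _⟩, hn (r', s) ⟨hr', mem_univ _⟩, div_one, Complex.ofReal_one,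
        one_mul] at h2
      rw [Complex.ofReal_add, add_mul, Complex.exp_add, ← hαe, h2, mul_div_cancel₀ _ (hne r hr s)]
  obtain ⟨N, hN⟩ := exists_nat_gt (1 / δ)
  have hNpos : (0:ℝ) < N := (by positivity : (0:ℝ) < 1 / δ).trans hN
  -- The induction runs backwards from time 1, where the angle 0 works; steps of length 1/N < δ are
  -- short enough.
  have hind : ∀ j : ℕ, j ≤ N → P (1 - j / N) := by
    intro j
    induction j with
    | zero => exact fun _ => ⟨fun _ => 0, continuous_const, fun _ => rfl, fun s => by simp [h1]⟩
    | succ j ih =>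
      intro hj
      have hmem : ∀ i : ℕ, i ≤ N → (1 - i / N : ℝ) ∈ Icc (0:ℝ) 1 := fun i hi => by
        have : (i:ℝ) / N ≤ 1 := by rw [div_le_one hNpos]; exact_mod_cast hi
        have : 0 ≤ (i:ℝ) / N := by positivity
        constructor <;> linarith
      refine hstep _ (hmem j (by omega)) _ (hmem (j + 1) hj) ?_ (ih (by omega))
      have : (1 - ((j + 1 : ℕ) : ℝ) / N) - (1 - (j:ℝ) / N) = -(1 / N) := by push_cast; ring
      rw [this, abs_neg, abs_of_pos (by positivity), div_lt_comm₀ hNpos hδ]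
      exact hN
  have := hind N le_rfl
  rwa [div_self hNpos.ne', sub_self] at this

/-- If a surface can be moved, keeping the curve `γ` fixed, so that it becomes vertical along `γ`,
then its normal does not wind around the blackboard framing. -/
theorem IsIsotopyFixing.winding_eq_zero {F : Set Space} {ν : Space → Space} {γ : ℝ → Space}
    {Φ : ℝ → Space → Space} (hΦ : IsIsotopyFixing F γ Φ) (hF : IsSmoothSurface F)
    (hν : IsUnitNormalField F ν) (hγ : IsEmbeddedClosedCurve γ) (hγF : ∀ t, γ t ∈ F)
    (h : NowhereVertical γ) (hvl : range γ ⊆ verticalLocus (Φ 1 '' F)) {θ : ℝ → ℝ} {k : ℤ}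
    (hθ : Continuous θ) (hνθ : ∀ t, ν (γ t) = frameVec γ t (θ t))
    (hk : ∀ t, θ (t + 1) = θ t + k * (2 * Real.pi)) : k = 0 := by
  -- A quarter turn of the normal: the unit tangent vector of `F` orthogonal to `γ`.
  set μ : ℝ → Space := fun s => frameVec γ s (θ s + Real.pi / 2) with hμ
  have hμc : Continuous μ := by
    have h1 := (contDiff_blackboardFraming hγ h).continuous
    have h2 := (contDiff_binormal hγ h).continuous
    simp only [hμ, frameVec]
    fun_prop
  have hμT : ∀ s, μ s ∈ tangentPlane F (γ s) := fun s => by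
    rw [hν.mem_tangentPlane_iff hF (hγF s), hνθ, inner_frameVec_frameVec hγ h]
    simp
  have hμp : Function.Periodic μ 1 := fun s => by
    simp only [hμ, hk, frameVec_add_one hγ]
    rw [add_right_comm, frameVec_add_int_mul_two_pi]
  set V : ℝ × ℝ → Space := fun z => fderivWithin ℝ (Φ z.1) F (γ z.2) (μ z.2) with hV
  have hVc : ContinuousOn V (Icc 0 1 ×ˢ univ) :=
    hΦ.continuousOn_fderivWithin hF hγ.contDiff.continuous hγF hμc hμT
  have hTT : ∀ s, deriv γ s ∈ tangentPlane F (γ s) := fun s =>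
    mem_tangentPlane_of_hasDerivAt (Eventually.of_forall hγF) (hγ.hasDerivAt s)
  have hμ0 : ∀ s c, μ s ≠ c • deriv γ s := fun s c heq => by
    have h1 := inner_deriv_frameVec γ s (θ s + Real.pi / 2)
    have h2 := norm_frameVec hγ h s (θ s + Real.pi / 2)
    rw [← hμ] at *
    have h3 : inner ℝ (μ s) (μ s) = 0 := by
      conv_lhs => rw [heq]
      rw [inner_smul_left, inner_smul_right]
      have : inner ℝ (deriv γ s) (μ s) = 0 := h1
      rw [heq, inner_smul_right] at this
      rw [this]; simp
    rw [inner_self_eq_zero] at h3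
    have h2 : ‖μ s‖ = 1 := h2
    rw [h3, norm_zero] at h2
    exact zero_ne_one h2
  set x : ℝ × ℝ → ℝ := fun z => inner ℝ (blackboardFraming γ z.2) (V z) with hx
  set y : ℝ × ℝ → ℝ := fun z => inner ℝ (binormal γ z.2) (V z) with hy
  have hxc : ContinuousOn x (Icc 0 1 ×ˢ univ) :=
    ((contDiff_blackboardFraming hγ h).continuous.comp continuous_snd).continuousOn.inner hVc
  have hyc : ContinuousOn y (Icc 0 1 ×ˢ univ) :=
    ((contDiff_binormal hγ h).continuous.comp continuous_snd).continuousOn.inner hVc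
  -- The part of `V` normal to `γ`, with β and b as the real and imaginary directions.
  set Z : ℝ × ℝ → ℂ := fun z => ⟨x z, y z⟩ with hZ
  have hZeq : Z = fun z => (x z : ℂ) + y z * Complex.I := funext fun z => by
    rw [hZ]; exact Complex.mk_eq_add_mul_I _ _
  have hZc : ContinuousOn Z (Icc 0 1 ×ˢ univ) := by
    rw [hZeq]
    exact (Complex.continuous_ofReal.comp_continuousOn hxc).add
      ((Complex.continuous_ofReal.comp_continuousOn hyc).mul continuousOn_const)
  -- If the normal part vanishes, `V` is a multiple of the velocity, which the differential of `Φ r`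
  -- fixes. Injectivity on the tangent plane then makes `μ` a multiple of the velocity.
  have hZ0 : ∀ z ∈ Icc (0:ℝ) 1 ×ˢ univ, Z z ≠ 0 := by
    rintro ⟨r, s⟩ ⟨hr, -⟩ h0
    have hx0 : x (r, s) = 0 := congrArg Complex.re h0
    have hy0 : y (r, s) = 0 := congrArg Complex.im h0
    have h1 := frame_expansion hγ h s (V (r, s))
    have hx0' : inner ℝ (blackboardFraming γ s) (V (r, s)) = 0 := hx0
    have hy0' : inner ℝ (binormal γ s) (V (r, s)) = 0 := hy0
    rw [hx0', hy0', zero_smul, zero_smul, add_zero, add_zero] at h1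
    set c := inner ℝ (deriv γ s) (V (r, s)) / ‖deriv γ s‖ ^ 2
    apply hμ0 s c
    have h2 := (hΦ.embedding r hr).immersion (γ s) (hγF s) (μ s - c • deriv γ s) (by
      rw [hν.mem_tangentPlane_iff hF (hγF s)]
      rw [inner_sub_left, inner_smul_left, hν.normal _ (hγF s) _ (hμT s),
        hν.normal _ (hγF s) _ (hTT s)]
      simp) (by
      rw [map_sub, map_smul, hΦ.fderivWithin_deriv hγ hγF hr s, ← h1, sub_self])
    exact sub_eq_zero.1 h2
  -- At time 1 the vertical vector is a combination of the velocity and `V`. Both it and the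
  -- velocity are orthogonal to β, and the coefficient of `V` is nonzero because the velocity is not
  -- vertical.
  have hZ1 : ∀ s, x (1, s) = 0 := by
    intro s
    have hm : vert ∈ tangentPlane (Φ 1 '' F) (Φ 1 (γ s)) := by
      rw [hΦ.fixes 1 (by simp) s]
      exact (hvl ⟨s, rfl⟩).2
    obtain ⟨w, hwT, hw⟩ := (hΦ.embedding 1 (by simp)).exists_of_mem_tangentPlane_image hF (hγF s) hm
    obtain ⟨a, b, hab⟩ := eq_add_smul_frameVec hγ h (t := s) (φ := θ s) (w := w) (by
      rw [← hνθ]; exact hν.normal _ (hγF s) _ hwT)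
    rw [hab, map_add, map_smul, map_smul, hΦ.fderivWithin_deriv hγ hγF (by simp) s] at hw
    have hw : a • deriv γ s + b • V (1, s) = vert := hw
    have h1 := congrArg (fun v => inner ℝ (blackboardFraming γ s) v) hw
    simp only [inner_add_right, inner_smul_right, inner_blackboardFraming_vert] at h1
    rw [real_inner_comm, inner_deriv_blackboardFraming, mul_zero, zero_add] at h1
    refine (mul_eq_zero.1 h1).resolve_left fun hb => ?_
    rw [hb, zero_smul, add_zero] at hw
    have ha : a ≠ 0 := by
      rintro rfl
      rw [zero_smul] at hw
      have := congrArg (fun v : Space => v 2) hw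
      simp [vert] at this
    apply h s
    rw [Submodule.mem_span_singleton]
    exact ⟨a⁻¹, by rw [← hw, smul_smul, inv_mul_cancel₀ ha, one_smul]⟩
  have hVp : ∀ r s, V (r, s + 1) = V (r, s) := fun r s => by
    simp only [hV, hγ.periodic s, hμp s]
  -- At time 1 only the line through `Z` is known, namely the imaginary axis. The normalized square
  -- does not see the sign of `Z`, and the minus sign makes its value at time 1 equal to 1.
  obtain ⟨α, hα, hαp, hαe⟩ := exists_periodic_angle_of_homotopy
    (w := fun z => -(Z z) ^ 2 / (‖Z z‖ ^ 2 : ℝ)) (by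
      refine ((hZc.pow 2).neg).div ?_ fun z hz => ?_
      · exact Complex.continuous_ofReal.comp_continuousOn (hZc.norm.pow 2)
      · have := norm_pos_iff.2 (hZ0 z hz)
        exact_mod_cast (by positivity : ‖Z z‖ ^ 2 ≠ 0))
    (fun z hz => by
      have := norm_pos_iff.2 (hZ0 z hz)
      rw [norm_div, norm_neg, norm_pow, Complex.norm_real, Real.norm_of_nonneg (by positivity)]
      exact div_self (by positivity))
    (fun r _ s => by
      simp only [hZ, hx, hy, hVp, periodic_blackboardFraming hγ s, periodic_binormal hγ s])
    (fun s => by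
      have h1 : Z (1, s) = y (1, s) * Complex.I := by rw [hZeq]; simp [hZ1]
      have h2 : ‖Z (1, s)‖ ^ 2 = y (1, s) ^ 2 := by
        rw [h1]; simp
      have h3 : Z (1, s) ≠ 0 := hZ0 _ ⟨by simp, mem_univ _⟩
      have h4 : y (1, s) ≠ 0 := fun h0 => h3 (by rw [h1, h0]; simp)
      show -Z (1, s) ^ 2 / ((‖Z (1, s)‖ ^ 2 : ℝ) : ℂ) = 1
      rw [h2, h1, mul_pow, Complex.I_sq]
      push_cast
      have : (y (1, s) : ℂ) ≠ 0 := by exact_mod_cast h4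
      field_simp)
  have hV0 : ∀ s, V (0, s) = μ s := fun s => by
    have h1 : HasFDerivWithinAt (Φ 0) (ContinuousLinearMap.id ℝ Space) F (γ s) :=
      (hasFDerivWithinAt_id (γ s) F).congr (fun p hp => hΦ.start p hp) (hΦ.start _ (hγF s))
    exact ((hΦ.embedding 0 (by simp)).hasFDerivWithinAt (hγF s)).unique_on h1 (hμT s)
  -- At time 0, `Z` has angle θ + π/2, so minus its square has angle 2θ. Hence 2θ differs from the
  -- periodic angle α by a constant.
  have hcos : ∀ s, Real.cos (2 * θ s - α s) = 1 := by
    intro s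
    have h1 : Z (0, s) = Complex.exp ((θ s + Real.pi / 2 : ℝ) * Complex.I) := by
      rw [hZeq]
      simp only [hx, hy, hV0, hμ]
      rw [inner_blackboardFraming_frameVec h, inner_binormal_frameVec hγ h, Complex.exp_mul_I,
        ← Complex.ofReal_cos, ← Complex.ofReal_sin]
    have h2 : ‖Z (0, s)‖ = 1 := by rw [h1]; exact Complex.norm_exp_ofReal_mul_I _
    have h3 := hαe s
    simp only [h2] at h3
    rw [h1, ← Complex.exp_nat_mul] at h3
    have h4 : Complex.exp ((2 * θ s - α s : ℝ) * Complex.I) = 1 := by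
      have e1 : ((2 * θ s - α s : ℝ) : ℂ) * Complex.I =
          ((2 : ℕ) : ℂ) * ((θ s + Real.pi / 2 : ℝ) * Complex.I) - Real.pi * Complex.I -
            α s * Complex.I := by push_cast; ring
      rw [e1, Complex.exp_sub, Complex.exp_sub, Complex.exp_pi_mul_I, ← h3]
      have : Complex.exp (((2 : ℕ) : ℂ) * ((θ s + Real.pi / 2 : ℝ) * Complex.I)) ≠ 0 :=
        Complex.exp_ne_zero _
      field_simp
      simp
    have := congrArg Complex.re h4
    rwa [Complex.exp_ofReal_mul_I_re, Complex.one_re] at this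
  obtain ⟨n, hn⟩ := exists_int_of_forall_cos_eq_one (by fun_prop) hcos
  have h1 := hn 1
  have h0 := hn 0
  have e1 := hk 0
  have e2 := hαp 0
  rw [zero_add] at e1 e2
  have : (k : ℝ) * (2 * Real.pi) = 0 := by linarith
  have hpi := Real.pi_pos
  have := (mul_eq_zero.1 this).resolve_right (by positivity)
  exact_mod_cast this

open scoped Manifold

/-! ### Extension of functions on a closed curve -/

/-- A smooth cutoff function that is `1` near a compact set. -/
theorem exists_cutoff {K N : Set Space} (hK : IsCompact K) (hN : IsOpen N) (hKN : K ⊆ N) :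
    ∃ χ : Space → ℝ, ContDiff ℝ ∞ χ ∧ HasCompactSupport χ ∧ tsupport χ ⊆ N ∧
      (∀ x ∈ K, ∀ᶠ y in 𝓝 x, χ y = 1) ∧ ∀ x, χ x ∈ Icc (0:ℝ) 1 := by
  obtain ⟨L, hL, hKL, hLN⟩ := exists_compact_between hK hN hKN
  obtain ⟨f, h1, h0, hf⟩ := exists_contMDiffMap_one_nhds_of_subset_interior 𝓘(ℝ, Space)
    (n := ⊤) hK.isClosed hKL
  have hsupp : Function.support f ⊆ L := fun x hx => by
    by_contra hxL
    exact hx (h0 x hxL)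
  have hts : tsupport f ⊆ L := closure_minimal hsupp hL.isClosed
  refine ⟨f, f.contMDiff.contDiff, hL.of_isClosed_subset (isClosed_tsupport f) hts,
    hts.trans hLN, fun x hx => ?_, hf⟩
  exact h1.filter_mono (nhds_le_nhdsSet hx)

/-- A product with a smooth function is smooth if the other factor is smooth near the support of
the first. -/
theorem contDiff_smul_of_tsupport_subset {E : Type*} [NormedAddCommGroup E] [NormedSpace ℝ E]
    {χ : Space → ℝ} (hχ : ContDiff ℝ ∞ χ) {f : Space → E}
    (hf : ∀ x ∈ tsupport χ, ContDiffAt ℝ ∞ f x) : ContDiff ℝ ∞ fun x => χ x • f x := by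
  rw [contDiff_iff_contDiffAt]
  intro x
  by_cases hx : x ∈ tsupport χ
  · exact hχ.contDiffAt.smul (hf x hx)
  · refine contDiffAt_const (c := (0 : E)) |>.congr_of_eventuallyEq ?_
    filter_upwards [notMem_tsupport_iff_eventuallyEq.1 hx] with y hy
    rw [hy]; simp

/-- Near every nonzero complex number there is a smooth branch of the argument, normalized to have
period `1`. -/
theorem exists_smooth_arg {z : ℂ} (hz : z ≠ 0) :
    ∃ σ : ℂ → ℝ, ContDiffAt ℝ ∞ σ z ∧
      ∀ᶠ w in 𝓝 z, ∃ n : ℤ, Complex.arg w / (2 * Real.pi) = σ w + n := by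
  have harg : ∀ z ∈ Complex.slitPlane, ContDiffAt ℝ ∞ Complex.arg z := fun z hz => by
    have h1 : ContDiffAt ℝ ∞ Complex.log z := (Complex.contDiffAt_log hz).restrict_scalars ℝ
    have h2 := Complex.imCLM.contDiff.contDiffAt.comp z h1
    exact h2.congr_of_eventuallyEq (Eventually.of_forall fun w => (Complex.log_im w).symm)
  have hpi := Real.pi_pos
  rcases Complex.mem_slitPlane_or_neg_mem_slitPlane hz with h | h
  · exact ⟨fun w => Complex.arg w / (2 * Real.pi), (harg z h).div_const _,
      Eventually.of_forall fun w => ⟨0, by simp⟩⟩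
  -- Near the cut the argument of `-w` is smooth; it differs from that of `w` by half a turn modulo
  -- full turns.
  · refine ⟨fun w => Complex.arg (-w) / (2 * Real.pi) - 1 / 2,
      (((harg _ h).comp z contDiffAt_id.neg).div_const _).sub contDiffAt_const, ?_⟩
    filter_upwards [isOpen_ne.mem_nhds hz] with w hw
    have h1 := Complex.arg_neg_coe_angle hw
    rw [← Real.Angle.coe_add] at h1
    obtain ⟨k, hk⟩ := Real.Angle.angle_eq_iff_two_pi_dvd_sub.1 h1
    refine ⟨-k, ?_⟩
    push_cast
    field_simp
    linarith

section Extension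

variable {γ : ℝ → Space}

/-- The parameter on an embedded closed curve extends to a smooth function on space with values in
the plane. -/
theorem exists_circle_extension (hγ : IsEmbeddedClosedCurve γ) :
    ∃ c : Space → ℂ, ContDiff ℝ ∞ c ∧
      ∀ s, c (γ s) = Complex.exp ((2 * Real.pi * s : ℝ) * Complex.I) := by
  -- The admissible values: one point on the curve, all of ℂ off it. These sets are convex, so local
  -- extensions can be glued by a partition of unity.
  set t : Space → Set ℂ := fun x =>
    {z | ∀ s, γ s = x → z = Complex.exp ((2 * Real.pi * s : ℝ) * Complex.I)} with ht
  have hexp : ∀ (s : ℝ) (n : ℤ), Complex.exp ((2 * Real.pi * (s + n) : ℝ) * Complex.I) =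
      Complex.exp ((2 * Real.pi * s : ℝ) * Complex.I) := fun s n => by
    rw [Complex.exp_eq_exp_iff_exists_int]
    exact ⟨n, by push_cast; ring⟩
  have hconv : ∀ x, Convex ℝ (t x) := by
    intro x z hz w hw a b ha hb hab s hs
    rw [hz s hs, hw s hs, ← add_smul, hab, one_smul]
  have hloc : ∀ x : Space, ∃ U ∈ 𝓝 x, ∃ g : Space → ℂ,
      ContMDiffOn 𝓘(ℝ, Space) 𝓘(ℝ, ℂ) ((⊤ : ℕ∞) : ℕ∞ω) g U ∧ ∀ y ∈ U, g y ∈ t y := by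
    intro x
    by_cases hx : x ∈ range γ
    · obtain ⟨s₀, rfl⟩ := hx
      -- Restricted to `γ`, this linear function is a coordinate near `s₀`; inverting it there
      -- recovers the parameter from the point.
      set ℓ : Space → ℝ := fun p => inner ℝ (deriv γ s₀) p with hℓ
      have hℓc : ContDiff ℝ ∞ ℓ := contDiff_const.inner ℝ contDiff_id
      have hed : HasDerivAt (fun s => ℓ (γ s)) (inner ℝ (deriv γ s₀) (deriv γ s₀)) s₀ := by
        simpa using (hasDerivAt_const s₀ (deriv γ s₀)).inner ℝ (hγ.hasDerivAt s₀)
      have hne : (inner ℝ (deriv γ s₀) (deriv γ s₀) : ℝ) ≠ 0 :=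
        inner_self_ne_zero.2 (hγ.deriv_ne_zero s₀)
      obtain ⟨Ψ, hΨ, hsΨ, -, hΨs⟩ := exists_openPartialHomeomorph_of_injective_fderiv
        (G := fun s => ℓ (γ s)) isOpen_univ (mem_univ s₀) (hℓc.comp hγ.contDiff).contDiffOn (by
          rw [hed.hasFDerivAt.fderiv]
          intro u v huv
          simpa [hγ.deriv_ne_zero s₀] using huv)
      -- The rest of the curve may meet the same levels of `ℓ` at wrong parameters. It is compact
      -- and avoids `γ s₀` by injectivity, so it can be removed.
      set K : Set Space := γ '' (Icc (s₀ - 1/2) (s₀ + 1/2) \ Ψ.source) with hK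
      have hKc : IsCompact K := (isCompact_Icc.diff Ψ.open_source).image hγ.contDiff.continuous
      have hxK : γ s₀ ∈ Kᶜ := by
        rintro ⟨s, ⟨hs, hsS⟩, hse⟩
        obtain ⟨n, hn⟩ := hγ.exists_eq_add_int hse
        have h1 : (n:ℝ) < 1 := by linarith [hs.2]
        have h2 : (-1:ℝ) < n := by linarith [hs.1]
        have h3 : n < 1 := by exact_mod_cast h1
        have h4 : -1 < n := by exact_mod_cast h2
        apply hsS
        rw [hn, show n = 0 by omega]
        simpa using hsΨ
      refine ⟨ℓ ⁻¹' Ψ.target ∩ Kᶜ, ?_,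
        fun p => Complex.exp ((2 * Real.pi * Ψ.symm (ℓ p) : ℝ) * Complex.I), ?_, ?_⟩
      · refine inter_mem ?_ (hKc.isClosed.isOpen_compl.mem_nhds hxK)
        refine (Ψ.open_target.preimage hℓc.continuous).mem_nhds ?_
        have := Ψ.map_source hsΨ
        rwa [hΨ] at this
      · apply ContDiffOn.contMDiffOn
        have h1 : ContDiffOn ℝ ∞ (fun p => Ψ.symm (ℓ p)) (ℓ ⁻¹' Ψ.target ∩ Kᶜ) :=
          hΨs.comp hℓc.contDiffOn fun p hp => hp.1
        have h2 : ContDiff ℝ ∞ fun r : ℝ => Complex.exp ((2 * Real.pi * r : ℝ) * Complex.I) :=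
          Complex.contDiff_exp.comp
            ((Complex.ofRealCLM.contDiff.comp (contDiff_const.mul contDiff_id)).mul contDiff_const)
        exact h2.comp_contDiffOn h1
      · rintro y ⟨-, hyK⟩ s rfl
        set s' := s + (-round (s - s₀) : ℤ) with hs'
        have hγs : γ s' = γ s := hγ.apply_add_int _ _
        have habs := abs_le.1 (abs_sub_round (s - s₀))
        have hmem : s' ∈ Ψ.source := by
          by_contra hns
          refine hyK ⟨s', ⟨⟨?_, ?_⟩, hns⟩, hγs⟩
          · rw [hs']; push_cast; linarith [habs.1]
          · rw [hs']; push_cast; linarith [habs.2]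
        have h1 := Ψ.left_inv hmem
        rw [hΨ] at h1
        simp only [hγs] at h1
        beta_reduce
        rw [h1, hs', hexp]
    · refine ⟨(range γ)ᶜ, (isOpen_compl_range hγ).mem_nhds hx, fun _ => 0, contMDiffOn_const, ?_⟩
      intro y hy s hs
      exact absurd ⟨s, hs⟩ hy
  obtain ⟨g, hg⟩ := exists_contMDiffMap_forall_mem_convex_of_local 𝓘(ℝ, Space) hconv hloc
  exact ⟨g, g.contMDiff.contDiff, fun s => hg (γ s) s rfl⟩

/-- A smooth function on an embedded closed curve extends to a smooth function supported near the
curve that is constant to first order in normal directions up to reparametrization. -/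
theorem exists_extension (hγ : IsEmbeddedClosedCurve γ) {E : Type*} [NormedAddCommGroup E]
    [NormedSpace ℝ E] {e : ℝ → E} (he : ContDiff ℝ ∞ e) (hp : Function.Periodic e 1) {C : ℝ}
    (hC : ∀ s, ‖e s‖ ≤ C) {N : Set Space} (hN : IsOpen N) (hγN : range γ ⊆ N) :
    ∃ f : Space → E, ContDiff ℝ ∞ f ∧ HasCompactSupport f ∧ tsupport f ⊆ N ∧ (∀ x, ‖f x‖ ≤ C) ∧
      (∀ s, f (γ s) = e s) ∧ ∀ s v, ∃ r : ℝ, fderiv ℝ f (γ s) v = r • deriv e s := by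
  obtain ⟨c, hc, hcγ⟩ := exists_circle_extension hγ
  have hU : IsOpen {x | c x ≠ 0} := isOpen_ne.preimage hc.continuous
  have hγU : range γ ⊆ N ∩ {x | c x ≠ 0} := by
    rintro _ ⟨s, rfl⟩
    refine ⟨hγN ⟨s, rfl⟩, ?_⟩
    rw [mem_ofPred_eq, hcγ]; exact Complex.exp_ne_zero _
  obtain ⟨χ, hχ, hχc, hχN, hχ1, hχI⟩ := exists_cutoff hγ.isCompact_range (hN.inter hU) hγU
  have hpn : ∀ s (n : ℤ), e (s + n) = e s := fun s n => by
    have := hp.int_mul n s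
    rwa [mul_one] at this
  -- Since `e` has period 1, the choice of the argument does not matter, and `a` is smooth wherever
  -- `c` is nonzero, across the cut as well.
  set a : Space → E := fun x => e (Complex.arg (c x) / (2 * Real.pi)) with ha
  have hloc : ∀ x, c x ≠ 0 → ∃ σ : Space → ℝ, ContDiffAt ℝ ∞ σ x ∧
      (∃ n : ℤ, Complex.arg (c x) / (2 * Real.pi) = σ x + n) ∧ ∀ᶠ y in 𝓝 x, a y = e (σ y) := by
    intro x hx
    obtain ⟨σ, hσ, hσe⟩ := exists_smooth_arg hx
    refine ⟨σ ∘ c, hσ.comp x hc.contDiffAt, hσe.self_of_nhds, ?_⟩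
    filter_upwards [hc.continuous.continuousAt.eventually hσe] with y ⟨n, hn⟩
    simp only [ha, hn, Function.comp_apply, hpn]
  have hac : ∀ x, c x ≠ 0 → ContDiffAt ℝ ∞ a x := fun x hx => by
    obtain ⟨σ, hσ, -, hσe⟩ := hloc x hx
    exact (he.contDiffAt.comp x hσ).congr_of_eventuallyEq hσe
  have hargs : ∀ s, ∃ n : ℤ, Complex.arg (c (γ s)) / (2 * Real.pi) = s + n := fun s => by
    have h1 := Complex.arg_cos_add_sin_mul_I_coe_angle (2 * Real.pi * s : ℝ)
    rw [Real.Angle.cos_coe, Real.Angle.sin_coe, Complex.ofReal_cos, Complex.ofReal_sin,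
      ← Complex.exp_mul_I, ← hcγ] at h1
    obtain ⟨k, hk⟩ := Real.Angle.angle_eq_iff_two_pi_dvd_sub.1 h1
    refine ⟨k, ?_⟩
    have hpi := Real.pi_pos
    field_simp
    linarith
  have haγ : ∀ s, a (γ s) = e s := fun s => by
    obtain ⟨n, hn⟩ := hargs s
    simp only [ha, hn, hpn]
  refine ⟨fun x => χ x • a x, contDiff_smul_of_tsupport_subset hχ fun x hx => hac x (hχN hx).2,
    hχc.smul_right, (tsupport_smul_subset_left χ a).trans (hχN.trans inter_subset_left), ?_, ?_, ?_⟩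
  · intro x
    rw [norm_smul, Real.norm_of_nonneg (hχI x).1]
    calc χ x * ‖a x‖ ≤ 1 * ‖a x‖ := by gcongr; exact (hχI x).2
      _ ≤ C := by rw [one_mul]; exact hC _
  · intro s
    beta_reduce
    rw [(hχ1 (γ s) ⟨s, rfl⟩).self_of_nhds, one_smul, haγ]
  · intro s v
    have hcs : c (γ s) ≠ 0 := (hγU ⟨s, rfl⟩).2
    obtain ⟨σ, hσ, ⟨n, hn⟩, hσe⟩ := hloc _ hcs
    -- Near the curve the extension factors through one real parameter, so its differential takes
    -- values in the line of `deriv e s`.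
    have hev : (fun x => χ x • a x) =ᶠ[𝓝 (γ s)] fun x => e (σ x) := by
      filter_upwards [hσe, hχ1 (γ s) ⟨s, rfl⟩] with x h1 h2
      rw [h1, h2, one_smul]
    obtain ⟨k, hk⟩ := hargs s
    have hσs : σ (γ s) = s + ((k - n : ℤ) : ℝ) := by push_cast; linarith
    have hd : deriv e (σ (γ s)) = deriv e s := by
      rw [hσs]
      have := hp.deriv.int_mul (k - n) s
      rwa [mul_one] at this
    have h3 := ((he.differentiable (by simp) (σ (γ s))).hasDerivAt.hasFDerivAt).comp (γ s)
      (hσ.differentiableAt (by simp)).hasFDerivAt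
    refine ⟨fderiv ℝ σ (γ s) v, ?_⟩
    rw [hev.fderiv_eq]
    have h4 : fderiv ℝ (fun x => e (σ x)) (γ s) = _ := h3.fderiv
    rw [h4]
    simp [hd]

/-- A smooth function vanishing on the curve, with prescribed gradient along it. -/
theorem exists_function_with_gradient (hγ : IsEmbeddedClosedCurve γ) {m : ℝ → Space}
    (hm : ContDiff ℝ ∞ m) (hp : Function.Periodic m 1) (hmT : ∀ s, inner ℝ (deriv γ s) (m s) = 0) :
    ∃ h : Space → ℝ, ContDiff ℝ ∞ h ∧ (∀ s, h (γ s) = 0) ∧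
      ∀ s v, fderiv ℝ h (γ s) v = inner ℝ (m s) v := by
  obtain ⟨C, -, hC⟩ := hp.exists_norm_le hm.continuous
  obtain ⟨C', -, hC'⟩ := hγ.periodic.exists_norm_le hγ.contDiff.continuous
  obtain ⟨M, hM, -, -, -, hMγ, -⟩ := exists_extension hγ hm hp hC isOpen_univ (subset_univ _)
  obtain ⟨P, hP, -, -, -, hPγ, hPd⟩ := exists_extension hγ hγ.contDiff hγ.periodic hC' isOpen_univ
    (subset_univ _)
  -- `P` replaces the nearest point projection: on `γ` it is the identity and its differential takes
  -- values in the tangent line. As `m` is normal to `γ`, this does not affect the gradient.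
  refine ⟨fun x => inner ℝ (M x) (x - P x), hM.inner ℝ (contDiff_id.sub hP), fun s => ?_,
    fun s v => ?_⟩
  · beta_reduce
    rw [hPγ, sub_self, inner_zero_right]
  · have h1 := (hM.differentiable (by simp) (γ s)).hasFDerivAt
    have h2 := (hasFDerivAt_id (𝕜 := ℝ) (γ s)).sub (hP.differentiable (by simp) (γ s)).hasFDerivAt
    have h3 : HasFDerivAt (fun x => inner ℝ (M x) (x - P x)) _ (γ s) := h1.inner ℝ h2
    rw [h3.fderiv]
    obtain ⟨r, hr⟩ := hPd s v
    simp [hPγ, hMγ, hr, inner_sub_right, inner_smul_right, real_inner_comm]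
    right
    rw [real_inner_comm, hmT]

end Extension

/-! ### Ambient isotopies -/

section AmbientIsotopy

variable {γ : ℝ → Space}

theorem isAmbientIsotopyFixing_id (γ : ℝ → Space) :
    IsAmbientIsotopyFixing γ fun _ p => p where
  contDiffOn := contDiff_snd.contDiffOn
  diffeo _ _ := ⟨contDiff_id, id, contDiff_id, fun _ => rfl, fun _ => rfl⟩
  start _ := rfl
  fixes _ _ _ := rfl

theorem IsAmbientIsotopyFixing.comp {Φ Ψ : ℝ → Space → Space} (hΨ : IsAmbientIsotopyFixing γ Ψ)
    (hΦ : IsAmbientIsotopyFixing γ Φ) : IsAmbientIsotopyFixing γ fun t p => Ψ t (Φ t p) where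
  contDiffOn := hΨ.contDiffOn.comp (contDiffOn_fst.prodMk hΦ.contDiffOn)
    fun x hx => ⟨hx.1, mem_univ _⟩
  diffeo t ht := by
    obtain ⟨h1, g1, hg1, hl1, hr1⟩ := hΦ.diffeo t ht
    obtain ⟨h2, g2, hg2, hl2, hr2⟩ := hΨ.diffeo t ht
    exact ⟨h2.comp h1, g1 ∘ g2, hg1.comp hg2, fun p => by simp [hl2 _, hl1 _],
      fun p => by simp [hr2 _, hr1 _]⟩
  start p := by rw [hΦ.start, hΨ.start]
  fixes t ht s := by rw [hΦ.fixes t ht, hΨ.fixes t ht]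

/-- A `C¹`-small perturbation of the identity is a diffeomorphism. -/
theorem exists_smooth_inverse_of_norm_fderiv_le {g : Space → Space} (hg : ContDiff ℝ ∞ g)
    (hg' : ∀ p, ‖fderiv ℝ g p‖ ≤ 1 / 2) :
    ∃ k : Space → Space, ContDiff ℝ ∞ k ∧ Function.LeftInverse k (fun p => p + g p) ∧
      Function.RightInverse k fun p => p + g p := by
  set f : Space → Space := fun p => p + g p with hf
  have hlip : ∀ x y, ‖g x - g y‖ ≤ 1 / 2 * ‖x - y‖ := fun x y =>
    convex_univ.norm_image_sub_le_of_norm_fderiv_le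
      (fun p _ => hg.differentiable (by simp) p) (fun p _ => hg' p) (mem_univ y) (mem_univ x)
  have happ : ApproximatesLinearOn f
      ((ContinuousLinearEquiv.refl ℝ Space : Space ≃L[ℝ] Space) : Space →L[ℝ] Space) univ
      (1 / 2 : NNReal) := by
    intro x _ y _
    have : f x - f y - (x - y) = g x - g y := by simp only [hf]; abel
    simpa [this] using hlip x y
  let H := happ.toHomeomorph f (Or.inr (by
    have h1 : ‖((ContinuousLinearEquiv.refl ℝ Space).symm : Space →L[ℝ] Space)‖₊ = 1 := by
      ext; exact ContinuousLinearMap.norm_id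
    rw [h1, inv_one]
    norm_num))
  have hH : (H : Space → Space) = f := rfl
  have hd : ∀ p, HasFDerivAt f (ContinuousLinearMap.id ℝ Space + fderiv ℝ g p) p := fun p =>
    (hasFDerivAt_id p).add (hg.differentiable (by simp) p).hasFDerivAt
  have hinj : ∀ p, Function.Injective (ContinuousLinearMap.id ℝ Space + fderiv ℝ g p) := by
    intro p
    rw [injective_iff_map_eq_zero]
    intro v hv
    have h1 : v = -fderiv ℝ g p v := by
      rw [eq_neg_iff_add_eq_zero]; simpa using hv
    have h2 : ‖v‖ ≤ 1 / 2 * ‖v‖ := by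
      conv_lhs => rw [h1, norm_neg]
      exact (fderiv ℝ g p).le_of_opNorm_le (hg' p) v
    rw [← norm_eq_zero]
    linarith [norm_nonneg v]
  refine ⟨H.symm, H.contDiff_symm (f₀' := fun p => (LinearEquiv.ofInjectiveEndo
    ((ContinuousLinearMap.id ℝ Space + fderiv ℝ g p : Space →L[ℝ] Space) : Space →ₗ[ℝ] Space)
    (hinj p)).toContinuousLinearEquiv) (fun p => ?_) ?_, fun p => H.symm_apply_apply p,
    fun p => H.apply_symm_apply p⟩
  · exact (hd p).congr_fderiv (by ext v; rfl)
  · rw [hH]; exact contDiff_id.add hg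

/-- The straight-line homotopy works: for t ≤ 1 the bound 1/2 also holds for `t • g`, so every stage
is a diffeomorphism. -/
theorem isAmbientIsotopyFixing_of_norm_fderiv_le {g : Space → Space} (hg : ContDiff ℝ ∞ g)
    (hg' : ∀ p, ‖fderiv ℝ g p‖ ≤ 1 / 2) (hγ : ∀ s, g (γ s) = 0) :
    IsAmbientIsotopyFixing γ fun t p => p + t • g p where
  contDiffOn := by fun_prop
  diffeo t ht := by
    refine ⟨by fun_prop, ?_⟩
    refine exists_smooth_inverse_of_norm_fderiv_le (g := fun p => t • g p) (by fun_prop) fun p => ?_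
    have h1 : fderiv ℝ (fun p => t • g p) p = t • fderiv ℝ g p :=
      ((hg.differentiable (by simp) p).hasFDerivAt.const_smul t).fderiv
    rw [h1, norm_smul, Real.norm_of_nonneg ht.1]
    calc t * ‖fderiv ℝ g p‖ ≤ 1 * (1 / 2) := by
          gcongr
          exacts [ht.2, hg' p]
      _ = 1 / 2 := one_mul _
  start p := by simp
  fixes t _ s := by simp [hγ]

/-! ### Perturbations supported near the curve -/

/-- A bounded modification of a smooth function, with the same derivative at its zeros. -/
theorem hasFDerivAt_mul_sin_div {h : Space → ℝ} (hh : ContDiff ℝ ∞ h) {δ : ℝ} (hδ : 0 < δ)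
    (p : Space) : HasFDerivAt (fun p => δ * Real.sin (h p / δ))
      (Real.cos (h p / δ) • fderiv ℝ h p) p := by
  have h1 := (hh.differentiable (by simp) p).hasFDerivAt
  have h2 := ((h1.mul_const δ⁻¹).sin).const_mul δ
  simp only [← div_eq_mul_inv] at h2
  refine h2.congr_fderiv ?_
  rw [smul_smul, smul_smul]
  congr 1
  field_simp

theorem norm_cos_smul_fderiv_le (h : Space → ℝ) (δ : ℝ) (p : Space) :
    ‖Real.cos (h p / δ) • fderiv ℝ h p‖ ≤ ‖fderiv ℝ h p‖ := by
  rw [norm_smul]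
  exact mul_le_of_le_one_left (norm_nonneg _) (Real.abs_cos_le_one _)

theorem abs_mul_sin_le {δ : ℝ} (hδ : 0 < δ) (x : ℝ) : |δ * Real.sin x| ≤ δ := by
  rw [abs_mul, abs_of_pos hδ]
  exact mul_le_of_le_one_right hδ.le (Real.abs_sin_le_one _)

/-- The data from which perturbations near the curve are built: a function `h` with prescribed
gradient on the curve, and a vector field `E` with prescribed values on the curve, supported where
the gradient of `h` is bounded. -/
theorem exists_perturbation_data (hγ : IsEmbeddedClosedCurve γ) {m e : ℝ → Space}
    (hm : ContDiff ℝ ∞ m) (hmp : Function.Periodic m 1)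
    (hmT : ∀ s, inner ℝ (deriv γ s) (m s) = 0) (hm1 : ∀ s, ‖m s‖ = 1)
    (he : ContDiff ℝ ∞ e) (hep : Function.Periodic e 1) {C : ℝ} (hC : ∀ s, ‖e s‖ ≤ C) :
    ∃ (h : Space → ℝ) (E : Space → Space) (B : ℝ), ContDiff ℝ ∞ h ∧ ContDiff ℝ ∞ E ∧
      (∀ s, h (γ s) = 0) ∧ (∀ s v, fderiv ℝ h (γ s) v = inner ℝ (m s) v) ∧
      (∀ s, E (γ s) = e s) ∧ 0 ≤ B ∧ (∀ p, ‖fderiv ℝ E p‖ ≤ B) ∧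
      ∀ (u : Space →L[ℝ] ℝ) p, ‖u‖ ≤ ‖fderiv ℝ h p‖ → ‖u.smulRight (E p)‖ ≤ 2 * C := by
  obtain ⟨h, hh, hhγ, hhd⟩ := exists_function_with_gradient hγ hm hmp hmT
  -- On the curve the gradient of `h` is the unit vector `m`, so this open set contains the curve,
  -- and `E` can be supported in it.
  have hN : IsOpen {p | ‖fderiv ℝ h p‖ < 2} :=
    isOpen_lt (hh.continuous_fderiv (by simp)).norm continuous_const
  have hγN : range γ ⊆ {p | ‖fderiv ℝ h p‖ < 2} := by
    rintro _ ⟨s, rfl⟩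
    refine lt_of_le_of_lt ((fderiv ℝ h (γ s)).opNorm_le_bound zero_le_one fun v => ?_) one_lt_two
    rw [hhd, ← hm1 s]
    exact norm_inner_le_norm _ _
  obtain ⟨E, hE, hEc, hEN, hEC, hEγ, -⟩ := exists_extension hγ he hep hC hN hγN
  obtain ⟨B, hB⟩ := (hEc.fderiv ℝ).exists_bound_of_continuous (hE.continuous_fderiv (by simp))
  have hC0 : 0 ≤ C := (norm_nonneg _).trans (hC 0)
  refine ⟨h, E, B, hh, hE, hhγ, hhd, hEγ, (norm_nonneg _).trans (hB 0), hB, fun u p hu => ?_⟩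
  rw [ContinuousLinearMap.norm_smulRight_apply]
  by_cases hp : p ∈ tsupport E
  · have h2 : ‖u‖ ≤ 2 := hu.trans (le_of_lt (hEN hp))
    exact mul_le_mul h2 (hEC p) (norm_nonneg _) (by norm_num)
  · rw [image_eq_zero_of_notMem_tsupport hp, norm_zero, mul_zero]; positivity

/-- A small perturbation vanishing on the curve with prescribed rank one derivative. -/
theorem exists_perturbation (hγ : IsEmbeddedClosedCurve γ) {m e : ℝ → Space}
    (hm : ContDiff ℝ ∞ m) (hmp : Function.Periodic m 1)
    (hmT : ∀ s, inner ℝ (deriv γ s) (m s) = 0) (hm1 : ∀ s, ‖m s‖ = 1)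
    (he : ContDiff ℝ ∞ e) (hep : Function.Periodic e 1) (he8 : ∀ s, ‖e s‖ ≤ 1 / 8) :
    ∃ g : Space → Space, ContDiff ℝ ∞ g ∧ (∀ p, ‖fderiv ℝ g p‖ ≤ 1 / 2) ∧ (∀ s, g (γ s) = 0) ∧
      ∀ s v, fderiv ℝ g (γ s) v = inner ℝ (m s) v • e s := by
  obtain ⟨h, E, B, hh, hE, hhγ, hhd, hEγ, hB0, hB, hsm⟩ :=
    exists_perturbation_data hγ hm hmp hmT hm1 he hep he8
  -- Replacing `h` by δ sin(h/δ) bounds its values by δ without changing its gradient on `γ`. The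
  -- term with the derivative of `E` is then at most δB ≤ 1/4, and the rank one term at most 2 · 1/8
  -- = 1/4.
  set δ : ℝ := 1 / (4 * (B + 1)) with hδ
  have hδ0 : 0 < δ := by positivity
  have hd : ∀ p, HasFDerivAt (fun p => (δ * Real.sin (h p / δ)) • E p)
      ((δ * Real.sin (h p / δ)) • fderiv ℝ E p +
        (Real.cos (h p / δ) • fderiv ℝ h p).smulRight (E p)) p := fun p =>
    (hasFDerivAt_mul_sin_div hh hδ0 p).smul (hE.differentiable (by simp) p).hasFDerivAt
  refine ⟨fun p => (δ * Real.sin (h p / δ)) • E p, by fun_prop, fun p => ?_, fun s => by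
    simp [hhγ], fun s v => ?_⟩
  · rw [(hd p).fderiv]
    have h1 := hsm _ p (norm_cos_smul_fderiv_le h δ p)
    have h2 : ‖(δ * Real.sin (h p / δ)) • fderiv ℝ E p‖ ≤ δ * B := by
      rw [norm_smul]
      exact mul_le_mul (abs_mul_sin_le hδ0 _) (hB p) (norm_nonneg _) hδ0.le
    have h3 : δ * B ≤ 1 / 4 := by
      rw [hδ, div_mul_eq_mul_div, div_le_div_iff₀ (by positivity) (by norm_num)]
      linarith
    refine (norm_add_le _ _).trans ?_
    linarith
  · rw [(hd (γ s)).fderiv]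
    simp [hhγ, hhd, hEγ]

/-- Since `y` vanishes at 0, only the term in which both factors of the square are differentiated
survives. -/
theorem deriv_deriv_sq_smul {y : ℝ → ℝ} {w : ℝ → Space} (hy : ContDiff ℝ ∞ y)
    (hw : ContDiff ℝ ∞ w) (hy0 : y 0 = 0) :
    deriv (deriv fun t => y t ^ 2 • w t) 0 = (2 * deriv y 0 ^ 2) • w 0 := by
  have hyd : ∀ t, HasDerivAt y (deriv y t) t := fun t => (hy.differentiable (by simp) t).hasDerivAt
  have hwd : ∀ t, HasDerivAt w (deriv w t) t := fun t => (hw.differentiable (by simp) t).hasDerivAt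
  have hy2 : HasDerivAt (deriv y) (deriv (deriv y) 0) 0 :=
    ((contDiff_infty_iff_deriv.1 hy).2.differentiable (by simp) 0).hasDerivAt
  have hw2 : HasDerivAt (deriv w) (deriv (deriv w) 0) 0 :=
    ((contDiff_infty_iff_deriv.1 hw).2.differentiable (by simp) 0).hasDerivAt
  have h1 : (deriv fun t => y t ^ 2 • w t) =
      fun t => y t • (y t • deriv w t + (2 * deriv y t) • w t) := by
    ext1 t
    have := (((hyd t).pow 2).smul (hwd t)).deriv
    refine Eq.trans this ?_
    simp only [Pi.pow_apply]
    norm_num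
    module
  have h2 := (hyd 0).smul (((hyd 0).smul hw2).add (((hy2.const_mul 2)).smul (hwd 0)))
  rw [h1]
  refine Eq.trans h2.deriv ?_
  simp [hy0]
  module

/-- A small perturbation vanishing to first order on the curve, with prescribed second order part. -/
theorem exists_second_order_perturbation (hγ : IsEmbeddedClosedCurve γ) {m e : ℝ → Space}
    (hm : ContDiff ℝ ∞ m) (hmp : Function.Periodic m 1)
    (hmT : ∀ s, inner ℝ (deriv γ s) (m s) = 0) (hm1 : ∀ s, ‖m s‖ = 1)
    (he : ContDiff ℝ ∞ e) (hep : Function.Periodic e 1) :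
    ∃ g : Space → Space, ContDiff ℝ ∞ g ∧ (∀ p, ‖fderiv ℝ g p‖ ≤ 1 / 2) ∧ (∀ s, g (γ s) = 0) ∧
      (∀ s, fderiv ℝ g (γ s) = 0) ∧ ∀ s (c : ℝ → Space), ContDiff ℝ ∞ c → c 0 = γ s →
        deriv (deriv fun t => g (c t)) 0 = (2 * inner ℝ (m s) (deriv c 0) ^ 2) • e s := by
  obtain ⟨C, hC0, hC⟩ := hep.exists_norm_le he.continuous
  obtain ⟨h, E, B, hh, hE, hhγ, hhd, hEγ, hB0, hB, hsm⟩ :=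
    exists_perturbation_data hγ hm hmp hmT hm1 he hep hC
  -- With |u| ≤ δ ≤ 1 the derivative u² DE + 2u (Du ⊗ E) has norm at most δB + 4δC ≤ 1/2. The extra
  -- factor u makes smallness of `e` unnecessary.
  set δ : ℝ := 1 / (2 * (B + 4 * C + 1)) with hδ
  have hδ0 : 0 < δ := by positivity
  have hδ1 : δ ≤ 1 := by
    rw [hδ, div_le_one (by positivity)]; linarith
  set u : Space → ℝ := fun p => δ * Real.sin (h p / δ) with hu
  have huc : ContDiff ℝ ∞ u := by fun_prop
  have hud := hasFDerivAt_mul_sin_div hh hδ0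
  have hd : ∀ p, HasFDerivAt (fun p => u p ^ 2 • E p)
      (u p ^ 2 • fderiv ℝ E p +
        (2 * u p) • (Real.cos (h p / δ) • fderiv ℝ h p).smulRight (E p)) p := fun p => by
    have := ((hud p).pow 2).smul (hE.differentiable (by simp) p).hasFDerivAt
    refine this.congr_fderiv ?_
    ext1 v
    simp [hu, smul_smul, mul_assoc]
  refine ⟨fun p => u p ^ 2 • E p, by fun_prop, fun p => ?_, fun s => by
    simp [hu, hhγ], fun s => ?_, fun s c hc hcs => ?_⟩
  · rw [(hd p).fderiv]
    have h1 := hsm _ p (norm_cos_smul_fderiv_le h δ p)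
    have hup : |u p| ≤ δ := abs_mul_sin_le hδ0 _
    have h2 : ‖u p ^ 2 • fderiv ℝ E p‖ ≤ δ * B := by
      rw [norm_smul]
      refine mul_le_mul ?_ (hB p) (norm_nonneg _) hδ0.le
      rw [Real.norm_eq_abs, abs_pow, sq]
      calc |u p| * |u p| ≤ δ * 1 := mul_le_mul hup (hup.trans hδ1) (abs_nonneg _) hδ0.le
        _ = δ := mul_one δ
    have h4 : ‖(2 * u p) • (Real.cos (h p / δ) • fderiv ℝ h p).smulRight (E p)‖ ≤
        2 * δ * (2 * C) := by
      rw [norm_smul]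
      refine mul_le_mul ?_ h1 (norm_nonneg _) (by positivity)
      rw [Real.norm_eq_abs, abs_mul, abs_two]
      linarith
    have h3 : δ * (B + 4 * C) ≤ 1 / 2 := by
      rw [hδ, div_mul_eq_mul_div, div_le_div_iff₀ (by positivity) (by norm_num)]
      linarith
    refine (norm_add_le _ _).trans ?_
    linarith
  · rw [(hd (γ s)).fderiv]
    ext1 v
    simp [hu, hhγ]
  · have h1 := deriv_deriv_sq_smul (y := fun t => u (c t)) (w := fun t => E (c t)) (huc.comp hc)
      (hE.comp hc) (by simp [hu, hcs, hhγ])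
    have h2 : deriv (fun t => u (c t)) 0 = inner ℝ (m s) (deriv c 0) := by
      have h3 : HasFDerivAt u (Real.cos (h (c 0) / δ) • fderiv ℝ h (c 0)) (c 0) := hud (c 0)
      have := (h3.comp_hasDerivAt 0 (hc.differentiable (by simp) 0).hasDerivAt).deriv
      refine Eq.trans this ?_
      simp [hcs, hhγ, hhd]
    rw [h1, h2, hcs, hEγ]

end AmbientIsotopy

/-! ### Rotating a surface around the curve -/

section Rotation

variable {γ : ℝ → Space}

theorem norm_frameVec_sub_le (hγ : IsEmbeddedClosedCurve γ) (h : NowhereVertical γ) (t φ ψ : ℝ) :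
    ‖frameVec γ t φ - frameVec γ t ψ‖ ≤ |φ - ψ| := by
  have := convex_univ.norm_image_sub_le_of_norm_hasDerivWithin_le (C := 1)
    (fun x _ => (hasDerivAt_frameVec γ t x).hasDerivWithinAt)
    (fun x _ => (norm_frameVec hγ h t _).le) (mem_univ ψ) (mem_univ φ)
  rwa [one_mul] at this

theorem fderiv_add_one_smul {g : Space → Space} (hg : ContDiff ℝ ∞ g) (p v : Space) :
    fderiv ℝ (fun p => p + (1 : ℝ) • g p) p v = v + fderiv ℝ g p v := by
  have h1 : HasFDerivAt (fun p => p + (1 : ℝ) • g p) _ p :=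
    (hasFDerivAt_id p).add ((hg.differentiable (by simp) p).hasFDerivAt.const_smul (1 : ℝ))
  rw [h1.fderiv]; simp

/-- A normal field that does not wind around the blackboard framing is rotated to the binormal by
an ambient isotopy fixing the curve. -/
theorem exists_rotation (hγ : IsEmbeddedClosedCurve γ) (h : NowhereVertical γ) {θ : ℝ → ℝ}
    (hθ : ContDiff ℝ ∞ θ) (hp : Function.Periodic θ 1) :
    ∃ Φ : ℝ → Space → Space, IsAmbientIsotopyFixing γ Φ ∧
      ∀ s, fderiv ℝ (Φ 1) (γ s) (frameVec γ s (θ s + Real.pi / 2)) = binormal γ s := by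
  obtain ⟨C, hC0, hC⟩ := hp.exists_norm_le hθ.continuous
  -- Each of the `N` steps turns the field by at most C/N < 1/8, the size allowed by
  -- `exists_perturbation`.
  obtain ⟨N, hN⟩ := exists_nat_gt (8 * C)
  have hNpos : (0:ℝ) < N := by linarith
  have key : ∀ j : ℕ, ∃ Φ : ℝ → Space → Space, IsAmbientIsotopyFixing γ Φ ∧
      ∀ s, fderiv ℝ (Φ 1) (γ s) (frameVec γ s (θ s + Real.pi / 2)) =
        frameVec γ s (θ s * (1 - j / N) + Real.pi / 2) := by
    intro j
    induction j with
    | zero => exact ⟨fun _ p => p, isAmbientIsotopyFixing_id γ, fun s => by simp⟩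
    | succ j ih =>
      obtain ⟨Φ, hΦ, hΦd⟩ := ih
      set φ : ℕ → ℝ → ℝ := fun j s => θ s * (1 - j / N) + Real.pi / 2 with hφ
      have hφc : ∀ j, ContDiff ℝ ∞ (φ j) := fun j => by fun_prop
      have hmc : ∀ j, ContDiff ℝ ∞ fun s => frameVec γ s (φ j s) := fun j =>
        contDiff_frameVec hγ h contDiff_id (hφc j)
      have hmp : ∀ j, Function.Periodic (fun s => frameVec γ s (φ j s)) 1 := fun j s => by
        simp only [hφ, hp s, frameVec_add_one hγ]
      -- The differential of the step is v ↦ v + ⟨m, v⟩(m' - m), where m and m' are the present and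
      -- the next field; it takes the unit vector m to m'. These fields close up because θ is
      -- periodic.
      obtain ⟨g, hg, hg2, hg0, hgd⟩ := exists_perturbation hγ (hmc j) (hmp j)
        (fun s => inner_deriv_frameVec γ s _) (fun s => norm_frameVec hγ h s _)
        ((hmc (j + 1)).sub (hmc j)) ((hmp (j + 1)).sub (hmp j)) (fun s => by
          refine (norm_frameVec_sub_le hγ h s _ _).trans ?_
          have : φ (j + 1) s - φ j s = -(θ s / N) := by simp only [hφ]; push_cast; ring
          rw [this, abs_neg, abs_div, abs_of_pos hNpos, div_le_div_iff₀ hNpos (by norm_num)]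
          have := hC s
          rw [Real.norm_eq_abs] at this
          linarith)
      have hΨ := isAmbientIsotopyFixing_of_norm_fderiv_le hg hg2 hg0
      refine ⟨_, hΨ.comp hΦ, fun s => ?_⟩
      have h1 : HasFDerivAt (Φ 1) (fderiv ℝ (Φ 1) (γ s)) (γ s) :=
        ((hΦ.diffeo 1 (by simp)).1.differentiable (by simp) (γ s)).hasFDerivAt
      have h2 : HasFDerivAt (fun p => p + (1 : ℝ) • g p)
          (fderiv ℝ (fun p => p + (1 : ℝ) • g p) (γ s)) (Φ 1 (γ s)) := by
        rw [hΦ.fixes 1 (by simp)]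
        exact ((hΨ.diffeo 1 (by simp)).1.differentiable (by simp) (γ s)).hasFDerivAt
      have h3 := (h2.comp (γ s) h1).fderiv
      have h4 : fderiv ℝ (fun p => Φ 1 p + (1 : ℝ) • g (Φ 1 p)) (γ s) = _ := h3
      rw [h4, ContinuousLinearMap.comp_apply, hΦd, fderiv_add_one_smul hg, hgd,
        real_inner_self_eq_norm_sq, norm_frameVec hγ h]
      simp [hφ]
  obtain ⟨Φ, hΦ, hΦd⟩ := key N
  refine ⟨Φ, hΦ, fun s => ?_⟩
  rw [hΦd, div_self hNpos.ne', sub_self, mul_zero, zero_add, binormal_eq_frameVec]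

end Rotation

/-! ### Images of surfaces under diffeomorphisms -/

theorem fderiv_leftInverse_apply {f g : Space → Space} (hf : ContDiff ℝ ∞ f)
    (hg : ContDiff ℝ ∞ g) (h : Function.LeftInverse g f) (p v : Space) :
    fderiv ℝ g (f p) (fderiv ℝ f p v) = v := by
  have h1 := ((hg.differentiable (by simp) (f p)).hasFDerivAt.comp p
    (hf.differentiable (by simp) p).hasFDerivAt)
  have h2 : g ∘ f = id := funext h
  rw [h2] at h1
  exact (DFunLike.congr_fun (h1.unique (hasFDerivAt_id p)) v)

theorem fderiv_mem_tangentPlane_image {f : Space → Space} (hf : ContDiff ℝ ∞ f) {F : Set Space}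
    {p v : Space} (hv : v ∈ tangentPlane F p) : fderiv ℝ f p v ∈ tangentPlane (f '' F) (f p) :=
  (hf.differentiable (by simp) p).hasFDerivAt.hasFDerivWithinAt.mapsTo_tangent_cone hv

theorem IsSmoothSurface.image {F : Set Space} (hF : IsSmoothSurface F) {f g : Space → Space}
    (hf : ContDiff ℝ ∞ f) (hg : ContDiff ℝ ∞ g) (hl : Function.LeftInverse g f)
    (hr : Function.RightInverse g f) : IsSmoothSurface (f '' F) := by
  rintro _ ⟨p, hp, rfl⟩
  obtain ⟨U, u, hU, hpU, hu, hu', hFU⟩ := hF p hp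
  refine ⟨g ⁻¹' U, u ∘ g, hU.preimage hg.continuous, by rwa [mem_preimage, hl p],
    hu.comp hg.contDiffOn fun q hq => hq, fun q hq h0 => ?_, ?_⟩
  · refine hu' (g q) hq ?_
    have h1 : HasFDerivAt u (fderiv ℝ u (g q)) (g q) :=
      ((hu.contDiffAt (hU.mem_nhds hq)).differentiableAt (by simp)).hasFDerivAt
    rw [(h1.comp q (hg.differentiable (by simp) q).hasFDerivAt).fderiv] at h0
    ext v
    have h2 := fderiv_leftInverse_apply hf hg hl (g q) v
    rw [hr q] at h2
    have h3 := DFunLike.congr_fun h0 (fderiv ℝ f (g q) v)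
    rwa [ContinuousLinearMap.comp_apply, h2] at h3
  · ext q
    constructor
    · rintro ⟨⟨x, hx, rfl⟩, hq⟩
      rw [mem_preimage, hl x] at hq
      refine ⟨by rwa [mem_preimage, hl x], ?_⟩
      rw [Function.comp_apply, hl x]
      exact (hFU.subset ⟨hx, hq⟩).2
    · rintro ⟨hq, hq0⟩
      exact ⟨⟨g q, (hFU.symm.subset ⟨hq, hq0⟩).1, hr q⟩, hq⟩

theorem IsAmbientIsotopyFixing.isSmoothSurface_image {γ : ℝ → Space} {Φ : ℝ → Space → Space}
    (hΦ : IsAmbientIsotopyFixing γ Φ) {F : Set Space} (hF : IsSmoothSurface F) :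
    IsSmoothSurface (Φ 1 '' F) := by
  obtain ⟨h, g, hg, hl, hr⟩ := hΦ.diffeo 1 (by simp)
  exact hF.image h hg hl hr

theorem IsAmbientIsotopyFixing.isIsotopyFixing {γ : ℝ → Space} {Φ : ℝ → Space → Space}
    (hΦ : IsAmbientIsotopyFixing γ Φ) (F : Set Space) : IsIsotopyFixing F γ Φ where
  contDiffOn := hΦ.contDiffOn.mono (prod_mono le_rfl (subset_univ F))
  embedding t ht := by
    obtain ⟨h, g, hg, hl, hr⟩ := hΦ.diffeo t ht
    refine ⟨h.contDiffOn, ?_, fun p hp v hv hv0 => ?_⟩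
    · let H : Space ≃ₜ Space := ⟨⟨Φ t, g, hl, hr⟩, h.continuous, hg.continuous⟩
      exact H.isEmbedding.comp IsEmbedding.subtypeVal
    · have h1 := (h.differentiable (by simp) p).hasFDerivAt
      -- Derivatives within `F` are not unique, but any two agree on tangent vectors.
      have h2 : fderiv ℝ (Φ t) p v = fderivWithin ℝ (Φ t) F p v :=
        h1.hasFDerivWithinAt.unique_on
          (h1.hasFDerivWithinAt (s := F)).differentiableWithinAt.hasFDerivWithinAt hv
      rw [← fderiv_leftInverse_apply h hg hl p v, h2, hv0, map_zero]
  start p _ := hΦ.start p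
  fixes := hΦ.fixes

/-! ### Vertical tangent planes along the curve -/

section Vertical

variable {γ : ℝ → Space} {F : Set Space}

theorem apply_eq_inner_blackboardFraming_mul (hγ : IsEmbeddedClosedCurve γ)
    (h : NowhereVertical γ) {s : ℝ} {L : Space →L[ℝ] ℝ} (hT : L (deriv γ s) = 0)
    (hb : L (binormal γ s) = 0) (w : Space) :
    L w = inner ℝ (blackboardFraming γ s) w * L (blackboardFraming γ s) := by
  conv_lhs => rw [frame_expansion hγ h s w]
  simp [hT, hb]

theorem deriv_mem_tangentPlane (hγ : IsEmbeddedClosedCurve γ) (hγF : ∀ s, γ s ∈ F) (s : ℝ) :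
    deriv γ s ∈ tangentPlane F (γ s) :=
  mem_tangentPlane_of_hasDerivAt (Eventually.of_forall hγF) (hγ.hasDerivAt s)

/-- The velocity and the binormal span the orthogonal complement of β, a plane that contains the
vertical direction. Tangency of the binormal is thus enough for a vertical tangent plane. -/
theorem tangentPlane_eq_of_binormal_mem (hF : IsSmoothSurface F) (hγ : IsEmbeddedClosedCurve γ)
    (h : NowhereVertical γ) (hγF : ∀ s, γ s ∈ F) {s : ℝ}
    (hb : binormal γ s ∈ tangentPlane F (γ s)) :
    tangentPlane F (γ s) = {w | inner ℝ (blackboardFraming γ s) w = 0} := by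
  obtain ⟨L, hL, hLF⟩ := hF.exists_functional (hγF s)
  have hT := deriv_mem_tangentPlane hγ hγF s
  rw [hLF] at hb hT ⊢
  have key := apply_eq_inner_blackboardFraming_mul hγ h (s := s) (L := L) hT hb
  have hβ : L (blackboardFraming γ s) ≠ 0 := fun h0 => hL (by ext w; simp [key w, h0])
  ext w
  rw [mem_ofPred_eq, mem_ofPred_eq, key w, mul_eq_zero, or_iff_left hβ]

/-- Along a compact part of a surface the normal curvature in the vertical direction is bounded. -/
theorem IsSmoothSurface.exists_normal_acceleration_le (hF : IsSmoothSurface F) {K : Set Space}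
    (hK : IsCompact K) (hKF : K ⊆ F) :
    ∃ M : ℝ, ∀ p ∈ K, ∀ n : Space, tangentPlane F p = {w | inner ℝ n w = 0} → ‖n‖ = 1 →
      ∀ c : ℝ → Space, ContDiff ℝ ∞ c → (∀ᶠ t in 𝓝 0, c t ∈ F) → c 0 = p → deriv c 0 = vert →
        |inner ℝ n (deriv (deriv c) 0)| ≤ M := by
  refine hK.induction_on (p := fun S => ∃ M : ℝ, ∀ p ∈ S, ∀ n : Space,
    tangentPlane F p = {w | inner ℝ n w = 0} → ‖n‖ = 1 →
      ∀ c : ℝ → Space, ContDiff ℝ ∞ c → (∀ᶠ t in 𝓝 0, c t ∈ F) → c 0 = p → deriv c 0 = vert →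
        |inner ℝ n (deriv (deriv c) 0)| ≤ M) ⟨0, by simp⟩
    (fun S T hST ⟨M, hM⟩ => ⟨M, fun p hp => hM p (hST hp)⟩)
    (fun S T ⟨M, hM⟩ ⟨M', hM'⟩ => ⟨max M M', ?_⟩) fun p hp => ?_
  · rintro p (hp | hp) n hn hn1 c hc hcF hc0 hcd
    exacts [(hM p hp n hn hn1 c hc hcF hc0 hcd).trans (le_max_left _ _),
      (hM' p hp n hn hn1 c hc hcF hc0 hcd).trans (le_max_right _ _)]
  · obtain ⟨U, f, hU, hpU, hf, hf', hFU, hfT⟩ := hF.exists_equation (hKF hp)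
    have h1 : ContDiffOn ℝ ∞ (fderiv ℝ f) U := hf.fderiv_of_isOpen hU (by simp)
    have h2 : ContinuousOn (fderiv ℝ (fderiv ℝ f)) U := h1.continuousOn_fderiv_of_isOpen hU (by simp)
    have hn1 : ∀ q ∈ U, ContinuousAt (fun q => ‖fderiv ℝ f q‖) q := fun q hq =>
      (h1.continuousOn.continuousAt (hU.mem_nhds hq)).norm
    have hn2 : ∀ q ∈ U, ContinuousAt (fun q => ‖fderiv ℝ (fderiv ℝ f) q‖) q := fun q hq =>
      (continuous_norm (E := Space →L[ℝ] Space →L[ℝ] ℝ)).continuousAt.comp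
        (h2.continuousAt (hU.mem_nhds hq))
    -- Differentiating f(c) = 0 twice bounds the normal acceleration by ‖D²f‖ ‖vert‖² / ‖Df‖,
    -- whatever the curve `c`. This quotient is continuous, hence locally bounded, and compactness
    -- gives a uniform bound.
    have h3 : ContinuousAt
        (fun q => ‖fderiv ℝ (fderiv ℝ f) q‖ * ‖vert‖ * ‖vert‖ / ‖fderiv ℝ f q‖) p :=
      ContinuousAt.div₀ (((hn2 p hpU).mul continuousAt_const).mul continuousAt_const) (hn1 p hpU)
        (norm_ne_zero_iff.2 (hf' p hpU))
    obtain ⟨B, hB⟩ : ∃ B, ‖fderiv ℝ (fderiv ℝ f) p‖ * ‖vert‖ * ‖vert‖ / ‖fderiv ℝ f p‖ < B :=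
      exists_gt _
    refine ⟨_, mem_nhdsWithin_of_mem_nhds
      ((h3.eventually_lt continuousAt_const hB).and (hU.mem_nhds hpU)), B, ?_⟩
    rintro q ⟨hqB, hqU⟩ n hn hn1 c hc hcF hc0 hcd
    refine le_trans ?_ hqB.le
    have hcU : ∀ᶠ t in 𝓝 0, c t ∈ U :=
      hc.continuous.continuousAt.eventually_mem (by rw [hc0]; exact hU.mem_nhds hqU)
    have h4 := fderiv_fderiv_add_eq_zero hU hqU hf hc hc0
      ((hcF.and hcU).mono fun t ht => (hFU.subset ht).2)
    rw [hcd] at h4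
    have hfq : f q = 0 := by
      rw [← hc0]; exact (hFU.subset ⟨hcF.self_of_nhds, hcU.self_of_nhds⟩).2
    have hT := (hfT q hqU hfq).2.symm.trans hn
    have key : ∀ w, fderiv ℝ f q w = inner ℝ n w * fderiv ℝ f q n := fun w => by
      have h5 : w - inner ℝ n w • n ∈ {w | inner ℝ n w = (0:ℝ)} := by
        rw [mem_ofPred_eq, inner_sub_right, real_inner_smul_right, real_inner_self_eq_norm_sq, hn1]
        ring
      rw [← hT, mem_ofPred_eq, map_sub, map_smul, smul_eq_mul] at h5
      linarith
    have h6 : ‖fderiv ℝ f q‖ ≤ |fderiv ℝ f q n| :=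
      (fderiv ℝ f q).opNorm_le_bound (abs_nonneg _) fun w => by
        rw [key w, Real.norm_eq_abs, abs_mul, mul_comm]
        gcongr
        have := abs_real_inner_le_norm n w
        rwa [hn1, one_mul] at this
    have hpos : 0 < ‖fderiv ℝ f q‖ := norm_pos_iff.2 (hf' q hqU)
    rw [le_div_iff₀ hpos]
    calc |inner ℝ n (deriv (deriv c) 0)| * ‖fderiv ℝ f q‖
        ≤ |inner ℝ n (deriv (deriv c) 0)| * |fderiv ℝ f q n| := by gcongr
      _ = ‖fderiv ℝ (fderiv ℝ f) q vert vert‖ := by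
        rw [← abs_mul, ← key, eq_neg_of_add_eq_zero_right h4, abs_neg, Real.norm_eq_abs]
      _ ≤ _ := (fderiv ℝ (fderiv ℝ f) q).le_opNorm₂ vert vert

/-- A surface with vertical tangent planes along the curve is bent by an ambient isotopy so that
its projection folds along the curve. -/
theorem exists_fold (hF : IsSmoothSurface F) (hγ : IsEmbeddedClosedCurve γ)
    (h : NowhereVertical γ) (hγF : ∀ s, γ s ∈ F)
    (hb : ∀ s, binormal γ s ∈ tangentPlane F (γ s)) :
    ∃ Ψ : ℝ → Space → Space, IsAmbientIsotopyFixing γ Ψ ∧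
      ∀ s, IsFoldPoint (Ψ 1 '' F) (γ s) := by
  obtain ⟨M, hM⟩ := hF.exists_normal_acceleration_le hγ.isCompact_range (range_subset_iff.2 hγF)
  have hbv : ∀ s, 0 < inner ℝ (binormal γ s) vert := inner_binormal_vert_pos hγ h
  have hbc := contDiff_binormal hγ h
  have hβc := contDiff_blackboardFraming hγ h
  -- With this factor the perturbation adds exactly 2(M + 1) to the normal acceleration of a curve
  -- with vertical velocity. It was at least -M before, so it becomes positive.
  set e : ℝ → Space := fun s =>
    ((M + 1) / inner ℝ (binormal γ s) vert ^ 2) • blackboardFraming γ s with he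
  have hec : ContDiff ℝ ∞ e :=
    (contDiff_const.div ((hbc.inner ℝ contDiff_const).pow 2) fun s => (pow_pos (hbv s) 2).ne').smul
      hβc
  have hep : Function.Periodic e 1 := fun s => by
    simp only [he, periodic_binormal hγ s, periodic_blackboardFraming hγ s]
  obtain ⟨g, hg, hg2, hg0, hgd, hgdd⟩ := exists_second_order_perturbation hγ hbc
    (periodic_binormal hγ) (fun s => inner_deriv_binormal γ s) (fun s => norm_binormal hγ h s)
    hec hep
  have hΨ := isAmbientIsotopyFixing_of_norm_fderiv_le hg hg2 hg0
  refine ⟨_, hΨ, fun s => ?_⟩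
  have hfix := hΨ.fixes 1 (by simp) s
  have hΨc := (hΨ.diffeo 1 (by simp)).1
  beta_reduce at hfix hΨc ⊢
  set F₁ := (fun p => p + (1 : ℝ) • g p) '' F with hF₁
  have hF₁s : IsSmoothSurface F₁ := hΨ.isSmoothSurface_image hF
  have hγF₁ : ∀ s, γ s ∈ F₁ := fun s => ⟨γ s, hγF s, hΨ.fixes 1 (by simp) s⟩
  have hT : tangentPlane F₁ (γ s) = {w | inner ℝ (blackboardFraming γ s) w = 0} := by
    refine tangentPlane_eq_of_binormal_mem hF₁s hγ h hγF₁ ?_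
    have := fderiv_mem_tangentPlane_image hΨc (hb s)
    rwa [hfix, fderiv_add_one_smul hg, hgd, _root_.zero_apply, add_zero] at this
  have hT₀ := tangentPlane_eq_of_binormal_mem hF hγ h hγF (hb s)
  have hβv : inner ℝ (blackboardFraming γ s) vert = (0:ℝ) := inner_blackboardFraming_vert γ s
  obtain ⟨c, hc, hcF, hc0, hcd⟩ := hF.exists_curve (hγF s) (v := vert) (by rw [hT₀]; exact hβv)
  refine ⟨⟨hγF₁ s, by rw [hT]; exact hβv⟩, fun t => c t + (1 : ℝ) • g (c t), by fun_prop,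
    Eventually.of_forall fun t => ⟨c t, hcF t, rfl⟩, ?_, ?_, ?_⟩
  · beta_reduce
    rw [hc0, hfix]
  · have h1 : HasFDerivAt (fun p => p + (1 : ℝ) • g p)
        (fderiv ℝ (fun p => p + (1 : ℝ) • g p) (γ s)) (c 0) := by
      rw [hc0]; exact (hΨc.differentiable (by simp) _).hasFDerivAt
    refine Eq.trans (h1.comp_hasDerivAt 0 hcd).deriv ?_
    rw [fderiv_add_one_smul hg, hgd, _root_.zero_apply, add_zero]
  · have hgc : ContDiff ℝ ∞ fun t => g (c t) := hg.comp hc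
    have hd1 : deriv (fun t => c t + (1 : ℝ) • g (c t)) =
        fun t => deriv c t + deriv (fun t => g (c t)) t := by
      ext1 t
      have := ((hc.differentiable (by simp) t).hasDerivAt.add
        ((hgc.differentiable (by simp) t).hasDerivAt.const_smul (1:ℝ))).deriv
      refine Eq.trans this ?_
      rw [one_smul]
    have hd2 : deriv (deriv fun t => c t + (1 : ℝ) • g (c t)) 0 =
        deriv (deriv c) 0 + deriv (deriv fun t => g (c t)) 0 := by
      rw [hd1]
      exact (((contDiff_infty_iff_deriv.1 hc).2.differentiable (by simp) 0).hasDerivAt.add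
        ((contDiff_infty_iff_deriv.1 hgc).2.differentiable (by simp) 0).hasDerivAt).deriv
    have hMs := abs_le.1 (hM (γ s) ⟨s, rfl⟩ _ hT₀ (norm_blackboardFraming h s) c hc
      (Eventually.of_forall hcF) hc0 hcd.deriv)
    rw [hT, hd2, hgdd s c hc hc0, hcd.deriv, mem_ofPred_eq, inner_add_right,
      real_inner_smul_right, he]
    beta_reduce
    rw [real_inner_smul_right, real_inner_self_eq_norm_sq, norm_blackboardFraming h s]
    have h2 : 2 * inner ℝ (binormal γ s) vert ^ 2 *
        ((M + 1) / inner ℝ (binormal γ s) vert ^ 2 * 1 ^ 2) = 2 * (M + 1) := by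
      have := (hbv s).ne'
      field_simp
    rw [h2]
    have h3 := hMs.1
    have h4 := hMs.2
    linarith

/-! ### Folds and profile curves -/

/-- Near a curve of fold points there are no other points with vertical tangent plane. -/
theorem eventually_mem_range_of_isFoldPoint (hF : IsSmoothSurface F)
    (hγ : IsEmbeddedClosedCurve γ) (h : NowhereVertical γ)
    (hfold : ∀ s, IsFoldPoint F (γ s)) (s₀ : ℝ) :
    ∀ᶠ q in 𝓝 (γ s₀), q ∈ verticalLocus F → q ∈ range γ := by
  have hγF : ∀ s, γ s ∈ F := fun s => (hfold s).1.1
  obtain ⟨U, f, hU, hpU, hf, hf', hFU, hfT⟩ := hF.exists_equation (hγF s₀)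
  have hfd : ContDiffOn ℝ ∞ (fderiv ℝ f) U := hf.fderiv_of_isOpen hU (by simp)
  have hzero : ∀ q ∈ U, q ∈ verticalLocus F → f q = 0 ∧ fderiv ℝ f q vert = 0 := by
    intro q hqU hq
    have hfq : f q = 0 := (hFU.subset ⟨hq.1, hqU⟩).2
    have h1 := hq.2
    rw [(hfT q hqU hfq).2] at h1
    exact ⟨hfq, h1⟩
  have hf0 : HasFDerivAt f (fderiv ℝ f (γ s₀)) (γ s₀) :=
    ((hf.contDiffAt (hU.mem_nhds hpU)).differentiableAt (by simp)).hasFDerivAt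
  have hfd0 : HasFDerivAt (fderiv ℝ f) (fderiv ℝ (fderiv ℝ f) (γ s₀)) (γ s₀) :=
    ((hfd.contDiffAt (hU.mem_nhds hpU)).differentiableAt (by simp)).hasFDerivAt
  have hfT₀ := (hfT _ hpU (hzero _ hpU (hfold s₀).1).1).2
  have hDT : fderiv ℝ f (γ s₀) (deriv γ s₀) = 0 := by
    have := deriv_mem_tangentPlane hγ hγF s₀
    rwa [hfT₀] at this
  have hDv : fderiv ℝ f (γ s₀) vert = 0 := (hzero _ hpU (hfold s₀).1).2
  -- The vertical derivative of `f` vanishes all along `γ`.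
  have hDDT : fderiv ℝ (fderiv ℝ f) (γ s₀) (deriv γ s₀) vert = 0 := by
    have h1 := (hfd0.comp_hasDerivAt s₀ (hγ.hasDerivAt s₀)).clm_apply
      (hasDerivAt_const s₀ vert)
    have h2 : HasDerivAt (fun s => fderiv ℝ f (γ s) vert) 0 s₀ :=
      (hasDerivAt_const s₀ (0:ℝ)).congr_of_eventuallyEq <|
        (hγ.contDiff.continuous.continuousAt.eventually_mem (hU.mem_nhds hpU)).mono
          fun s hs => (hzero _ hs (hfold s).1).2
    have := h1.unique h2
    rwa [map_zero, add_zero] at this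
  have hDDv : fderiv ℝ (fderiv ℝ f) (γ s₀) vert vert ≠ 0 := by
    obtain ⟨-, c, hc, hcF, hc0, hcd, hcdd⟩ := hfold s₀
    have hcU : ∀ᶠ t in 𝓝 0, c t ∈ U :=
      hc.continuous.continuousAt.eventually_mem (by rw [hc0]; exact hU.mem_nhds hpU)
    have h4 := fderiv_fderiv_add_eq_zero hU hpU hf hc hc0
      ((hcF.and hcU).mono fun t ht => (hFU.subset ht).2)
    intro h0
    rw [hcd, h0, zero_add] at h4
    exact hcdd (by rw [hfT₀]; exact h4)
  set a := inner ℝ (binormal γ s₀) vert with ha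
  have ha0 : a ≠ 0 := (inner_binormal_vert_pos hγ h s₀).ne'
  have hvexp : vert = (inner ℝ (deriv γ s₀) vert / ‖deriv γ s₀‖ ^ 2) • deriv γ s₀ +
      a • binormal γ s₀ := by
    have := frame_expansion hγ h s₀ vert
    rwa [inner_blackboardFraming_vert, zero_smul, add_zero] at this
  have hDb : fderiv ℝ f (γ s₀) (binormal γ s₀) = 0 := by
    have h1 := hDv
    rw [hvexp, map_add, map_smul, map_smul, hDT, smul_zero, zero_add, smul_eq_mul] at h1
    exact (mul_eq_zero.1 h1).resolve_left ha0
  -- The fold condition gives D²f(vert, vert) ≠ 0. Since `vert` is a combination of the velocity and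
  -- the binormal and the velocity contributes 0, the binormal must contribute.
  have hDDb : fderiv ℝ (fderiv ℝ f) (γ s₀) (binormal γ s₀) vert ≠ 0 := by
    intro h0
    apply hDDv
    have h1 : fderiv ℝ (fderiv ℝ f) (γ s₀) vert =
      (inner ℝ (deriv γ s₀) vert / ‖deriv γ s₀‖ ^ 2) • fderiv ℝ (fderiv ℝ f) (γ s₀) (deriv γ s₀) +
        a • fderiv ℝ (fderiv ℝ f) (γ s₀) (binormal γ s₀) := by
      rw [← map_smul, ← map_smul, ← map_add, ← hvexp]
    rw [h1]
    simp [hDDT, h0]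
  set T := deriv γ s₀ with hTdef
  -- The first two coordinates vanish on the vertical locus; the third is a parameter along `γ`. In
  -- the frame (velocity, β, b) the differential is invertible, as β is detected by `f`, b by the
  -- vertical derivative, and the velocity by the third coordinate.
  set G : Space → Space := fun q => !₂[f q, fderiv ℝ f q vert, inner ℝ T q] with hG
  have hGc : ContDiffOn ℝ ∞ G U := by
    rw [contDiffOn_euclidean]
    intro i
    fin_cases i
    · exact hf
    · exact hfd.clm_apply contDiffOn_const
    · exact (contDiff_const.inner ℝ contDiff_id).contDiffOn
  have hGd : ∀ v, fderiv ℝ G (γ s₀) v =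
      !₂[fderiv ℝ f (γ s₀) v, fderiv ℝ (fderiv ℝ f) (γ s₀) v vert, inner ℝ T v] := by
    intro v
    have hGat : HasFDerivAt G (fderiv ℝ G (γ s₀)) (γ s₀) :=
      ((hGc.contDiffAt (hU.mem_nhds hpU)).differentiableAt (by simp)).hasFDerivAt
    have hGi : ∀ i, HasFDerivAt (fun q => G q i) _ (γ s₀) := fun i =>
      (EuclideanSpace.proj (𝕜 := ℝ) i).hasFDerivAt.comp (γ s₀) hGat
    have h0 := DFunLike.congr_fun ((hGi 0).unique hf0) v
    have h1 := DFunLike.congr_fun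
      ((hGi 1).unique (hfd0.clm_apply (hasFDerivAt_const vert (γ s₀)))) v
    have h2 := DFunLike.congr_fun
      ((hGi 2).unique ((hasFDerivAt_const T (γ s₀)).inner ℝ (hasFDerivAt_id (γ s₀)))) v
    ext i
    fin_cases i
    · simpa using h0
    · simpa using h1
    · simpa using h2
  have hinj : Function.Injective (fderiv ℝ G (γ s₀)) := by
    rw [injective_iff_map_eq_zero]
    intro v hv
    rw [hGd] at hv
    have e0 : fderiv ℝ f (γ s₀) v = 0 := by simpa using congrArg (fun w : Space => w 0) hv
    have e1 : fderiv ℝ (fderiv ℝ f) (γ s₀) v vert = 0 := by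
      simpa using congrArg (fun w : Space => w 1) hv
    have e2 : inner ℝ T v = (0:ℝ) := by simpa using congrArg (fun w : Space => w 2) hv
    have key := apply_eq_inner_blackboardFraming_mul hγ h hDT hDb
    have hβ : fderiv ℝ f (γ s₀) (blackboardFraming γ s₀) ≠ 0 := fun h0 =>
      hf' _ hpU (by ext w; simp [key w, h0])
    have e3 : inner ℝ (blackboardFraming γ s₀) v = (0:ℝ) := by
      rw [key v] at e0
      exact (mul_eq_zero.1 e0).resolve_right hβ
    have e4 := frame_expansion hγ h s₀ v
    rw [← hTdef, e2, e3, zero_div, zero_smul, zero_smul, zero_add, zero_add] at e4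
    have e5 : inner ℝ (binormal γ s₀) v = (0:ℝ) := by
      rw [e4, map_smul, _root_.smul_apply, smul_eq_mul] at e1
      exact (mul_eq_zero.1 e1).resolve_right hDDb
    rw [e4, e5, zero_smul]
  obtain ⟨Φ, hΦ, hpΦ, hΦU, -⟩ := exists_openPartialHomeomorph_of_injective_fderiv hU hpU hGc hinj
  have hGeq : ∀ q ∈ U, q ∈ verticalLocus F → G q = !₂[0, 0, inner ℝ T q] := by
    intro q hqU hq
    rw [hG]
    beta_reduce
    rw [(hzero q hqU hq).1, (hzero q hqU hq).2]
  have hσ : HasStrictDerivAt (fun s => inner ℝ T (γ s)) (‖T‖ ^ 2) s₀ := by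
    have h1 : ContDiff ℝ ∞ fun s => inner ℝ T (γ s) := contDiff_const.inner ℝ hγ.contDiff
    refine (h1.contDiffAt.hasStrictDerivAt (by simp)).congr_deriv ?_
    have := ((hasDerivAt_const s₀ T).inner ℝ (hγ.hasDerivAt s₀)).deriv
    rw [this, inner_zero_left, add_zero, ← hTdef, real_inner_self_eq_norm_sq]
  have hT0 : ‖T‖ ^ 2 ≠ 0 := (pow_pos (norm_deriv_pos hγ s₀) 2).ne'
  -- Near its value at `γ s₀`, the third coordinate takes all values already on `γ`. So a nearby
  -- point of the locus has the same image under `G` as a point of `γ`, and equals it by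
  -- injectivity.
  have himg : (fun s => inner ℝ T (γ s)) '' (γ ⁻¹' Φ.source) ∈ 𝓝 (inner ℝ T (γ s₀)) := by
    rw [← hσ.map_nhds_eq hT0]
    exact image_mem_map (hγ.contDiff.continuous.continuousAt.preimage_mem_nhds
      (Φ.open_source.mem_nhds hpΦ))
  have hcont : ContinuousAt (fun q : Space => (inner ℝ T q : ℝ)) (γ s₀) := by fun_prop
  filter_upwards [Φ.open_source.mem_nhds hpΦ, hcont.preimage_mem_nhds himg] with q hqΦ hq hqF
  obtain ⟨s, hs, hsq⟩ := hq
  refine ⟨s, Φ.injOn hs hqΦ ?_⟩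
  rw [hΦ, hGeq _ (hΦU hs) (hfold s).1, hGeq _ (hΦU hqΦ) hqF]
  beta_reduce at hsq
  rw [hsq]

/-- The curve is compact, hence closed, and by `eventually_mem_range_of_isFoldPoint` it is
relatively open in the vertical locus. A connected subset of the locus that meets it cannot leave
it. -/
theorem isProfileCurve_of_isFoldPoint (hF : IsSmoothSurface F)
    (hγ : IsEmbeddedClosedCurve γ) (h : NowhereVertical γ)
    (hfold : ∀ s, IsFoldPoint F (γ s)) : IsProfileCurve γ F := by
  have hsub : range γ ⊆ verticalLocus F := range_subset_iff.2 fun s => (hfold s).1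
  refine Subset.antisymm ((isPreconnected_range hγ.contDiff.continuous).subset_connectedComponentIn
    (mem_range_self 0) hsub) fun q hq => ?_
  by_contra hqγ
  have hev := eventually_mem_range_of_isFoldPoint hF hγ h hfold
  have hC : IsPreconnected (connectedComponentIn (verticalLocus F) (γ 0)) :=
    isPreconnected_connectedComponentIn
  have h0 : γ 0 ∈ connectedComponentIn (verticalLocus F) (γ 0) :=
    mem_connectedComponentIn (hfold 0).1
  obtain ⟨x, hxC, hxO, hxγ⟩ := hC (interior {q | q ∈ verticalLocus F → q ∈ range γ}) (range γ)ᶜ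
    isOpen_interior (isOpen_compl_range hγ)
    (fun x _ => by
      by_cases hx : x ∈ range γ
      · obtain ⟨s, rfl⟩ := hx
        exact Or.inl (mem_interior_iff_mem_nhds.2 (hev s))
      · exact Or.inr hx)
    ⟨γ 0, h0, mem_interior_iff_mem_nhds.2 (hev 0)⟩ ⟨q, hq, hqγ⟩
  exact hxγ (interior_subset hxO (connectedComponentIn_subset _ _ hxC))

theorem IsProfileCurve.range_subset (hp : IsProfileCurve γ F) : range γ ⊆ verticalLocus F := by
  rw [hp]
  exact connectedComponentIn_subset _ _

end Vertical

/-! ### The two directions combined. -/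

/-- If the surface framing does not wind around the blackboard framing, then the surface is
carried by an ambient isotopy to one that folds along the curve. -/
theorem exists_ambient_isotopy_fold {F₀ : Set Space} {ν : Space → Space} {γ : ℝ → Space}
    (hF₀ : IsSmoothSurface F₀) (hν : IsUnitNormalField F₀ ν)
    (hγ : IsEmbeddedClosedCurve γ) (hγF : ∀ t, γ t ∈ F₀) (h : NowhereVertical γ) {θ : ℝ → ℝ}
    (hθ : ContDiff ℝ ∞ θ) (hνθ : ∀ t, ν (γ t) = frameVec γ t (θ t))
    (hp : Function.Periodic θ 1) :
    ∃ Φ : ℝ → Space → Space, IsAmbientIsotopyFixing γ Φ ∧ IsProfileCurve γ (Φ 1 '' F₀) ∧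
      ∀ t, IsFoldPoint (Φ 1 '' F₀) (γ t) := by
  obtain ⟨Φ, hΦ, hΦb⟩ := exists_rotation hγ h hθ hp
  have hF := hΦ.isSmoothSurface_image hF₀
  have hfix := hΦ.fixes 1 (by simp)
  obtain ⟨Ψ, hΨ, hfold⟩ := exists_fold hF hγ h (fun s => ⟨γ s, hγF s, hfix s⟩) fun s => by
    have h1 : frameVec γ s (θ s + Real.pi / 2) ∈ tangentPlane F₀ (γ s) := by
      rw [hν.mem_tangentPlane_iff hF₀ (hγF s), hνθ, inner_frameVec_frameVec hγ h]
      simp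
    have := fderiv_mem_tangentPlane_image (hΦ.diffeo 1 (by simp)).1 h1
    rwa [hΦb, hfix] at this
  have himg : (fun p => Ψ 1 (Φ 1 p)) '' F₀ = Ψ 1 '' (Φ 1 '' F₀) := by rw [image_image]
  have hfold' : ∀ s, IsFoldPoint ((fun p => Ψ 1 (Φ 1 p)) '' F₀) (γ s) := by rwa [himg]
  exact ⟨_, hΨ.comp hΦ, isProfileCurve_of_isFoldPoint ((hΨ.comp hΦ).isSmoothSurface_image hF₀)
    hγ h hfold', hfold'⟩

theorem framingNumber_eq_of_eventually {γ n : ℝ → Space} {x : ℝ}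
    (h : ∀ᶠ ε in 𝓝[>] (0 : ℝ), linkingNumber γ (pushOff γ n ε) = x) : framingNumber γ n = x :=
  (tendsto_const_nhds.congr' (h.mono fun _ hε => hε.symm)).limUnder_eq

/-- The first two conjuncts say that the writhe and the surface linking number are well defined,
the third is the equivalence. The last two sharpen its two directions: for "only if" it is enough
that the final surface has vertical tangent planes along `γ`, and for "if" the isotopy can be
taken to be ambient and the projection of the final surface to fold along `γ`. -/
theorem theorem3p1 (F₀ : Set Space) (ν : Space → Space) (γ : ℝ → Space)
    (hF₀ : IsSmoothSurface F₀) (hν : IsUnitNormalField F₀ ν)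
    (hγ : IsEmbeddedClosedCurve γ) (hγF : ∀ t, γ t ∈ F₀) (hvert : NowhereVertical γ) :
    (∀ᶠ ε in 𝓝[>] (0 : ℝ),
      (∀ s t, γ s ≠ pushOff γ (blackboardFraming γ) ε t) ∧
        linkingNumber γ (pushOff γ (blackboardFraming γ) ε) = writhe γ) ∧
    (∀ᶠ ε in 𝓝[>] (0 : ℝ),
      (∀ s t, γ s ≠ pushOff γ (surfaceFraming γ ν) ε t) ∧
        linkingNumber γ (pushOff γ (surfaceFraming γ ν) ε) = surfaceLinkingNumber γ ν) ∧
    ((∃ Φ : ℝ → Space → Space, IsIsotopyFixing F₀ γ Φ ∧ IsProfileCurve γ (Φ 1 '' F₀)) ↔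
      writhe γ = surfaceLinkingNumber γ ν) ∧
    ((∃ Φ : ℝ → Space → Space, IsIsotopyFixing F₀ γ Φ ∧
        range γ ⊆ verticalLocus (Φ 1 '' F₀)) →
      writhe γ = surfaceLinkingNumber γ ν) ∧
    (writhe γ = surfaceLinkingNumber γ ν →
      ∃ Φ : ℝ → Space → Space, IsAmbientIsotopyFixing γ Φ ∧ IsProfileCurve γ (Φ 1 '' F₀) ∧
        ∀ t, IsFoldPoint (Φ 1 '' F₀) (γ t)) := by
  obtain ⟨ε₀, A, M, hε₀, hM, hlk⟩ := exists_linkingNumber_formula hγ hvert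
  obtain ⟨θ, k, hθ, hνθ, hk⟩ := exists_normal_angle hF₀ hν hγ hγF hvert
  have hev : ∀ᶠ ε in 𝓝[>] (0 : ℝ), 0 < ε ∧ ε < ε₀ := Ioo_mem_nhdsGT hε₀
  have hβ : blackboardFraming γ = fun t => frameVec γ t 0 :=
    funext (blackboardFraming_eq_frameVec γ)
  have hs : surfaceFraming γ ν = fun t => frameVec γ t (θ t) := funext hνθ
  have hwev : ∀ᶠ ε in 𝓝[>] (0 : ℝ), (∀ s t, γ s ≠ pushOff γ (blackboardFraming γ) ε t) ∧
      linkingNumber γ (pushOff γ (blackboardFraming γ) ε) = A := by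
    filter_upwards [hev] with ε hε
    rw [hβ]
    simpa using hlk (fun _ => 0) 0 contDiff_const (by simp) ε hε.1 hε.2
  have hlev : ∀ᶠ ε in 𝓝[>] (0 : ℝ), (∀ s t, γ s ≠ pushOff γ (surfaceFraming γ ν) ε t) ∧
      linkingNumber γ (pushOff γ (surfaceFraming γ ν) ε) = A + k * M := by
    filter_upwards [hev] with ε hε
    rw [hs]
    exact hlk θ k hθ hk ε hε.1 hε.2
  have hw : writhe γ = A := framingNumber_eq_of_eventually (hwev.mono fun _ hε => hε.2)
  have hl : surfaceLinkingNumber γ ν = A + k * M :=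
    framingNumber_eq_of_eventually (hlev.mono fun _ hε => hε.2)
  -- Both numbers are values of the same injective affine function, at the winding numbers 0 and
  -- `k`.
  have hiff : writhe γ = surfaceLinkingNumber γ ν ↔ k = 0 := by
    rw [hw, hl, left_eq_add, mul_eq_zero, or_iff_left hM, Int.cast_eq_zero]
  have honly : (∃ Φ : ℝ → Space → Space, IsIsotopyFixing F₀ γ Φ ∧
      range γ ⊆ verticalLocus (Φ 1 '' F₀)) → writhe γ = surfaceLinkingNumber γ ν := by
    rintro ⟨Φ, hΦ, hvl⟩
    exact hiff.2 (hΦ.winding_eq_zero hF₀ hν hγ hγF hvert hvl hθ.continuous hνθ hk)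
  have hif : writhe γ = surfaceLinkingNumber γ ν →
      ∃ Φ : ℝ → Space → Space, IsAmbientIsotopyFixing γ Φ ∧ IsProfileCurve γ (Φ 1 '' F₀) ∧
        ∀ t, IsFoldPoint (Φ 1 '' F₀) (γ t) := fun heq =>
    exists_ambient_isotopy_fold hF₀ hν hγ hγF hvert hθ hνθ fun t => by
      rw [hk, hiff.1 heq]; simp
  refine ⟨by rwa [hw], by rwa [hl], ⟨?_, ?_⟩, honly, hif⟩
  · rintro ⟨Φ, hΦ, hpc⟩
    exact honly ⟨Φ, hΦ, hpc.range_subset⟩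
  · intro heq
    obtain ⟨Φ, hΦ, hpc, -⟩ := hif heq
    exact ⟨Φ, hΦ.isIsotopyFixing F₀, hpc⟩
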